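/- Let $(D;D_1,D_2;M)$ be a (smooth, locally decomposable) double vector bundle with projections $\pi_1:D\to D_1$, $\pi_2:D\to D_2$ and core $D_3\to M$; the additions of $D\to D_1$ and $D\to D_2$ are denoted $+_1$ and $+_2$. Let $l_1,l_2$ be fibrewise non-zero linear functions on $D_1$, $D_2$, and let $\sigma$ be a nowhere vanishing section of $D_3$, viewed as the linear function $l_3(\kappa)=\langle\kappa,\sigma\rangle$ on $D_3^*$. Put $A_i=\{l_i=1\}\subset D_i$ and $A=\{x\in D: l_1(\pi_1x)=1,\ l_2(\pi_2x)=1\}$. A core element $c$ over $m$ acts on $x\in D$ over $m$ by $x+c:=x+_1(0_{\pi_1x}+_2c)$. Let $D^V=(D^{*D_1};D_1,D_3^*;M)$ be the vertical dual, i.e. the dual bundle of $\pi_1$, with projection $\varphi\mapsto\kappa$ to $D_3^*$ given by $\langle\kappa,c\rangle=\langle\varphi,0+_2c\rangle$ and operations over $D_3^*$ given by $\langle\varphi+_2\psi,x+_2y\rangle=\langle\varphi,x\rangle+\langle\psi,y\rangle$ and $\langle t\cdot_2\varphi,t\cdot_2x\rangle=t\langle\varphi,x\rangle$. Let $A^\#$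 be the special affine dual of $A\to A_1$: its fibre over $a\in A_1$ consists of the affine functions $f$ on $A_a=A\cap\pi_1^{-1}(a)$ with $f(x+\sigma)=f(x)+1$. Let $D_3^\ddagger=\{\kappa\in D_3^*:\langle\kappa,\sigma\rangle=1\}$. The square $(A^\#;A_1,D_3^\ddagger;M)$ has as projection $A^\#\to D_3^\ddagger$ the map $f\mapsto\kappa$, $\langle\kappa,c\rangle=f(x+c)-f(x)$; affine combinations are pointwise over $A_1$, and over $D_3^\ddagger$ they are given by $\mathrm{aff}_2(f,g;t)(\mathrm{aff}_2(x,y;t))=tf(x)+(1-t)g(y)$ for $x\in A_a$, $y\in A_b$ with $\pi_2x=\pi_2y$, where $f,g$ lie over $a,b$. Then: 1. $D^V$ is a double vector bundle, $l_3$ is a fibrewise non-zero linear function on $D_3^*$, and the subset of $D^V$ on which the pullbacks of $l_1$ and $l_3$ equal $1$, with sides $A_1$ and $\{l_3=1\}=D_3^\ddagger$, is a double affine bundle; so is $(A^\#;A_1,D_3^\ddagger;M)$. 2. Restriction of functionals, $\varphi\mapsto\varphi|_{A_a}$ for $\varphi$ over $a\in A_1$, is an isomorphism of double affine bundles from the former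 onto the latter, which is the identity on $A_1$ and on $D_3^\ddagger$. 3. The vector bundle $D_2^*$ is isomorphic to the core of $D^V$, where $\lambda\in D_2^*$ corresponds to the functional $x\mapsto\lambda(\pi_2x)$ on the fibre of $\pi_1$ over the zero vector. It is also isomorphic, by restriction $\lambda\mapsto\lambda|_{A_2}$, to the bundle $A_2^\dagger$ of affine functions on the fibres of $A_2\to M$. The isomorphism of 2 carries translation by the core element $\lambda$ to $f\mapsto f+\lambda|_{A_2}\circ\pi_2$. The function $l_2$ is a nowhere vanishing section of the core $D_2^*$ of $D^V$, and under these identifications it corresponds to the constant function $1_{A_2}\in\mathrm{Sec}_M(A_2^\dagger)$. -/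

import Mathlib

open Diffeology
open scoped ContDiff Manifold Topology

noncomputable section

namespace DoubleAffine

/-! ### Smooth structures

Smooth manifolds are treated inside the category of diffeological spaces, in which they form a full
subcategory: the diffeology of a manifold consists of its smooth parametrisations, and the maps
which are smooth for the diffeologies are the smooth maps. -/

/-- The coordinate space `ℝᵏ`. -/
abbrev Coord (k : ℕ) : Type := EuclideanSpace ℝ (Fin k)

/-- The diffeology of `M` is that of a manifold: its plots are the smooth maps `ℝⁿ → M`. -/
class IsManifoldDiffeology (E : Type*) [NormedAddCommGroup E] [NormedSpace ℝ E] (M : Type*)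
    [TopologicalSpace M] [ChartedSpace E M] [DiffeologicalSpace M] : Prop where
  isPlot_iff : ∀ (n : ℕ) (p : Coord n → M), IsPlot p ↔ ContMDiff 𝓘(ℝ, Coord n) 𝓘(ℝ, E) ∞ p

/-- The subspace diffeology. -/
instance subtypeDiffeology {X : Type*} [DiffeologicalSpace X] {P : X → Prop} :
    DiffeologicalSpace {x : X // P x} where
  plots _ := {c | IsPlot fun u => (c u).1}
  constant_plots _ := isPlot_const
  plot_reparam hp hf := isPlot_reparam (X := X) hp hf
  locality hp := DiffeologicalSpace.locality fun u => by
    obtain ⟨V, hV, huV, h⟩ := hp u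
    exact ⟨V, hV, huV, fun hf hs => h hf hs⟩

/-- The product diffeology. -/
instance prodDiffeology {X Y : Type*} [DiffeologicalSpace X] [DiffeologicalSpace Y] :
    DiffeologicalSpace (X × Y) where
  plots _ := {c | (IsPlot fun u => (c u).1) ∧ IsPlot fun u => (c u).2}
  constant_plots _ := ⟨isPlot_const, isPlot_const⟩
  plot_reparam hp hf := ⟨isPlot_reparam (X := X) hp.1 hf, isPlot_reparam (X := Y) hp.2 hf⟩
  locality hp := ⟨DiffeologicalSpace.locality fun u => by
      obtain ⟨V, hV, huV, h⟩ := hp u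
      exact ⟨V, hV, huV, fun hf hs => (h hf hs).1⟩,
    DiffeologicalSpace.locality fun u => by
      obtain ⟨V, hV, huV, h⟩ := hp u
      exact ⟨V, hV, huV, fun hf hs => (h hf hs).2⟩⟩

/-- A bijection that is smooth together with its inverse. -/
def IsDiffeo {X Y : Type*} [DiffeologicalSpace X] [DiffeologicalSpace Y] (e : X ≃ Y) : Prop :=
  DSmooth e ∧ DSmooth e.symm

/-- A smooth real function on one fibre `p ⁻¹ {base}` of a map `p : E → B`, extended by zero to `E`
(so that it is determined by its values on the fibre). -/
structure FibreFunction {E B : Type*} [DiffeologicalSpace E] (p : E → B) where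
  base : B
  val : E → ℝ
  val_off : ∀ x, p x ≠ base → val x = 0
  smooth : ∀ (n : ℕ) (c : Coord n → E), IsPlot c → (∀ u, p (c u) = base) →
    IsPlot fun u => val (c u)

/-- A family of functions on fibres is smooth when its base point is smooth and its
value at any smoothly varying point of the fibres is smooth.  (On fibrewise linear or affine
functions on a bundle this is smoothness of the coefficients in a local trivialization, that is,
the usual smooth structure of the dual bundle.) -/
instance fibreFunctionDiffeology {E B : Type*} [DiffeologicalSpace E] [DiffeologicalSpace B]
    {p : E → B} : DiffeologicalSpace (FibreFunction p) where
  plots n := {c | (IsPlot fun u => (c u).base) ∧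
    ∀ (k : ℕ) (s : Coord k → Coord n) (x : Coord k → E), ContDiff ℝ ∞ s → IsPlot x →
      (∀ v, p (x v) = (c (s v)).base) → IsPlot fun v => (c (s v)).val (x v)}
  constant_plots f := ⟨isPlot_const, fun k _ x _ hx h => f.smooth k x hx h⟩
  plot_reparam hp hf := ⟨isPlot_reparam (X := B) hp.1 hf, fun k s x hs hx h =>
    hp.2 k (_ ∘ s) x (hf.comp hs) hx h⟩
  locality {n c} hp := by
    refine ⟨DiffeologicalSpace.locality fun u => ?_, fun k s x hs hx hb =>
      DiffeologicalSpace.locality fun v => ?_⟩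
    · obtain ⟨V, hV, huV, h⟩ := hp u
      exact ⟨V, hV, huV, fun hf hs => (h hf hs).1⟩
    · obtain ⟨V, hV, huV, h⟩ := hp (s v)
      refine ⟨s ⁻¹' V, hV.preimage hs.continuous, huV, fun {m f} hf hfs => ?_⟩
      exact (h (f := s ∘ f) hf (hs.comp hfs)).2 m id (x ∘ f) contDiff_id
        (isPlot_reparam hx hfs) fun w => hb (f w)

/-- The element with the property `P` (used where there is exactly one), with default value `d`. -/
def pick {α : Type*} (d : α) (P : α → Prop) : α :=
  open Classical in if h : ∃ a, P a then h.choose else d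

/-! ### Vector and affine bundles: the structure maps -/

/-- Projection and fibrewise operations of a vector bundle; `add x y` is only meaningful for `x`
and `y` in the same fibre. -/
structure VectorBundleData (E B : Type*) where
  proj : E → B
  add : E → E → E
  smul : ℝ → E → E

/-- Projection and fibrewise affine combinations of an affine bundle: `aff x y t` is the
combination of `x` and `y` with weights `t` and `1 - t`, and is only meaningful for `x` and `y` in
the same fibre. -/
structure AffineBundleData (E B : Type*) where
  proj : E → B
  aff : E → E → ℝ → E

namespace VectorBundleData

variable {E B : Type*} (ξ : VectorBundleData E B)

/-- `x` is the zero vector of its fibre. -/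
def IsZero (x : E) : Prop := ξ.smul 0 x = x

/-- The operations stay in the fibres. -/
def FibrePreserving : Prop :=
  (∀ x y, ξ.proj x = ξ.proj y → ξ.proj (ξ.add x y) = ξ.proj x) ∧
    ∀ t x, ξ.proj (ξ.smul t x) = ξ.proj x

/-- The affine combinations of a vector bundle. -/
def toAffine : AffineBundleData E B where
  proj := ξ.proj
  aff x y t := ξ.add (ξ.smul t x) (ξ.smul (1 - t) y)

/-- The operations restricted to a subset (closed under them). -/
def restrict {C : Type*} (P : E → Prop) (proj : {x : E // P x} → C) :
    VectorBundleData {x : E // P x} C where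
  proj := proj
  add x y := pick x fun z => z.1 = ξ.add x.1 y.1
  smul t x := pick x fun z => z.1 = ξ.smul t x.1

/-- A smooth function that is linear on every fibre. -/
structure IsLinearFunction [DiffeologicalSpace E] (l : E → ℝ) : Prop where
  smooth : DSmooth l
  map_add : ∀ x y, ξ.proj x = ξ.proj y → l (ξ.add x y) = l x + l y
  map_smul : ∀ t x, l (ξ.smul t x) = t * l x

/-- `l` vanishes identically on no fibre. -/
def FibrewiseNonzero (l : E → ℝ) : Prop := ∀ b, ∃ x, ξ.proj x = b ∧ l x ≠ 0

/-- The total space of the dual bundle: linear functions on the fibres. -/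
def Dual [DiffeologicalSpace E] : Type _ :=
  {f : FibreFunction ξ.proj //
    (∀ x y, ξ.proj x = f.base → ξ.proj y = f.base → f.val (ξ.add x y) = f.val x + f.val y) ∧
    ∀ t x, ξ.proj x = f.base → f.val (ξ.smul t x) = t * f.val x}

instance [DiffeologicalSpace E] [DiffeologicalSpace B] : DiffeologicalSpace ξ.Dual :=
  inferInstanceAs (DiffeologicalSpace (Subtype _))

/-- The zero functional on the fibre over `b`. -/
def zeroDual [DiffeologicalSpace E] (b : B) : ξ.Dual :=
  ⟨⟨b, fun _ => 0, fun _ _ => rfl, fun _ _ _ _ => isPlot_const⟩,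
    fun _ _ _ _ => (add_zero 0).symm, fun t _ _ => (mul_zero t).symm⟩

/-- The dual vector bundle, with pointwise operations. -/
def dual [DiffeologicalSpace E] : VectorBundleData ξ.Dual B where
  proj f := f.1.base
  add f g := pick f fun h => h.1.base = f.1.base ∧
    ∀ x, ξ.proj x = f.1.base → h.1.val x = f.1.val x + g.1.val x
  smul t f := pick f fun h => h.1.base = f.1.base ∧
    ∀ x, ξ.proj x = f.1.base → h.1.val x = t * f.1.val x

end VectorBundleData

/-- An isomorphism of vector bundles over the identity of the base. -/
structure IsVectorBundleIso {E E' B : Type*} [DiffeologicalSpace E] [DiffeologicalSpace E']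
    (ξ : VectorBundleData E B) (η : VectorBundleData E' B) (e : E ≃ E') : Prop where
  diffeo : IsDiffeo e
  proj : ∀ x, η.proj (e x) = ξ.proj x
  map_add : ∀ x y, ξ.proj x = ξ.proj y → e (ξ.add x y) = η.add (e x) (e y)
  map_smul : ∀ t x, e (ξ.smul t x) = η.smul t (e x)

namespace AffineBundleData

variable {E B : Type*} (ζ : AffineBundleData E B)

/-- Affine combinations stay in the fibres. -/
def FibrePreserving : Prop :=
  ∀ x y t, ζ.proj x = ζ.proj y → ζ.proj (ζ.aff x y t) = ζ.proj x

/-- Affine combinations restricted to a subset (closed under them). -/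
def restrict {C : Type*} (P : E → Prop) (proj : {x : E // P x} → C) :
    AffineBundleData {x : E // P x} C where
  proj := proj
  aff x y t := pick x fun z => z.1 = ζ.aff x.1 y.1 t

/-- The function `f` on a fibre is an affine map. -/
def IsAffineMap [DiffeologicalSpace E] (f : FibreFunction ζ.proj) : Prop :=
  ∀ x y t, ζ.proj x = f.base → ζ.proj y = f.base →
    f.val (ζ.aff x y t) = t * f.val x + (1 - t) * f.val y

/-- The total space of the bundle `A†` of affine functions on the fibres of an affine bundle. -/
def AffineFunctions [DiffeologicalSpace E] : Type _ :=
  {f : FibreFunction ζ.proj // ζ.IsAffineMap f}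

instance [DiffeologicalSpace E] [DiffeologicalSpace B] : DiffeologicalSpace ζ.AffineFunctions :=
  inferInstanceAs (DiffeologicalSpace (Subtype _))

/-- The vector bundle `A†`, with pointwise operations. -/
def affineFunctions [DiffeologicalSpace E] : VectorBundleData ζ.AffineFunctions B where
  proj f := f.1.base
  add f g := pick f fun h => h.1.base = f.1.base ∧
    ∀ x, ζ.proj x = f.1.base → h.1.val x = f.1.val x + g.1.val x
  smul t f := pick f fun h => h.1.base = f.1.base ∧
    ∀ x, ζ.proj x = f.1.base → h.1.val x = t * f.1.val x

end AffineBundleData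

/-! ### Double vector bundles -/

/-- The structure maps of a double vector bundle `(D; D₁, D₂; M)`:
`left : D → D₁`, `top : D → D₂`, `bot : D₁ → M`, `right : D₂ → M`. -/
structure DoubleVectorBundleData (D D₁ D₂ M : Type*) where
  left : VectorBundleData D D₁
  top : VectorBundleData D D₂
  bot : VectorBundleData D₁ M
  right : VectorBundleData D₂ M

section DoubleVector

variable {D D₁ D₂ M : Type*} [DiffeologicalSpace D] [DiffeologicalSpace D₁] [DiffeologicalSpace D₂]
  [DiffeologicalSpace M]

/-- An isomorphism of the part of a double vector bundle lying over `U ⊆ M` with the trivial double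
vector bundle `(U × ℝᵏ¹ × ℝᵏ² × ℝᵏ³; U × ℝᵏ¹, U × ℝᵏ²; U)`. -/
structure DoubleVectorTrivialization (𝔻 : DoubleVectorBundleData D D₁ D₂ M) (U : Set M)
    (k₁ k₂ k₃ : ℕ) where
  e₁ : {y : D₁ // 𝔻.bot.proj y ∈ U} ≃ U × Coord k₁
  e₂ : {z : D₂ // 𝔻.right.proj z ∈ U} ≃ U × Coord k₂
  e : {x : D // 𝔻.bot.proj (𝔻.left.proj x) ∈ U} ≃ U × Coord k₁ × Coord k₂ × Coord k₃
  diffeo₁ : IsDiffeo e₁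
  diffeo₂ : IsDiffeo e₂
  diffeo : IsDiffeo e
  base₁ : ∀ y, ((e₁ y).1 : M) = 𝔻.bot.proj y
  base₂ : ∀ z, ((e₂ z).1 : M) = 𝔻.right.proj z
  base : ∀ x, ((e x).1 : M) = 𝔻.bot.proj (𝔻.left.proj x)
  left_proj : ∀ x y, 𝔻.left.proj x.1 = y.1 → (e x).2.1 = (e₁ y).2
  top_proj : ∀ x z, 𝔻.top.proj x.1 = z.1 → (e x).2.2.1 = (e₂ z).2
  bot_add : ∀ x y z, 𝔻.bot.proj x.1 = 𝔻.bot.proj y.1 → z.1 = 𝔻.bot.add x.1 y.1 →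
    (e₁ z).2 = (e₁ x).2 + (e₁ y).2
  bot_smul : ∀ t x z, z.1 = 𝔻.bot.smul t x.1 → (e₁ z).2 = t • (e₁ x).2
  right_add : ∀ x y z, 𝔻.right.proj x.1 = 𝔻.right.proj y.1 → z.1 = 𝔻.right.add x.1 y.1 →
    (e₂ z).2 = (e₂ x).2 + (e₂ y).2
  right_smul : ∀ t x z, z.1 = 𝔻.right.smul t x.1 → (e₂ z).2 = t • (e₂ x).2
  left_add : ∀ x y z, 𝔻.left.proj x.1 = 𝔻.left.proj y.1 → z.1 = 𝔻.left.add x.1 y.1 →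
    (e z).2.2 = (e x).2.2 + (e y).2.2
  left_smul : ∀ t x z, z.1 = 𝔻.left.smul t x.1 → (e z).2.2 = t • (e x).2.2
  top_add : ∀ x y z, 𝔻.top.proj x.1 = 𝔻.top.proj y.1 → z.1 = 𝔻.top.add x.1 y.1 →
    (e z).2.1 = (e x).2.1 + (e y).2.1 ∧ (e z).2.2.2 = (e x).2.2.2 + (e y).2.2.2
  top_smul : ∀ t x z, z.1 = 𝔻.top.smul t x.1 →
    (e z).2.1 = t • (e x).2.1 ∧ (e z).2.2.2 = t • (e x).2.2.2

/-- `𝔻` is a double vector bundle: a commuting square of four vector bundles with smooth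
projections that are vector bundle morphisms and with commuting homotheties, locally (over `M`) isomorphic to a
trivial double vector bundle. -/
structure IsDoubleVectorBundle (𝔻 : DoubleVectorBundleData D D₁ D₂ M) : Prop where
  smooth_left : DSmooth 𝔻.left.proj
  smooth_top : DSmooth 𝔻.top.proj
  smooth_bot : DSmooth 𝔻.bot.proj
  smooth_right : DSmooth 𝔻.right.proj
  comm : ∀ x, 𝔻.bot.proj (𝔻.left.proj x) = 𝔻.right.proj (𝔻.top.proj x)
  left_fibre : 𝔻.left.FibrePreserving
  top_fibre : 𝔻.top.FibrePreserving
  bot_fibre : 𝔻.bot.FibrePreserving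
  right_fibre : 𝔻.right.FibrePreserving
  top_proj_add : ∀ x y, 𝔻.left.proj x = 𝔻.left.proj y →
    𝔻.top.proj (𝔻.left.add x y) = 𝔻.right.add (𝔻.top.proj x) (𝔻.top.proj y)
  top_proj_smul : ∀ t x, 𝔻.top.proj (𝔻.left.smul t x) = 𝔻.right.smul t (𝔻.top.proj x)
  left_proj_add : ∀ x y, 𝔻.top.proj x = 𝔻.top.proj y →
    𝔻.left.proj (𝔻.top.add x y) = 𝔻.bot.add (𝔻.left.proj x) (𝔻.left.proj y)
  left_proj_smul : ∀ t x, 𝔻.left.proj (𝔻.top.smul t x) = 𝔻.bot.smul t (𝔻.left.proj x)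
  homothety_comm : ∀ s t x,
    𝔻.left.smul s (𝔻.top.smul t x) = 𝔻.top.smul t (𝔻.left.smul s x)
  locally_trivial : ∀ m : M, ∃ U : Set M, IsOpen[dTopology] U ∧ m ∈ U ∧
    ∃ k₁ k₂ k₃ : ℕ, Nonempty (DoubleVectorTrivialization 𝔻 U k₁ k₂ k₃)

namespace DoubleVectorBundleData

variable (𝔻 : DoubleVectorBundleData D D₁ D₂ M)

/-- The total space of the core `D₃`: the elements lying over zero vectors of `D₁` and `D₂`. -/
def Core : Type _ :=
  {c : D // 𝔻.bot.IsZero (𝔻.left.proj c) ∧ 𝔻.right.IsZero (𝔻.top.proj c)}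

instance : DiffeologicalSpace 𝔻.Core := inferInstanceAs (DiffeologicalSpace (Subtype _))

/-- The core bundle `D₃ → M` (both additions of `D` agree on it). -/
def core : VectorBundleData 𝔻.Core M :=
  𝔻.left.restrict _ fun c => 𝔻.bot.proj (𝔻.left.proj c.1)

/-- The vector in the fibre of `D → D₁` through `x` which is defined by the core element `c`:
the sum `0 +₂ c` of the zero vector of that fibre and `c`. -/
def coreVector (x c : D) : D := 𝔻.top.add (𝔻.left.smul 0 x) c

/-- The translate of `x` by the core element `c`. -/
def translate (x c : D) : D := 𝔻.left.add x (𝔻.coreVector x c)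

/-- The vertical dual `(D*₁; D₁, D₃*; M)`, the dual of `D → D₁`. The projection to `D₃*` is
`⟨κ, c⟩ = ⟨φ, 0 +₂ c⟩`. The operations over `D₃*` are
`⟨φ +₂ ψ, x +₂ y⟩ = ⟨φ, x⟩ + ⟨ψ, y⟩` and `⟨t ·₂ φ, t ·₂ x⟩ = t ⟨φ, x⟩`. -/
def verticalDual : DoubleVectorBundleData 𝔻.left.Dual D₁ 𝔻.core.Dual M where
  left := 𝔻.left.dual
  bot := 𝔻.bot
  right := 𝔻.core.dual
  top :=
    let res : 𝔻.left.Dual → 𝔻.core.Dual := fun φ =>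
      pick (𝔻.core.zeroDual (𝔻.bot.proj φ.1.base)) fun κ =>
        κ.1.base = 𝔻.bot.proj φ.1.base ∧ ∀ (x : D) (c : 𝔻.Core), 𝔻.left.proj x = φ.1.base →
          𝔻.core.proj c = κ.1.base → κ.1.val c = φ.1.val (𝔻.coreVector x c.1)
    { proj := res
      add := fun φ ψ => pick φ fun χ =>
        χ.1.base = 𝔻.bot.add φ.1.base ψ.1.base ∧ res χ = res φ ∧
          ∀ x y, 𝔻.left.proj x = φ.1.base → 𝔻.left.proj y = ψ.1.base →
            𝔻.top.proj x = 𝔻.top.proj y →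
            χ.1.val (𝔻.top.add x y) = φ.1.val x + ψ.1.val y
      smul := fun t φ => pick φ fun χ =>
        χ.1.base = 𝔻.bot.smul t φ.1.base ∧ res χ = res φ ∧
          ∀ x, 𝔻.left.proj x = φ.1.base → χ.1.val (𝔻.top.smul t x) = t * φ.1.val x }

end DoubleVectorBundleData

end DoubleVector

/-! ### Double affine bundles -/

/-- The structure maps of a double affine bundle `(A; A₁, A₂; M)`. -/
structure DoubleAffineBundleData (A A₁ A₂ M : Type*) where
  left : AffineBundleData A A₁
  top : AffineBundleData A A₂
  bot : AffineBundleData A₁ M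
  right : AffineBundleData A₂ M

section DoubleAffineBundles

variable {A A₁ A₂ M : Type*} [DiffeologicalSpace A] [DiffeologicalSpace A₁] [DiffeologicalSpace A₂]
  [DiffeologicalSpace M]

/-- An isomorphism of the part of a double affine bundle lying over `U ⊆ M` with the trivial double
affine bundle `(U × ℝᵏ¹ × ℝᵏ² × ℝᵏ³; U × ℝᵏ¹, U × ℝᵏ²; U)`. -/
structure DoubleAffineTrivialization (𝔸 : DoubleAffineBundleData A A₁ A₂ M) (U : Set M)
    (k₁ k₂ k₃ : ℕ) where
  e₁ : {y : A₁ // 𝔸.bot.proj y ∈ U} ≃ U × Coord k₁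
  e₂ : {z : A₂ // 𝔸.right.proj z ∈ U} ≃ U × Coord k₂
  e : {x : A // 𝔸.bot.proj (𝔸.left.proj x) ∈ U} ≃ U × Coord k₁ × Coord k₂ × Coord k₃
  diffeo₁ : IsDiffeo e₁
  diffeo₂ : IsDiffeo e₂
  diffeo : IsDiffeo e
  base₁ : ∀ y, ((e₁ y).1 : M) = 𝔸.bot.proj y
  base₂ : ∀ z, ((e₂ z).1 : M) = 𝔸.right.proj z
  base : ∀ x, ((e x).1 : M) = 𝔸.bot.proj (𝔸.left.proj x)
  left_proj : ∀ x y, 𝔸.left.proj x.1 = y.1 → (e x).2.1 = (e₁ y).2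
  top_proj : ∀ x z, 𝔸.top.proj x.1 = z.1 → (e x).2.2.1 = (e₂ z).2
  bot_aff : ∀ x y z t, 𝔸.bot.proj x.1 = 𝔸.bot.proj y.1 → z.1 = 𝔸.bot.aff x.1 y.1 t →
    (e₁ z).2 = t • (e₁ x).2 + (1 - t) • (e₁ y).2
  right_aff : ∀ x y z t, 𝔸.right.proj x.1 = 𝔸.right.proj y.1 → z.1 = 𝔸.right.aff x.1 y.1 t →
    (e₂ z).2 = t • (e₂ x).2 + (1 - t) • (e₂ y).2
  left_aff : ∀ x y z t, 𝔸.left.proj x.1 = 𝔸.left.proj y.1 → z.1 = 𝔸.left.aff x.1 y.1 t →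
    (e z).2.2 = t • (e x).2.2 + (1 - t) • (e y).2.2
  top_aff : ∀ x y z t, 𝔸.top.proj x.1 = 𝔸.top.proj y.1 → z.1 = 𝔸.top.aff x.1 y.1 t →
    (e z).2.1 = t • (e x).2.1 + (1 - t) • (e y).2.1 ∧
      (e z).2.2.2 = t • (e x).2.2.2 + (1 - t) • (e y).2.2.2

/-- `𝔸` is a double affine bundle: a commuting square of affine bundles, such that the (smooth)
projections of `A` are morphisms of affine bundles, `A → A₁ ×_M A₂` is surjective, the affine combinations
satisfy the interchange law, and `𝔸` is locally (over `M`) isomorphic to a trivial double affine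
bundle. -/
structure IsDoubleAffineBundle (𝔸 : DoubleAffineBundleData A A₁ A₂ M) : Prop where
  smooth_left : DSmooth 𝔸.left.proj
  smooth_top : DSmooth 𝔸.top.proj
  smooth_bot : DSmooth 𝔸.bot.proj
  smooth_right : DSmooth 𝔸.right.proj
  comm : ∀ x, 𝔸.bot.proj (𝔸.left.proj x) = 𝔸.right.proj (𝔸.top.proj x)
  left_fibre : 𝔸.left.FibrePreserving
  top_fibre : 𝔸.top.FibrePreserving
  bot_fibre : 𝔸.bot.FibrePreserving
  right_fibre : 𝔸.right.FibrePreserving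
  top_proj_aff : ∀ x y t, 𝔸.left.proj x = 𝔸.left.proj y →
    𝔸.top.proj (𝔸.left.aff x y t) = 𝔸.right.aff (𝔸.top.proj x) (𝔸.top.proj y) t
  left_proj_aff : ∀ x y t, 𝔸.top.proj x = 𝔸.top.proj y →
    𝔸.left.proj (𝔸.top.aff x y t) = 𝔸.bot.aff (𝔸.left.proj x) (𝔸.left.proj y) t
  surjective : ∀ a₁ a₂, 𝔸.bot.proj a₁ = 𝔸.right.proj a₂ →
    ∃ x, 𝔸.left.proj x = a₁ ∧ 𝔸.top.proj x = a₂
  interchange : ∀ (x x' y y' : A) (s t : ℝ), 𝔸.left.proj x = 𝔸.left.proj x' →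
    𝔸.left.proj y = 𝔸.left.proj y' → 𝔸.top.proj x = 𝔸.top.proj y →
    𝔸.top.proj x' = 𝔸.top.proj y' →
    𝔸.top.aff (𝔸.left.aff x x' s) (𝔸.left.aff y y' s) t =
      𝔸.left.aff (𝔸.top.aff x y t) (𝔸.top.aff x' y' t) s
  locally_trivial : ∀ m : M, ∃ U : Set M, IsOpen[dTopology] U ∧ m ∈ U ∧
    ∃ k₁ k₂ k₃ : ℕ, Nonempty (DoubleAffineTrivialization 𝔸 U k₁ k₂ k₃)

/-- An isomorphism of double affine bundles which is the identity on both side bundles. -/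
structure IsDoubleAffineIso {A' : Type*} [DiffeologicalSpace A']
    (𝔸 : DoubleAffineBundleData A A₁ A₂ M) (𝔸' : DoubleAffineBundleData A' A₁ A₂ M)
    (e : A ≃ A') : Prop where
  diffeo : IsDiffeo e
  bot_eq : 𝔸'.bot = 𝔸.bot
  right_eq : 𝔸'.right = 𝔸.right
  left_proj : ∀ x, 𝔸'.left.proj (e x) = 𝔸.left.proj x
  top_proj : ∀ x, 𝔸'.top.proj (e x) = 𝔸.top.proj x
  left_aff : ∀ x y t, 𝔸.left.proj x = 𝔸.left.proj y →
    e (𝔸.left.aff x y t) = 𝔸'.left.aff (e x) (e y) t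
  top_aff : ∀ x y t, 𝔸.top.proj x = 𝔸.top.proj y →
    e (𝔸.top.aff x y t) = 𝔸'.top.aff (e x) (e y) t

end DoubleAffineBundles

section Special

variable {D D₁ D₂ M : Type*} [DiffeologicalSpace D] [DiffeologicalSpace D₁] [DiffeologicalSpace D₂]
  [DiffeologicalSpace M]

/-- The double affine bundle given in `𝔻` by means of the linear functions `l₁` and `l₂` on the side
bundles: the subset of `D` on which the pullbacks of `l₁` and `l₂` are `1`, with sides `{l₁ = 1}` and
`{l₂ = 1}`. -/
def levelSet (𝔻 : DoubleVectorBundleData D D₁ D₂ M) (l₁ : D₁ → ℝ) (l₂ : D₂ → ℝ) :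
    DoubleAffineBundleData {x : D // l₁ (𝔻.left.proj x) = 1 ∧ l₂ (𝔻.top.proj x) = 1}
      {y : D₁ // l₁ y = 1} {z : D₂ // l₂ z = 1} M where
  left := 𝔻.left.toAffine.restrict _ fun x => ⟨𝔻.left.proj x.1, x.2.1⟩
  top := 𝔻.top.toAffine.restrict _ fun x => ⟨𝔻.top.proj x.1, x.2.2⟩
  bot := 𝔻.bot.toAffine.restrict _ fun y => 𝔻.bot.proj y.1
  right := 𝔻.right.toAffine.restrict _ fun z => 𝔻.right.proj z.1

/-- `σ` is a nowhere vanishing smooth section of the core bundle of `𝔻`. -/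
structure IsSpecialSection (𝔻 : DoubleVectorBundleData D D₁ D₂ M) (σ : M → 𝔻.Core) : Prop where
  smooth : DSmooth σ
  proj : ∀ m, 𝔻.core.proj (σ m) = m
  ne_zero : ∀ m, ¬ 𝔻.core.IsZero (σ m)

/-- A section `σ` of the core `D₃` viewed as a linear function on `D₃*`. -/
def sectionFunction (𝔻 : DoubleVectorBundleData D D₁ D₂ M) (σ : M → 𝔻.Core) (κ : 𝔻.core.Dual) : ℝ :=
  κ.1.val (σ κ.1.base)

/-- The total space of `D₃‡`: linear functions on the fibres of `D₃` with value `1` at `σ`. -/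
abbrev CoreHyperplane (𝔻 : DoubleVectorBundleData D D₁ D₂ M) (σ : M → 𝔻.Core) : Type _ :=
  {κ : 𝔻.core.Dual // sectionFunction 𝔻 σ κ = 1}

/-- The total space of the special affine dual of `A → A₁`, for the special double affine bundle `A`
given in `𝔻` by `l₁`, `l₂` and `σ`: affine functions `f` on the fibres of `A → A₁` with linear part
equal to `1` on the distinguished vector `0 +₂ σ`, that is, `f (x + σ) = f x + 1`. -/
def SpecialDual (𝔻 : DoubleVectorBundleData D D₁ D₂ M) (l₁ : D₁ → ℝ) (l₂ : D₂ → ℝ)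
    (σ : M → 𝔻.Core) : Type _ :=
  {f : FibreFunction (levelSet 𝔻 l₁ l₂).left.proj // (levelSet 𝔻 l₁ l₂).left.IsAffineMap f ∧
    ∀ x x', (levelSet 𝔻 l₁ l₂).left.proj x = f.base →
      x'.1 = 𝔻.translate x.1 (σ (𝔻.bot.proj f.base.1)).1 → f.val x' = f.val x + 1}

instance (𝔻 : DoubleVectorBundleData D D₁ D₂ M) (l₁ : D₁ → ℝ) (l₂ : D₂ → ℝ) (σ : M → 𝔻.Core) :
    DiffeologicalSpace (SpecialDual 𝔻 l₁ l₂ σ) :=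
  inferInstanceAs (DiffeologicalSpace (Subtype _))

theorem pick_spec {α : Type*} {d : α} {P : α → Prop} (h : ∃ a, P a) : P (pick d P) := by
  unfold pick
  rw [dif_pos h]
  exact h.choose_spec

theorem core_add_val {𝔻 : DoubleVectorBundleData D D₁ D₂ M} (h : IsDoubleVectorBundle 𝔻)
    {c c' : 𝔻.Core} (hc : 𝔻.core.proj c = 𝔻.core.proj c') :
    𝔻.left.proj c.1 = 𝔻.left.proj c'.1 ∧ (𝔻.core.add c c').1 = 𝔻.left.add c.1 c'.1 := by
  obtain ⟨U, -, hm, k₁, k₂, k₃, ⟨T⟩⟩ := h.locally_trivial (𝔻.core.proj c)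
  have hm' : 𝔻.core.proj c' ∈ U := hc ▸ hm
  have h1 : 𝔻.left.proj c.1 = 𝔻.left.proj c'.1 := by
    have e1 := T.bot_smul 0 ⟨_, hm⟩ ⟨𝔻.left.proj c.1, hm⟩ c.2.1.symm
    have e2 := T.bot_smul 0 ⟨_, hm'⟩ ⟨𝔻.left.proj c'.1, hm'⟩ c'.2.1.symm
    rw [zero_smul] at e1 e2
    refine congrArg Subtype.val (T.e₁.injective (Prod.ext (Subtype.ext ?_) (e1.trans e2.symm)))
    rw [T.base₁, T.base₁]
    exact hc
  have g : 𝔻.right.proj (𝔻.top.proj c.1) = 𝔻.right.proj (𝔻.top.proj c'.1) := by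
    rw [← h.comm, ← h.comm]
    exact hc
  have hz : 𝔻.right.proj (𝔻.top.proj c.1) ∈ U := by
    rw [← h.comm]
    exact hm
  have hp := h.top_proj_add c.1 c'.1 h1
  have hs : 𝔻.right.proj (𝔻.top.proj (𝔻.left.add c.1 c'.1)) ∈ U := by
    rw [hp, h.right_fibre.1 _ _ g]
    exact hz
  refine ⟨h1, pick_spec (P := fun z : 𝔻.Core => z.1 = 𝔻.left.add c.1 c'.1)
    ⟨⟨𝔻.left.add c.1 c'.1, ?_, ?_⟩, rfl⟩⟩
  · rw [h.left_fibre.1 _ _ h1]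
    exact c.2.1
  · have e1 := T.right_smul 0 ⟨_, hz⟩ ⟨_, hz⟩ c.2.2.symm
    have e2 := T.right_smul 0 ⟨_, g ▸ hz⟩ ⟨_, g ▸ hz⟩ c'.2.2.symm
    have e3 := T.right_add ⟨_, hz⟩ ⟨_, g ▸ hz⟩ ⟨_, hs⟩ g hp
    have hr : 𝔻.right.proj (𝔻.right.smul 0 (𝔻.top.proj (𝔻.left.add c.1 c'.1))) ∈ U := by
      rw [h.right_fibre.2]
      exact hs
    have e4 := T.right_smul 0 ⟨_, hs⟩ ⟨_, hr⟩ rfl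
    rw [zero_smul] at e1 e2 e4
    rw [e1, e2, add_zero] at e3
    refine congrArg Subtype.val (T.e₂.injective (Prod.ext (Subtype.ext ?_) (e4.trans e3.symm)))
    rw [T.base₂, T.base₂]
    exact h.right_fibre.2 _ _

theorem core_smul_val {𝔻 : DoubleVectorBundleData D D₁ D₂ M} (h : IsDoubleVectorBundle 𝔻)
    (t : ℝ) (c : 𝔻.Core) : (𝔻.core.smul t c).1 = 𝔻.left.smul t c.1 := by
  obtain ⟨U, -, hm, k₁, k₂, k₃, ⟨T⟩⟩ := h.locally_trivial (𝔻.core.proj c)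
  have hz : 𝔻.right.proj (𝔻.top.proj c.1) ∈ U := by
    rw [← h.comm]
    exact hm
  have hp := h.top_proj_smul t c.1
  have hs : 𝔻.right.proj (𝔻.top.proj (𝔻.left.smul t c.1)) ∈ U := by
    rw [hp, h.right_fibre.2]
    exact hz
  refine pick_spec (P := fun z : 𝔻.Core => z.1 = 𝔻.left.smul t c.1)
    ⟨⟨𝔻.left.smul t c.1, ?_, ?_⟩, rfl⟩
  · rw [h.left_fibre.2]
    exact c.2.1
  · have e1 := T.right_smul 0 ⟨_, hz⟩ ⟨_, hz⟩ c.2.2.symm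
    have e3 := T.right_smul t ⟨_, hz⟩ ⟨_, hs⟩ hp
    have hr : 𝔻.right.proj (𝔻.right.smul 0 (𝔻.top.proj (𝔻.left.smul t c.1))) ∈ U := by
      rw [h.right_fibre.2]
      exact hs
    have e4 := T.right_smul 0 ⟨_, hs⟩ ⟨_, hr⟩ rfl
    rw [zero_smul] at e1 e4
    rw [e1, smul_zero] at e3
    refine congrArg Subtype.val (T.e₂.injective (Prod.ext (Subtype.ext ?_) (e4.trans e3.symm)))
    rw [T.base₂, T.base₂]
    exact h.right_fibre.2 _ _

theorem nonempty_coreHyperplane {𝔻 : DoubleVectorBundleData D D₁ D₂ M}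
    (h : IsDoubleVectorBundle 𝔻) {σ : M → 𝔻.Core} (hσ : IsSpecialSection 𝔻 σ) (m : M) :
    Nonempty (CoreHyperplane 𝔻 σ) := by
  classical
  obtain ⟨U, -, hm, k₁, k₂, k₃, ⟨T⟩⟩ := h.locally_trivial m
  have mem : ∀ c : 𝔻.Core, 𝔻.core.proj c = m → 𝔻.bot.proj (𝔻.left.proj c.1) ∈ U :=
    fun c hc => (show 𝔻.bot.proj (𝔻.left.proj c.1) = m from hc) ▸ hm
  have hσm : 𝔻.core.proj (σ m) = m := hσ.proj m
  obtain ⟨j, hj⟩ : ∃ j, (T.e ⟨(σ m).1, mem _ hσm⟩).2.2.2 j ≠ 0 := by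
    by_contra! h0
    refine hσ.ne_zero m (Subtype.ext ?_)
    rw [core_smul_val h]
    have hU : 𝔻.bot.proj (𝔻.left.proj (𝔻.left.smul 0 (σ m).1)) ∈ U := by
      rw [h.left_fibre.2]
      exact mem _ hσm
    have hU2 : 𝔻.right.proj (𝔻.top.proj (σ m).1) ∈ U := by
      rw [← h.comm]
      exact mem _ hσm
    have e1 := T.left_smul 0 ⟨_, mem _ hσm⟩ ⟨_, hU⟩ rfl
    have e2 := T.right_smul 0 ⟨_, hU2⟩ ⟨_, hU2⟩ (σ m).2.2.symm
    rw [zero_smul] at e1 e2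
    rw [← T.top_proj ⟨_, mem _ hσm⟩ ⟨_, hU2⟩ rfl] at e2
    have e3 : (T.e ⟨(σ m).1, mem _ hσm⟩).2.2.2 = 0 := by
      ext i
      exact h0 i
    have e4 := T.left_proj ⟨_, hU⟩ ⟨𝔻.left.proj (σ m).1, mem _ hσm⟩ (h.left_fibre.2 _ _)
    rw [← T.left_proj ⟨_, mem _ hσm⟩ ⟨𝔻.left.proj (σ m).1, mem _ hσm⟩ rfl] at e4
    refine congrArg Subtype.val (T.e.injective (Prod.ext (Subtype.ext ?_) (Prod.ext e4 ?_)))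
    · rw [T.base, T.base, h.left_fibre.2]
    · exact e1.trans (Prod.ext e2 e3).symm
  let w : 𝔻.Core → ℝ := fun c =>
    if hc : 𝔻.core.proj c = m then
      (T.e ⟨c.1, mem c hc⟩).2.2.2 j / (T.e ⟨(σ m).1, mem _ hσm⟩).2.2.2 j
    else 0
  have hw : ∀ c (hc : 𝔻.core.proj c = m), w c =
      (T.e ⟨c.1, mem c hc⟩).2.2.2 j / (T.e ⟨(σ m).1, mem _ hσm⟩).2.2.2 j :=
    fun c hc => dif_pos hc
  refine ⟨⟨⟨⟨m, w, fun c hc => dif_neg hc, ?_⟩, ?_, ?_⟩, ?_⟩⟩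
  · intro n c hc hb
    have hp : IsPlot fun u => (T.e ⟨(c u).1, mem _ (hb u)⟩).2.2.2 :=
      (T.diffeo.1 n (fun u => ⟨(c u).1, mem _ (hb u)⟩) hc).2.2.2
    have : (fun u => w (c u)) = fun u => (T.e ⟨(c u).1, mem _ (hb u)⟩).2.2.2 j /
        (T.e ⟨(σ m).1, mem _ hσm⟩).2.2.2 j := funext fun u => hw _ (hb u)
    rw [this]
    have h2 : ContDiff ℝ ∞ fun u => (T.e ⟨(c u).1, mem _ (hb u)⟩).2.2.2 := hp
    exact (show ContDiff ℝ ∞ _ from ((contDiff_euclidean.1 h2 j).div_const _))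
  · intro x y hx hy
    obtain ⟨h1, h2⟩ := core_add_val h (hx.trans hy.symm)
    have hs : 𝔻.core.proj (𝔻.core.add x y) = m := by
      change 𝔻.bot.proj (𝔻.left.proj (𝔻.core.add x y).1) = m
      rw [h2, h.left_fibre.1 _ _ h1]
      exact hx
    change w _ = w _ + w _
    rw [hw _ hs, hw _ hx, hw _ hy,
      T.left_add ⟨x.1, mem _ hx⟩ ⟨y.1, mem _ hy⟩ ⟨_, mem _ hs⟩ h1 h2, ← add_div]
    rfl
  · intro t x hx
    have h2 := core_smul_val h t x
    have hs : 𝔻.core.proj (𝔻.core.smul t x) = m := by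
      change 𝔻.bot.proj (𝔻.left.proj (𝔻.core.smul t x).1) = m
      rw [h2, h.left_fibre.2]
      exact hx
    change w _ = t * w _
    rw [hw _ hs, hw _ hx, T.left_smul t ⟨x.1, mem _ hx⟩ ⟨_, mem _ hs⟩ h2, ← mul_div_assoc]
    rfl
  · change w (σ m) = 1
    rw [hw _ hσm]
    exact div_self hj

/-- The special double affine dual `(A#; A₁, D₃‡; M)` of the special double affine bundle `A` given
in `𝔻` by `l₁`, `l₂` and `σ`. The fibres of `A# → A₁` have pointwise affine combinations. The
projection to `D₃‡` is `⟨κ, c⟩ = f (x + c) - f x`, the linear part of `f` on core vectors. The affine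
combinations over `D₃‡` are `aff₂(f, g; t) (aff₂(x, y; t)) = t f(x) + (1 - t) g(y)`. -/
def specialDual {𝔻 : DoubleVectorBundleData D D₁ D₂ M} (h : IsDoubleVectorBundle 𝔻)
    (l₁ : D₁ → ℝ) (l₂ : D₂ → ℝ) {σ : M → 𝔻.Core} (hσ : IsSpecialSection 𝔻 σ) :
    DoubleAffineBundleData (SpecialDual 𝔻 l₁ l₂ σ) {y : D₁ // l₁ y = 1} (CoreHyperplane 𝔻 σ) M where
  left :=
    { proj := fun f => f.1.base
      aff := fun f g t => pick f fun χ => χ.1.base = f.1.base ∧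
        ∀ x, (levelSet 𝔻 l₁ l₂).left.proj x = f.1.base →
          χ.1.val x = t * f.1.val x + (1 - t) * g.1.val x }
  top :=
    { proj := fun f =>
        pick (nonempty_coreHyperplane h hσ (𝔻.bot.proj f.1.base.1)).some fun κ =>
          κ.1.1.base = 𝔻.bot.proj f.1.base.1 ∧
          ∀ x x' (c : 𝔻.Core), (levelSet 𝔻 l₁ l₂).left.proj x = f.1.base →
            𝔻.core.proj c = κ.1.1.base → x'.1 = 𝔻.translate x.1 c.1 →
            κ.1.1.val c = f.1.val x' - f.1.val x
      aff := fun f g t => pick f fun χ =>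
        χ.1.base = (levelSet 𝔻 l₁ l₂).bot.aff f.1.base g.1.base t ∧
        ∀ x y, (levelSet 𝔻 l₁ l₂).left.proj x = f.1.base →
          (levelSet 𝔻 l₁ l₂).left.proj y = g.1.base →
          (levelSet 𝔻 l₁ l₂).top.proj x = (levelSet 𝔻 l₁ l₂).top.proj y →
          χ.1.val ((levelSet 𝔻 l₁ l₂).top.aff x y t) = t * f.1.val x + (1 - t) * g.1.val y }
  bot := (levelSet 𝔻 l₁ l₂).bot
  right := 𝔻.core.dual.toAffine.restrict _ fun κ => κ.1.1.base

end Special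

end DoubleAffine

end

noncomputable section

namespace DoubleAffine

/-! ### Locality in diffeological spaces -/

section Locality

variable {X M : Type*} [DiffeologicalSpace X] [DiffeologicalSpace M]

/-! Everything rests on one computation in local coordinates. Over a small open set of `M` a point
of `D` is a tuple (m, u, v, w), with u and v the coordinates of its two projections and w the core
coordinate. A functional on the fibre of `D → D₁` over (m, u) then has the form (v, w) ↦ ⟨v, p⟩ +
⟨w, q⟩. Its projection to `D₃*` is q, since core vectors have v = 0. The operations over `D₃*` keep
q and act on (u, p), while those over `D₁` keep u and act on (q, p). So (m, u, q, p) are coordinates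
of a double vector bundle with sides u, q and core p (`DoubleVectorChart.verticalDual`), and the
vertical dual is one (`isDoubleVectorBundle_verticalDual`).

In any double vector bundle, two fibrewise nonzero linear functions on the sides cut out a double
affine bundle: locally the equation l = 1 is solved for one coordinate direction on each side, and
the core coordinate stays free (`exists_levelChart`, `isDoubleAffineBundle_levelSet`). This applies
to the vertical dual with `l₁` and `l₃`.

The comparison with `A#` is linear algebra. If Λ is a nonzero linear form, an affine function g on
{Λ = 1} extends uniquely to a linear function, F v = g(v + (1 - Λ v) v₀) + (Λ v - 1) g(v₀) with Λ v₀
= 1 (`exists_linear_extension`). With Λ the pullback of `l₂` to a fibre of `D → D₁`, restriction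
identifies linear functions on the fibre with affine functions on the fibre of `A`. Since φ(x + c) =
φ(x) + ⟨κ, c⟩ (`val_translate`), the condition f(x + σ) = f(x) + 1 says exactly that `l₃` is 1 on κ.
As v₀ can be taken to vary smoothly with the base point, the inverse is smooth too
(`IsLevel.isPlot_dual`). The operations on `A#` are characterized by their values, and the
restricted operations of the vertical dual have these values (`isDoubleAffineIso_restrictEquiv`). So
the double affine structure passes to `A#` by transport, without charts on `A#`.

The core of the vertical dual consists of the elements with u = 0 and q = 0; what remains is p, the
coordinate of `D₂*`. Translation by such an element adds ⟨v, p⟩, the value of the pullback of λ. The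
isomorphism with `A₂†` is the extension argument again, for `D₂` and `l₂`, and `l₂` restricts to 1
on `A₂`. -/

theorem isPlot_of_local {n : ℕ} {c : Coord n → X} {b : Coord n → M} (hb : IsPlot b)
    (H : ∀ m, ∃ U : Set M, IsOpen[dTopology] U ∧ m ∈ U ∧ ∀ (k : ℕ) (f : Coord k → Coord n),
      ContDiff ℝ ∞ f → (∀ v, b (f v) ∈ U) → IsPlot fun v => c (f v)) : IsPlot c :=
  DiffeologicalSpace.locality fun u => by
    -- The preimages under `b` of the given D-open sets form the open cover of the parameter space
    -- that the locality axiom asks for.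
    obtain ⟨U, hU, hm, h⟩ := H (b u)
    exact ⟨b ⁻¹' U, isOpen_iff_preimages_plots.1 hU _ _ hb, hm, fun hf hs => h _ _ hs hf⟩

/-- Allows a test by plots with values in `U`, as needed when the condition defining `S` makes sense
only there. Plots are parametrized by all of ℝⁿ, so a plot which enters `U` at a point is first
shrunk to a ball and then reparametrized by a diffeomorphism of ℝⁿ onto that ball. -/
theorem isOpen_of_local {U S : Set X} (hU : IsOpen[dTopology] U) (hSU : S ⊆ U)
    (H : ∀ (n : ℕ) (p : Coord n → X), IsPlot p → (∀ y, p y ∈ U) → IsOpen (p ⁻¹' S)) :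
    IsOpen[dTopology] S := by
  refine isOpen_iff_preimages_plots.2 fun n p hp => isOpen_iff_mem_nhds.2 fun x hx => ?_
  obtain ⟨ε, hε, hb⟩ := Metric.isOpen_iff.1 (isOpen_iff_preimages_plots.1 hU n p hp) x (hSU hx)
  let φ := OpenPartialHomeomorph.univBall x ε
  have hφ : ∀ y, φ y ∈ Metric.ball x ε := fun y => by
    have := φ.map_source (x := y) (by simp [φ])
    rwa [OpenPartialHomeomorph.univBall_target x hε] at this
  have hS := H n (p ∘ φ) (isPlot_reparam hp OpenPartialHomeomorph.contDiff_univBall)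
    fun y => hb (hφ y)
  have hO : IsOpen (φ '' ((p ∘ φ) ⁻¹' S)) :=
    φ.isOpen_image_of_subset_source hS (by simp [φ])
  refine Filter.mem_of_superset (hO.mem_nhds ?_) (by rintro _ ⟨y, hy, rfl⟩; exact hy)
  have h0 : φ 0 = x := OpenPartialHomeomorph.univBall_apply_zero x ε
  exact ⟨0, by simpa [h0] using hx, h0⟩

theorem isOpen_ne_zero {U : Set X} (hU : IsOpen[dTopology] U) {g : U → ℝ} (hg : DSmooth g) :
    IsOpen[dTopology] {m | ∃ h : m ∈ U, g ⟨m, h⟩ ≠ 0} := by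
  refine isOpen_of_local hU (fun m hm => hm.1) fun n p hp hpU => ?_
  have h : ContDiff ℝ ∞ fun y => g ⟨p y, hpU y⟩ := (hg n (fun y => ⟨p y, hpU y⟩) hp).contDiff
  have e : p ⁻¹' {m | ∃ h : m ∈ U, g ⟨m, h⟩ ≠ 0} = (fun y => g ⟨p y, hpU y⟩) ⁻¹' {y | y ≠ 0} :=
    Set.ext fun y => ⟨fun hy => hy.2, fun hy => ⟨hpU y, hy⟩⟩
  rw [e]
  exact isOpen_ne.preimage h.continuous

theorem isOpen_dTopology_inter {U V : Set X} (hU : IsOpen[dTopology] U) (hV : IsOpen[dTopology] V) :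
    IsOpen[dTopology] (U ∩ V) :=
  isOpen_iff_preimages_plots.2 fun n p hp =>
    (isOpen_iff_preimages_plots.1 hU n p hp).inter (isOpen_iff_preimages_plots.1 hV n p hp)

theorem isOpen_dTopology_preimage {f : X → M} (hf : DSmooth f) {U : Set M}
    (hU : IsOpen[dTopology] U) : IsOpen[dTopology] (f ⁻¹' U) :=
  isOpen_iff_preimages_plots.2 fun n p hp => isOpen_iff_preimages_plots.1 hU n _ (hf n p hp)

instance {V W : Type*} [NormedAddCommGroup V] [NormedSpace ℝ V] [DiffeologicalSpace V]
    [IsContDiffCompatible V] [NormedAddCommGroup W] [NormedSpace ℝ W] [DiffeologicalSpace W]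
    [IsContDiffCompatible W] : IsContDiffCompatible (V × W) where
  isPlot_iff := ⟨fun h => (IsPlot.contDiff h.1).prodMk (IsPlot.contDiff h.2),
    fun h => ⟨h.fst.isPlot, h.snd.isPlot⟩⟩

theorem isPlot_linearMap {V W : Type*} [NormedAddCommGroup V] [NormedSpace ℝ V]
    [DiffeologicalSpace V] [IsContDiffCompatible V] [NormedAddCommGroup W] [NormedSpace ℝ W]
    [DiffeologicalSpace W] [IsContDiffCompatible W] [FiniteDimensional ℝ V] (L : V →ₗ[ℝ] W) {n : ℕ}
    {v : Coord n → V} (hv : IsPlot v) : IsPlot fun u => L (v u) :=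
  (L.toContinuousLinearMap.contDiff.comp hv.contDiff).isPlot

end Locality

/-! ### Dual bundles -/

namespace VectorBundleData

variable {E B : Type*} [DiffeologicalSpace E] {ξ : VectorBundleData E B}

/-- Functions on a fibre are extended by zero to the total space, so agreement on the fibre is
agreement everywhere. -/
theorem Dual.ext {f g : ξ.Dual} (hb : f.1.base = g.1.base)
    (hv : ∀ x, ξ.proj x = f.1.base → f.1.val x = g.1.val x) : f = g := by
  obtain ⟨⟨b, v, hv0, hs⟩, h⟩ := f
  obtain ⟨⟨b', v', hv0', hs'⟩, h'⟩ := g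
  obtain rfl : b = b' := hb
  obtain rfl : v = v' := funext fun x => by
    by_cases hx : ξ.proj x = b
    · exact hv x hx
    · rw [hv0 x hx, hv0' x hx]
  rfl

/-- The operations are given by `pick`, which has the required property only if some element has it.
The pointwise sum, again smooth and linear on the fibre, is such an element. -/
theorem dual_add_spec (f g : ξ.Dual) (h : f.1.base = g.1.base) :
    (ξ.dual.add f g).1.base = f.1.base ∧
      ∀ x, ξ.proj x = f.1.base → (ξ.dual.add f g).1.val x = f.1.val x + g.1.val x := by
  refine pick_spec (P := fun k : ξ.Dual => k.1.base = f.1.base ∧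
    ∀ x, ξ.proj x = f.1.base → k.1.val x = f.1.val x + g.1.val x)
    ⟨⟨⟨f.1.base, fun x => f.1.val x + g.1.val x, ?_, ?_⟩, ?_, ?_⟩, rfl, fun _ _ => rfl⟩
  · intro x hx
    rw [f.1.val_off x hx, g.1.val_off x (h ▸ hx), add_zero]
  · intro n c hc hb
    exact ((f.1.smooth n c hc hb).contDiff.add
      (g.1.smooth n c hc fun u => (hb u).trans h).contDiff).isPlot
  · intro x y hx hy
    change f.1.val _ + g.1.val _ = f.1.val _ + g.1.val _ + (f.1.val _ + g.1.val _)
    rw [f.2.1 x y hx hy, g.2.1 x y (hx.trans h) (hy.trans h)]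
    ring
  · intro t x hx
    change f.1.val _ + g.1.val _ = t * (f.1.val _ + g.1.val _)
    rw [f.2.2 t x hx, g.2.2 t x (hx.trans h)]
    ring

theorem dual_smul_spec (t : ℝ) (f : ξ.Dual) :
    (ξ.dual.smul t f).1.base = f.1.base ∧
      ∀ x, ξ.proj x = f.1.base → (ξ.dual.smul t f).1.val x = t * f.1.val x := by
  refine pick_spec (P := fun k : ξ.Dual => k.1.base = f.1.base ∧
    ∀ x, ξ.proj x = f.1.base → k.1.val x = t * f.1.val x)
    ⟨⟨⟨f.1.base, fun x => t * f.1.val x, ?_, ?_⟩, ?_, ?_⟩, rfl, fun _ _ => rfl⟩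
  · intro x hx
    rw [f.1.val_off x hx, mul_zero]
  · intro n c hc hb
    exact (contDiff_const.mul (f.1.smooth n c hc hb).contDiff).isPlot
  · intro x y hx hy
    change t * f.1.val _ = t * f.1.val _ + t * f.1.val _
    rw [f.2.1 x y hx hy]
    ring
  · intro s x hx
    change t * f.1.val _ = s * (t * f.1.val _)
    rw [f.2.2 s x hx]
    ring

end VectorBundleData

/-! ### Charts of vector bundles -/

/-- A local trivialization of a vector bundle over `U` with fibre `V`, given by the point `pt b v` with
base `b` and coordinate `v`, and by the coordinate map. -/
structure VectorBundleChart {E B : Type*} [DiffeologicalSpace E] [DiffeologicalSpace B]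
    (ξ : VectorBundleData E B) (U : Set B) (V : Type*) [AddCommGroup V] [Module ℝ V]
    [DiffeologicalSpace V] where
  pt : U → V → E
  coord : E → V
  proj_pt : ∀ b v, ξ.proj (pt b v) = b
  coord_pt : ∀ b v, coord (pt b v) = v
  pt_coord : ∀ x (h : ξ.proj x ∈ U), pt ⟨ξ.proj x, h⟩ (coord x) = x
  isPlot_pt : ∀ {n : ℕ} {b : Coord n → U} {v : Coord n → V}, IsPlot b → IsPlot v →
    IsPlot fun u => pt (b u) (v u)
  isPlot_coord : ∀ {n : ℕ} {c : Coord n → E}, IsPlot c → (∀ u, ξ.proj (c u) ∈ U) →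
    IsPlot fun u => coord (c u)
  add_pt : ∀ b v w, ξ.add (pt b v) (pt b w) = pt b (v + w)
  smul_pt : ∀ t b v, ξ.smul t (pt b v) = pt b (t • v)

/-- A bilinear pairing which identifies `W` with the dual space of `V`, smoothly. -/
structure DualPairing (V W : Type*) [AddCommGroup V] [Module ℝ V] [DiffeologicalSpace V]
    [AddCommGroup W] [Module ℝ W] [DiffeologicalSpace W] where
  pair : V →ₗ[ℝ] W →ₗ[ℝ] ℝ
  exists_repr : ∀ F : V →ₗ[ℝ] ℝ, ∃ w, ∀ v, pair v w = F v
  ext : ∀ {w w' : W}, (∀ v, pair v w = pair v w') → w = w'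
  isPlot_pair : ∀ {n : ℕ} {v : Coord n → V} {w : Coord n → W}, IsPlot v → IsPlot w →
    IsPlot fun u => pair (v u) (w u)
  isPlot_of_pair : ∀ {n : ℕ} {w : Coord n → W}, (∀ v, IsPlot fun u => pair v (w u)) → IsPlot w

/-- The inner product of `ℝᵏ` as a pairing. -/
def DualPairing.coord (k : ℕ) : DualPairing (Coord k) (Coord k) where
  pair := innerₗ (Coord k)
  exists_repr F := ⟨(InnerProductSpace.toDual ℝ (Coord k)).symm F.toContinuousLinearMap, fun v => by
    rw [innerₗ_apply_apply, real_inner_comm, InnerProductSpace.toDual_symm_apply]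
    rfl⟩
  ext h := ext_inner_left ℝ h
  isPlot_pair hv hw := (hv.contDiff.inner ℝ hw.contDiff).isPlot
  isPlot_of_pair {n w} h := (contDiff_euclidean.2 fun i => by
    have := (h (EuclideanSpace.single i 1)).contDiff
    simpa [EuclideanSpace.inner_single_left] using this).isPlot

/-- The pairing of `V × V'` with `W' × W`. -/
def DualPairing.prod {V W V' W' : Type*} [AddCommGroup V] [Module ℝ V] [DiffeologicalSpace V]
    [AddCommGroup W] [Module ℝ W] [DiffeologicalSpace W] [AddCommGroup V'] [Module ℝ V']
    [DiffeologicalSpace V'] [AddCommGroup W'] [Module ℝ W'] [DiffeologicalSpace W']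
    (β : DualPairing V W) (β' : DualPairing V' W') : DualPairing (V × V') (W' × W) where
  pair := β.pair.compl₁₂ (LinearMap.fst ℝ V V') (LinearMap.snd ℝ W' W) +
    β'.pair.compl₁₂ (LinearMap.snd ℝ V V') (LinearMap.fst ℝ W' W)
  exists_repr F := by
    obtain ⟨w, hw⟩ := β.exists_repr (F ∘ₗ LinearMap.inl ℝ V V')
    obtain ⟨w', hw'⟩ := β'.exists_repr (F ∘ₗ LinearMap.inr ℝ V V')
    refine ⟨(w', w), fun v => ?_⟩
    change β.pair v.1 w + β'.pair v.2 w' = F v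
    rw [hw, hw', LinearMap.comp_apply, LinearMap.comp_apply, ← map_add]
    simp
  ext {w w'} h := Prod.ext
    (β'.ext fun v => by simpa using h (0, v)) (β.ext fun v => by simpa using h (v, 0))
  isPlot_pair hv hw := ((β.isPlot_pair hv.1 hw.2).contDiff.add
    (β'.isPlot_pair hv.2 hw.1).contDiff).isPlot
  isPlot_of_pair h := ⟨β'.isPlot_of_pair fun v => by simpa using h (0, v),
    β.isPlot_of_pair fun v => by simpa using h (v, 0)⟩

namespace VectorBundleChart

variable {E B : Type*} [DiffeologicalSpace E] [DiffeologicalSpace B] {ξ : VectorBundleData E B}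
  {U : Set B} {V W : Type*} [AddCommGroup V] [Module ℝ V] [DiffeologicalSpace V]
  [AddCommGroup W] [Module ℝ W] [DiffeologicalSpace W]

theorem exists_pt (C : VectorBundleChart ξ U V) (b : U) {x : E} (h : ξ.proj x = b) :
    ∃ v, x = C.pt b v := by
  obtain ⟨b, hb⟩ := b
  subst h
  exact ⟨_, (C.pt_coord x hb).symm⟩

theorem pt_coord' (C : VectorBundleChart ξ U V) (b : U) {x : E} (h : ξ.proj x = b) :
    C.pt b (C.coord x) = x := by
  obtain ⟨v, rfl⟩ := C.exists_pt b h
  rw [C.coord_pt]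

theorem add_mem (C : VectorBundleChart ξ U V) (b : U) {x y : E} (hx : ξ.proj x = b)
    (hy : ξ.proj y = b) :
    ξ.proj (ξ.add x y) = b ∧ C.coord (ξ.add x y) = C.coord x + C.coord y := by
  obtain ⟨v, rfl⟩ := C.exists_pt b hx
  obtain ⟨w, rfl⟩ := C.exists_pt b hy
  rw [C.add_pt, C.proj_pt]
  simp [C.coord_pt]

theorem smul_mem (C : VectorBundleChart ξ U V) (b : U) {x : E} (t : ℝ) (hx : ξ.proj x = b) :
    ξ.proj (ξ.smul t x) = b ∧ C.coord (ξ.smul t x) = t • C.coord x := by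
  obtain ⟨v, rfl⟩ := C.exists_pt b hx
  rw [C.smul_pt, C.proj_pt]
  simp [C.coord_pt]

/-- An element of the dual bundle as a linear function of the coordinates. -/
def functional (C : VectorBundleChart ξ U V) (f : ξ.Dual) (b : U) (h : f.1.base = b) :
    V →ₗ[ℝ] ℝ where
  toFun v := f.1.val (C.pt b v)
  map_add' v w := by
    rw [← C.add_pt, f.2.1 _ _ ((C.proj_pt _ _).trans h.symm) ((C.proj_pt _ _).trans h.symm)]
  map_smul' t v := by
    rw [← C.smul_pt, f.2.2 _ _ ((C.proj_pt _ _).trans h.symm)]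
    rfl

open Classical in
/-- The functional on the fibre over `b` with a given coordinate expression. -/
def ofFunctional (C : VectorBundleChart ξ U V) (b : U) (F : V →ₗ[ℝ] ℝ)
    (hF : ∀ {n : ℕ} {v : Coord n → V}, IsPlot v → IsPlot fun u => F (v u)) : ξ.Dual :=
  ⟨{ base := b
     val := fun x => if ξ.proj x = b then F (C.coord x) else 0
     val_off := fun _ hx => if_neg hx
     smooth := fun n c hc hb => by
      simp only [hb, if_true]
      exact hF (C.isPlot_coord hc fun u => hb u ▸ b.2) },
    fun x y hx hy => by
      have h := C.add_mem b hx hy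
      simp only [show ξ.proj x = b from hx, show ξ.proj y = b from hy, h.1, h.2, if_true, map_add],
    fun t x hx => by
      have h := C.smul_mem b t hx
      simp only [show ξ.proj x = b from hx, h.1, h.2, if_true, map_smul, smul_eq_mul]⟩

theorem ofFunctional_val (C : VectorBundleChart ξ U V) (b : U) (F : V →ₗ[ℝ] ℝ)
    (hF : ∀ {n : ℕ} {v : Coord n → V}, IsPlot v → IsPlot fun u => F (v u)) {x : E}
    (hx : ξ.proj x = b) : (C.ofFunctional b F hF).1.val x = F (C.coord x) := if_pos hx

theorem dual_ext (C : VectorBundleChart ξ U V) (b : U) {f g : ξ.Dual} (hf : f.1.base = b)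
    (hg : g.1.base = b) (h : ∀ v, f.1.val (C.pt b v) = g.1.val (C.pt b v)) : f = g := by
  refine VectorBundleData.Dual.ext (hf.trans hg.symm) fun x hx => ?_
  obtain ⟨v, rfl⟩ := C.exists_pt b (hx.trans hf)
  exact h v

/-- The functional on the fibre over `b` which is represented by `w`. -/
def dualPt (C : VectorBundleChart ξ U V) (β : DualPairing V W) (b : U) (w : W) : ξ.Dual :=
  C.ofFunctional b (β.pair.flip w) fun hv => β.isPlot_pair hv isPlot_const

theorem dualPt_val (C : VectorBundleChart ξ U V) (β : DualPairing V W) (b : U) (w : W) {x : E}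
    (hx : ξ.proj x = b) : (C.dualPt β b w).1.val x = β.pair (C.coord x) w :=
  C.ofFunctional_val b _ (fun hv => β.isPlot_pair hv isPlot_const) hx

theorem dualPt_val_pt (C : VectorBundleChart ξ U V) (β : DualPairing V W) (b : U) (w : W) (v : V) :
    (C.dualPt β b w).1.val (C.pt b v) = β.pair v w := by
  rw [C.dualPt_val β b w (C.proj_pt b v), C.coord_pt]

open Classical in
/-- The coordinate of an element of the dual bundle. -/
def dualCoord (C : VectorBundleChart ξ U V) (β : DualPairing V W) (f : ξ.Dual) : W :=
  if h : f.1.base ∈ U then (β.exists_repr (C.functional f ⟨_, h⟩ rfl)).choose else 0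

theorem pair_dualCoord (C : VectorBundleChart ξ U V) (β : DualPairing V W) (f : ξ.Dual) (b : U)
    (h : f.1.base = b) (v : V) : β.pair v (C.dualCoord β f) = f.1.val (C.pt b v) := by
  obtain ⟨b, hb⟩ := b
  subst h
  rw [dualCoord, dif_pos hb]
  exact (β.exists_repr (C.functional f ⟨_, hb⟩ rfl)).choose_spec v

/-- The chart of the dual bundle. -/
def dual (C : VectorBundleChart ξ U V) (β : DualPairing V W) : VectorBundleChart ξ.dual U W where
  pt := C.dualPt β
  coord := C.dualCoord β
  proj_pt _ _ := rfl
  coord_pt b w := β.ext fun v => by rw [C.pair_dualCoord β _ b rfl, dualPt_val_pt]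
  pt_coord f h := C.dual_ext ⟨_, h⟩ rfl rfl fun v => by
    rw [dualPt_val_pt, C.pair_dualCoord β f ⟨_, h⟩ rfl]
  isPlot_pt {n b w} hb hw := by
    refine ⟨hb, fun k s x hs hx h => ?_⟩
    have h' : ∀ v, ξ.proj (x v) = b (s v) := h
    have : (fun v => (C.dualPt β (b (s v)) (w (s v))).1.val (x v)) =
        fun v => β.pair (C.coord (x v)) (w (s v)) :=
      funext fun v => C.dualPt_val β _ _ (h' v)
    change IsPlot fun v => (C.dualPt β (b (s v)) (w (s v))).1.val (x v)
    rw [this]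
    exact β.isPlot_pair (C.isPlot_coord hx fun u => h' u ▸ (b (s u)).2) (isPlot_reparam hw hs)
  isPlot_coord {n c} hc hU := by
    -- The coefficients of a moving functional are detected by its values at the points with
    -- constant coordinate `v` over the moving base point, and these points form a plot.
    refine β.isPlot_of_pair fun v => ?_
    have : (fun u => β.pair v (C.dualCoord β (c u))) =
        fun u => (c u).1.val (C.pt ⟨(c u).1.base, hU u⟩ v) :=
      funext fun u => C.pair_dualCoord β (c u) ⟨_, hU u⟩ rfl v
    rw [this]
    exact hc.2 n id _ contDiff_id
      (C.isPlot_pt (b := fun u => ⟨(c u).1.base, hU u⟩) hc.1 isPlot_const) fun u => C.proj_pt _ _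
  add_pt b v w := by
    obtain ⟨h1, h2⟩ := VectorBundleData.dual_add_spec (C.dualPt β b v) (C.dualPt β b w) rfl
    refine C.dual_ext b h1 rfl fun v => ?_
    rw [h2 _ (C.proj_pt _ _), dualPt_val_pt, dualPt_val_pt, dualPt_val_pt, map_add]
  smul_pt t b w := by
    obtain ⟨h1, h2⟩ := VectorBundleData.dual_smul_spec t (C.dualPt β b w)
    refine C.dual_ext b h1 rfl fun v => ?_
    rw [h2 _ (C.proj_pt _ _), dualPt_val_pt, dualPt_val_pt, map_smul, smul_eq_mul]

/-- A chart with another, isomorphic, fibre. -/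
def congr {V V' : Type*} [NormedAddCommGroup V] [NormedSpace ℝ V] [DiffeologicalSpace V]
    [IsContDiffCompatible V] [FiniteDimensional ℝ V] [NormedAddCommGroup V'] [NormedSpace ℝ V']
    [DiffeologicalSpace V'] [IsContDiffCompatible V'] [FiniteDimensional ℝ V']
    (C : VectorBundleChart ξ U V) (L : V ≃ₗ[ℝ] V') : VectorBundleChart ξ U V' where
  pt b v := C.pt b (L.symm v)
  coord x := L (C.coord x)
  proj_pt _ _ := C.proj_pt _ _
  coord_pt b v := by rw [C.coord_pt, L.apply_symm_apply]
  pt_coord x h := by rw [L.symm_apply_apply, C.pt_coord]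
  isPlot_pt hb hv := C.isPlot_pt hb (isPlot_linearMap L.symm.toLinearMap hv)
  isPlot_coord hc hU := isPlot_linearMap L.toLinearMap (C.isPlot_coord hc hU)
  add_pt b v w := by rw [C.add_pt, map_add]
  smul_pt t b v := by rw [C.smul_pt, map_smul]

end VectorBundleChart

/-! ### Charts of double vector bundles -/

section DoubleVectorCharts

variable {D D₁ D₂ M : Type*} [DiffeologicalSpace D] [DiffeologicalSpace D₁] [DiffeologicalSpace D₂]
  [DiffeologicalSpace M]

/-- A local trivialization of a double vector bundle over `U`, given by the points with given base and
coordinates, and by the coordinate maps. -/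
structure DoubleVectorChart (𝔻 : DoubleVectorBundleData D D₁ D₂ M) (U : Set M)
    (k₁ k₂ k₃ : ℕ) where
  pt₁ : U → Coord k₁ → D₁
  pt₂ : U → Coord k₂ → D₂
  pt : U → Coord k₁ → Coord k₂ → Coord k₃ → D
  c₁ : D₁ → Coord k₁
  c₂ : D₂ → Coord k₂
  c₃ : D → Coord k₃
  bot_pt₁ : ∀ m u, 𝔻.bot.proj (pt₁ m u) = m
  right_pt₂ : ∀ m v, 𝔻.right.proj (pt₂ m v) = m
  left_pt : ∀ m u v w, 𝔻.left.proj (pt m u v w) = pt₁ m u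
  top_pt : ∀ m u v w, 𝔻.top.proj (pt m u v w) = pt₂ m v
  c₁_pt₁ : ∀ m u, c₁ (pt₁ m u) = u
  c₂_pt₂ : ∀ m v, c₂ (pt₂ m v) = v
  c₃_pt : ∀ m u v w, c₃ (pt m u v w) = w
  eta₁ : ∀ y (h : 𝔻.bot.proj y ∈ U), pt₁ ⟨_, h⟩ (c₁ y) = y
  eta₂ : ∀ z (h : 𝔻.right.proj z ∈ U), pt₂ ⟨_, h⟩ (c₂ z) = z
  eta : ∀ x (h : 𝔻.bot.proj (𝔻.left.proj x) ∈ U),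
    pt ⟨_, h⟩ (c₁ (𝔻.left.proj x)) (c₂ (𝔻.top.proj x)) (c₃ x) = x
  isPlot_pt₁ : ∀ {n : ℕ} {m : Coord n → U} {u : Coord n → Coord k₁}, IsPlot m → IsPlot u →
    IsPlot fun a => pt₁ (m a) (u a)
  isPlot_pt₂ : ∀ {n : ℕ} {m : Coord n → U} {v : Coord n → Coord k₂}, IsPlot m → IsPlot v →
    IsPlot fun a => pt₂ (m a) (v a)
  isPlot_pt : ∀ {n : ℕ} {m : Coord n → U} {u : Coord n → Coord k₁} {v : Coord n → Coord k₂}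
    {w : Coord n → Coord k₃}, IsPlot m → IsPlot u → IsPlot v → IsPlot w →
    IsPlot fun a => pt (m a) (u a) (v a) (w a)
  isPlot_c₁ : ∀ {n : ℕ} {y : Coord n → D₁}, IsPlot y → (∀ a, 𝔻.bot.proj (y a) ∈ U) →
    IsPlot fun a => c₁ (y a)
  isPlot_c₂ : ∀ {n : ℕ} {z : Coord n → D₂}, IsPlot z → (∀ a, 𝔻.right.proj (z a) ∈ U) →
    IsPlot fun a => c₂ (z a)
  isPlot_c₃ : ∀ {n : ℕ} {x : Coord n → D}, IsPlot x →
    (∀ a, 𝔻.bot.proj (𝔻.left.proj (x a)) ∈ U) → IsPlot fun a => c₃ (x a)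
  bot_add : ∀ m u u', 𝔻.bot.add (pt₁ m u) (pt₁ m u') = pt₁ m (u + u')
  bot_smul : ∀ t m u, 𝔻.bot.smul t (pt₁ m u) = pt₁ m (t • u)
  right_add : ∀ m v v', 𝔻.right.add (pt₂ m v) (pt₂ m v') = pt₂ m (v + v')
  right_smul : ∀ t m v, 𝔻.right.smul t (pt₂ m v) = pt₂ m (t • v)
  left_add : ∀ m u v w v' w',
    𝔻.left.add (pt m u v w) (pt m u v' w') = pt m u (v + v') (w + w')
  left_smul : ∀ t m u v w, 𝔻.left.smul t (pt m u v w) = pt m u (t • v) (t • w)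
  top_add : ∀ m u u' v w w', 𝔻.top.add (pt m u v w) (pt m u' v w') = pt m (u + u') v (w + w')
  top_smul : ∀ t m u v w, 𝔻.top.smul t (pt m u v w) = pt m (t • u) v (t • w)

variable {𝔻 : DoubleVectorBundleData D D₁ D₂ M} {U : Set M} {k₁ k₂ k₃ : ℕ}

namespace DoubleVectorChart

theorem exists_pt₁ (C : DoubleVectorChart 𝔻 U k₁ k₂ k₃) (m : U) {y : D₁}
    (h : 𝔻.bot.proj y = m) : ∃ u, y = C.pt₁ m u := by
  obtain ⟨m, hm⟩ := m
  subst h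
  exact ⟨_, (C.eta₁ y hm).symm⟩

theorem exists_pt₂ (C : DoubleVectorChart 𝔻 U k₁ k₂ k₃) (m : U) {z : D₂}
    (h : 𝔻.right.proj z = m) : ∃ v, z = C.pt₂ m v := by
  obtain ⟨m, hm⟩ := m
  subst h
  exact ⟨_, (C.eta₂ z hm).symm⟩

theorem exists_pt (C : DoubleVectorChart 𝔻 U k₁ k₂ k₃) (m : U) {x : D}
    (h : 𝔻.bot.proj (𝔻.left.proj x) = m) : ∃ u v w, x = C.pt m u v w := by
  obtain ⟨m, hm⟩ := m
  subst h
  exact ⟨_, _, _, (C.eta x hm).symm⟩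

theorem pt₁_inj (C : DoubleVectorChart 𝔻 U k₁ k₂ k₃) {m : U} {u u' : Coord k₁} :
    C.pt₁ m u = C.pt₁ m u' ↔ u = u' :=
  ⟨fun h => by rw [← C.c₁_pt₁ m u, h, C.c₁_pt₁], fun h => h ▸ rfl⟩

theorem pt₂_inj (C : DoubleVectorChart 𝔻 U k₁ k₂ k₃) {m : U} {v v' : Coord k₂} :
    C.pt₂ m v = C.pt₂ m v' ↔ v = v' :=
  ⟨fun h => by rw [← C.c₂_pt₂ m v, h, C.c₂_pt₂], fun h => h ▸ rfl⟩

theorem base_pt (C : DoubleVectorChart 𝔻 U k₁ k₂ k₃) (m : U) (u : Coord k₁) (v : Coord k₂)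
    (w : Coord k₃) : 𝔻.bot.proj (𝔻.left.proj (C.pt m u v w)) = m := by
  rw [C.left_pt, C.bot_pt₁]

/-- Two points in the same fibre over `D₁`. -/
theorem exists_pt_left (C : DoubleVectorChart 𝔻 U k₁ k₂ k₃) (m : U) {x : D} {u : Coord k₁}
    (h : 𝔻.left.proj x = C.pt₁ m u) : ∃ v w, x = C.pt m u v w := by
  obtain ⟨u', v, w, rfl⟩ := C.exists_pt m (by rw [h, C.bot_pt₁] : 𝔻.bot.proj (𝔻.left.proj x) = m)
  rw [C.left_pt, C.pt₁_inj] at h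
  exact ⟨v, w, h ▸ rfl⟩

theorem isZero_pt₁ (C : DoubleVectorChart 𝔻 U k₁ k₂ k₃) (m : U) (u : Coord k₁) :
    𝔻.bot.IsZero (C.pt₁ m u) ↔ u = 0 := by
  rw [VectorBundleData.IsZero, C.bot_smul, C.pt₁_inj, zero_smul, eq_comm]

theorem isZero_pt₂ (C : DoubleVectorChart 𝔻 U k₁ k₂ k₃) (m : U) (v : Coord k₂) :
    𝔻.right.IsZero (C.pt₂ m v) ↔ v = 0 := by
  rw [VectorBundleData.IsZero, C.right_smul, C.pt₂_inj, zero_smul, eq_comm]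

/-- The point of the core with a given coordinate. -/
def corePt (C : DoubleVectorChart 𝔻 U k₁ k₂ k₃) (m : U) (w : Coord k₃) : 𝔻.Core :=
  ⟨C.pt m 0 0 w, by rw [C.left_pt, C.isZero_pt₁], by rw [C.top_pt, C.isZero_pt₂]⟩

theorem corePt_val (C : DoubleVectorChart 𝔻 U k₁ k₂ k₃) (m : U) (w : Coord k₃) :
    (C.corePt m w).1 = C.pt m 0 0 w := rfl

theorem core_proj_corePt (C : DoubleVectorChart 𝔻 U k₁ k₂ k₃) (m : U) (w : Coord k₃) :
    𝔻.core.proj (C.corePt m w) = m := C.base_pt m 0 0 w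

theorem exists_corePt (C : DoubleVectorChart 𝔻 U k₁ k₂ k₃) (m : U) {c : 𝔻.Core}
    (h : 𝔻.core.proj c = m) : ∃ w, c = C.corePt m w := by
  obtain ⟨c, h1, h2⟩ := c
  obtain ⟨u, v, w, rfl⟩ := C.exists_pt m h
  obtain rfl : u = 0 := by rwa [C.left_pt, C.isZero_pt₁] at h1
  obtain rfl : v = 0 := by rwa [C.top_pt, C.isZero_pt₂] at h2
  exact ⟨w, rfl⟩

/-- The zero of the fibre through (u, v, w) is (u, 0, 0), and the addition over `D₂` adds the first
and third coordinates only. So the core vector depends only on the fibre, not on the point `x` in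
it. -/
theorem coreVector_pt (C : DoubleVectorChart 𝔻 U k₁ k₂ k₃) (m : U) (u : Coord k₁) (v : Coord k₂)
    (w w' : Coord k₃) : 𝔻.coreVector (C.pt m u v w) (C.pt m 0 0 w') = C.pt m u 0 w' := by
  rw [DoubleVectorBundleData.coreVector, C.left_smul, zero_smul, zero_smul, C.top_add, add_zero,
    zero_add]

theorem translate_pt (C : DoubleVectorChart 𝔻 U k₁ k₂ k₃) (m : U) (u : Coord k₁) (v : Coord k₂)
    (w w' : Coord k₃) : 𝔻.translate (C.pt m u v w) (C.pt m 0 0 w') = C.pt m u v (w + w') := by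
  rw [DoubleVectorBundleData.translate, C.coreVector_pt, C.left_add, add_zero]

theorem pt_base_eq (C : DoubleVectorChart 𝔻 U k₁ k₂ k₃) {m m' : U} (h : (m : M) = m')
    (u : Coord k₁) (v : Coord k₂) (w : Coord k₃) : C.pt m u v w = C.pt m' u v w := by
  rw [Subtype.ext h]

/-- The chart of the bundle `D → D₁`. -/
def leftChart (C : DoubleVectorChart 𝔻 U k₁ k₂ k₃) (hbot : DSmooth 𝔻.bot.proj)
    (htop : DSmooth 𝔻.top.proj) (comm : ∀ x, 𝔻.bot.proj (𝔻.left.proj x) = 𝔻.right.proj (𝔻.top.proj x)) :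
    VectorBundleChart 𝔻.left (𝔻.bot.proj ⁻¹' U) (Coord k₂ × Coord k₃) where
  pt y v := C.pt ⟨_, y.2⟩ (C.c₁ y) v.1 v.2
  coord x := (C.c₂ (𝔻.top.proj x), C.c₃ x)
  proj_pt y v := by rw [C.left_pt, C.eta₁]
  coord_pt y v := by rw [C.top_pt, C.c₂_pt₂, C.c₃_pt]
  pt_coord x h := C.eta x h
  isPlot_pt {n b v} hb hv := C.isPlot_pt (m := fun a => ⟨_, (b a).2⟩) (hbot _ _ hb)
    (C.isPlot_c₁ hb fun a => (b a).2) hv.1 hv.2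
  isPlot_coord hc hU := ⟨C.isPlot_c₂ (htop _ _ hc) fun u => comm _ ▸ hU u, C.isPlot_c₃ hc hU⟩
  add_pt b v w := C.left_add _ _ _ _ _ _
  smul_pt t b v := C.left_smul _ _ _ _ _

theorem leftChart_pt (C : DoubleVectorChart 𝔻 U k₁ k₂ k₃) (hbot : DSmooth 𝔻.bot.proj)
    (htop : DSmooth 𝔻.top.proj)
    (comm : ∀ x, 𝔻.bot.proj (𝔻.left.proj x) = 𝔻.right.proj (𝔻.top.proj x)) (m : U) (u : Coord k₁)
    (h : 𝔻.bot.proj (C.pt₁ m u) ∈ U) (v : Coord k₂) (w : Coord k₃) :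
    (C.leftChart hbot htop comm).pt ⟨C.pt₁ m u, h⟩ (v, w) = C.pt m u v w := by
  change C.pt ⟨_, h⟩ (C.c₁ (C.pt₁ m u)) v w = _
  rw [C.c₁_pt₁]
  exact C.pt_base_eq (C.bot_pt₁ m u) _ _ _

/-- The chart of the bundle `D₂ → M`. -/
def rightChart (C : DoubleVectorChart 𝔻 U k₁ k₂ k₃) : VectorBundleChart 𝔻.right U (Coord k₂) where
  pt := C.pt₂
  coord := C.c₂
  proj_pt := C.right_pt₂
  coord_pt := C.c₂_pt₂
  pt_coord := C.eta₂
  isPlot_pt := C.isPlot_pt₂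
  isPlot_coord := C.isPlot_c₂
  add_pt := C.right_add
  smul_pt := C.right_smul

/-- The chart of the core bundle. -/
def coreChart (C : DoubleVectorChart 𝔻 U k₁ k₂ k₃) (h : IsDoubleVectorBundle 𝔻) :
    VectorBundleChart 𝔻.core U (Coord k₃) where
  pt := C.corePt
  coord c := C.c₃ c.1
  proj_pt := C.core_proj_corePt
  coord_pt m w := C.c₃_pt _ _ _ _
  pt_coord c hc := by
    obtain ⟨w, hw⟩ := C.exists_corePt ⟨_, hc⟩ rfl
    have h3 : C.c₃ c.1 = w := (congrArg (fun c => C.c₃ c.1) hw).trans (C.c₃_pt _ _ _ _)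
    exact (congrArg _ h3).trans hw.symm
  isPlot_pt hm hw := C.isPlot_pt hm isPlot_const isPlot_const hw
  isPlot_coord hc hU := C.isPlot_c₃ (x := fun a => Subtype.val _) hc hU
  add_pt m v w := Subtype.ext <| by
    refine (core_add_val h ?_).2.trans ?_
    · rw [C.core_proj_corePt, C.core_proj_corePt]
    · rw [C.corePt_val, C.corePt_val, C.left_add, add_zero]
      rfl
  smul_pt t m w := Subtype.ext <| by
    rw [core_smul_val h, C.corePt_val, C.left_smul, smul_zero]
    rfl

end DoubleVectorChart

theorem mem_of_eq_coe {X : Type*} {U : Set X} {m : U} {x : X} (h : x = m) : x ∈ U := h ▸ m.2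

namespace DoubleVectorTrivialization

theorem eq_symm₁ (T : DoubleVectorTrivialization 𝔻 U k₁ k₂ k₃) {y : D₁} (hy : 𝔻.bot.proj y ∈ U)
    {m : U} {u : Coord k₁} (hm : 𝔻.bot.proj y = m) (hu : (T.e₁ ⟨y, hy⟩).2 = u) :
    y = (T.e₁.symm (m, u)).1 :=
  congrArg Subtype.val (T.e₁.eq_symm_apply (y := ⟨y, hy⟩) |>.2 (Prod.ext (Subtype.ext ((T.base₁ _).trans hm)) hu))

theorem eq_symm₂ (T : DoubleVectorTrivialization 𝔻 U k₁ k₂ k₃) {z : D₂}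
    (hz : 𝔻.right.proj z ∈ U) {m : U} {v : Coord k₂} (hm : 𝔻.right.proj z = m)
    (hv : (T.e₂ ⟨z, hz⟩).2 = v) : z = (T.e₂.symm (m, v)).1 :=
  congrArg Subtype.val (T.e₂.eq_symm_apply (y := ⟨z, hz⟩) |>.2 (Prod.ext (Subtype.ext ((T.base₂ _).trans hm)) hv))

theorem proj_symm₁ (T : DoubleVectorTrivialization 𝔻 U k₁ k₂ k₃) (m : U) (u : Coord k₁) :
    𝔻.bot.proj (T.e₁.symm (m, u)).1 = m := by
  rw [← T.base₁, T.e₁.apply_symm_apply]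

theorem proj_symm₂ (T : DoubleVectorTrivialization 𝔻 U k₁ k₂ k₃) (m : U) (v : Coord k₂) :
    𝔻.right.proj (T.e₂.symm (m, v)).1 = m := by
  rw [← T.base₂, T.e₂.apply_symm_apply]

theorem left_symm (T : DoubleVectorTrivialization 𝔻 U k₁ k₂ k₃) (m : U) (u : Coord k₁)
    (v : Coord k₂) (w : Coord k₃) :
    𝔻.left.proj (T.e.symm (m, u, v, w)).1 = (T.e₁.symm (m, u)).1 := by
  refine T.eq_symm₁ (T.e.symm (m, u, v, w)).2 ?_ ?_
  · rw [← T.base, T.e.apply_symm_apply]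
  · rw [← T.left_proj (T.e.symm (m, u, v, w)) ⟨_, _⟩ rfl, T.e.apply_symm_apply]

theorem top_symm (T : DoubleVectorTrivialization 𝔻 U k₁ k₂ k₃) (h : IsDoubleVectorBundle 𝔻)
    (m : U) (u : Coord k₁) (v : Coord k₂) (w : Coord k₃) :
    𝔻.top.proj (T.e.symm (m, u, v, w)).1 = (T.e₂.symm (m, v)).1 := by
  refine T.eq_symm₂ (h.comm _ ▸ (T.e.symm (m, u, v, w)).2) ?_ ?_
  · rw [← h.comm, ← T.base, T.e.apply_symm_apply]
  · rw [← T.top_proj (T.e.symm (m, u, v, w)) ⟨_, _⟩ rfl, T.e.apply_symm_apply]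

/-- The two side coordinates of `T.e` are those of the projections, so once the projections are
known only the core coordinate is left to compare. -/
theorem eq_symm (T : DoubleVectorTrivialization 𝔻 U k₁ k₂ k₃) {x : D}
    {m : U} {u : Coord k₁} {v : Coord k₂} {w : Coord k₃}
    (hl : 𝔻.left.proj x = (T.e₁.symm (m, u)).1) (ht : 𝔻.top.proj x = (T.e₂.symm (m, v)).1)
    (hw : ∀ hx, (T.e ⟨x, hx⟩).2.2.2 = w) : x = (T.e.symm (m, u, v, w)).1 := by
  have hb : 𝔻.bot.proj (𝔻.left.proj x) = m := by rw [hl, T.proj_symm₁]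
  refine congrArg Subtype.val ((T.e.eq_symm_apply (y := ⟨x, mem_of_eq_coe hb⟩)).2
    (Prod.ext (Subtype.ext ((T.base _).trans hb)) (Prod.ext ?_ (Prod.ext ?_ (hw _)))))
  · rw [T.left_proj _ (T.e₁.symm (m, u)) hl, T.e₁.apply_symm_apply]
  · rw [T.top_proj _ (T.e₂.symm (m, v)) ht, T.e₂.apply_symm_apply]

open Classical in
/-- A local trivialization as a chart. -/
def toChart (T : DoubleVectorTrivialization 𝔻 U k₁ k₂ k₃) (h : IsDoubleVectorBundle 𝔻) :
    DoubleVectorChart 𝔻 U k₁ k₂ k₃ where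
  pt₁ m u := (T.e₁.symm (m, u)).1
  pt₂ m v := (T.e₂.symm (m, v)).1
  pt m u v w := (T.e.symm (m, u, v, w)).1
  c₁ y := if hy : 𝔻.bot.proj y ∈ U then (T.e₁ ⟨y, hy⟩).2 else 0
  c₂ z := if hz : 𝔻.right.proj z ∈ U then (T.e₂ ⟨z, hz⟩).2 else 0
  c₃ x := if hx : 𝔻.bot.proj (𝔻.left.proj x) ∈ U then (T.e ⟨x, hx⟩).2.2.2 else 0
  bot_pt₁ := T.proj_symm₁
  right_pt₂ := T.proj_symm₂
  left_pt := T.left_symm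
  top_pt := T.top_symm h
  c₁_pt₁ m u := by
    rw [dif_pos (T.e₁.symm (m, u)).2, Subtype.coe_eta, T.e₁.apply_symm_apply]
  c₂_pt₂ m v := by
    rw [dif_pos (T.e₂.symm (m, v)).2, Subtype.coe_eta, T.e₂.apply_symm_apply]
  c₃_pt m u v w := by
    rw [dif_pos (T.e.symm (m, u, v, w)).2, Subtype.coe_eta, T.e.apply_symm_apply]
  eta₁ y hy := by
    rw [dif_pos hy]
    exact (T.eq_symm₁ hy rfl rfl).symm
  eta₂ z hz := by
    rw [dif_pos hz]
    exact (T.eq_symm₂ hz rfl rfl).symm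
  eta x hx := by
    have hx' : 𝔻.right.proj (𝔻.top.proj x) ∈ U := h.comm x ▸ hx
    rw [dif_pos hx, dif_pos hx, dif_pos hx']
    exact (T.eq_symm (T.eq_symm₁ hx rfl rfl) (T.eq_symm₂ hx' (h.comm x).symm rfl) fun _ => rfl).symm
  isPlot_pt₁ hm hu := T.diffeo₁.2 _ _ ⟨hm, hu⟩
  isPlot_pt₂ hm hv := T.diffeo₂.2 _ _ ⟨hm, hv⟩
  isPlot_pt hm hu hv hw := T.diffeo.2 _ _ ⟨hm, hu, hv, hw⟩
  isPlot_c₁ {n y} hy hU := by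
    simp only [hU, dite_true]
    exact (T.diffeo₁.1 n (fun a => ⟨y a, hU a⟩) hy).2
  isPlot_c₂ {n z} hz hU := by
    simp only [hU, dite_true]
    exact (T.diffeo₂.1 n (fun a => ⟨z a, hU a⟩) hz).2
  isPlot_c₃ {n x} hx hU := by
    simp only [hU, dite_true]
    exact (T.diffeo.1 n (fun a => ⟨x a, hU a⟩) hx).2.2.2
  bot_add m u u' := by
    have hb : 𝔻.bot.proj (T.e₁.symm (m, u)).1 = 𝔻.bot.proj (T.e₁.symm (m, u')).1 := by
      rw [T.proj_symm₁, T.proj_symm₁]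
    have hm := (h.bot_fibre.1 _ _ hb).trans (T.proj_symm₁ m u)
    refine T.eq_symm₁ (hm ▸ m.2) hm ?_
    rw [T.bot_add _ _ ⟨_, _⟩ hb rfl, T.e₁.apply_symm_apply, T.e₁.apply_symm_apply]
  bot_smul t m u := by
    have hm := (h.bot_fibre.2 t _).trans (T.proj_symm₁ m u)
    refine T.eq_symm₁ (hm ▸ m.2) hm ?_
    rw [T.bot_smul t _ ⟨_, _⟩ rfl, T.e₁.apply_symm_apply]
  right_add m v v' := by
    have hb : 𝔻.right.proj (T.e₂.symm (m, v)).1 = 𝔻.right.proj (T.e₂.symm (m, v')).1 := by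
      rw [T.proj_symm₂, T.proj_symm₂]
    have hm := (h.right_fibre.1 _ _ hb).trans (T.proj_symm₂ m v)
    refine T.eq_symm₂ (hm ▸ m.2) hm ?_
    rw [T.right_add _ _ ⟨_, _⟩ hb rfl, T.e₂.apply_symm_apply, T.e₂.apply_symm_apply]
  right_smul t m v := by
    have hm := (h.right_fibre.2 t _).trans (T.proj_symm₂ m v)
    refine T.eq_symm₂ (hm ▸ m.2) hm ?_
    rw [T.right_smul t _ ⟨_, _⟩ rfl, T.e₂.apply_symm_apply]
  left_add m u v w v' w' := by
    have hb : 𝔻.left.proj (T.e.symm (m, u, v, w)).1 = 𝔻.left.proj (T.e.symm (m, u, v', w')).1 := by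
      rw [T.left_symm, T.left_symm]
    have hl := (h.left_fibre.1 _ _ hb).trans (T.left_symm m u v w)
    have key := fun hx => T.left_add _ _ ⟨_, hx⟩ hb rfl
    simp only [T.e.apply_symm_apply] at key
    have hx : 𝔻.bot.proj (𝔻.left.proj (𝔻.left.add (T.e.symm (m, u, v, w)).1
        (T.e.symm (m, u, v', w')).1)) = m := by rw [hl, T.proj_symm₁]
    have hx' := hx
    rw [h.comm] at hx'
    refine T.eq_symm hl (T.eq_symm₂ (mem_of_eq_coe hx') hx' ?_) fun hx => congrArg Prod.snd (key hx)
    rw [← T.top_proj ⟨_, mem_of_eq_coe hx⟩ ⟨_, mem_of_eq_coe hx'⟩ rfl]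
    exact congrArg Prod.fst (key _)
  left_smul t m u v w := by
    have hl := (h.left_fibre.2 t _).trans (T.left_symm m u v w)
    have key := fun hx => T.left_smul t (T.e.symm (m, u, v, w)) ⟨_, hx⟩ rfl
    simp only [T.e.apply_symm_apply] at key
    have hx : 𝔻.bot.proj (𝔻.left.proj (𝔻.left.smul t (T.e.symm (m, u, v, w)).1)) = m := by
      rw [hl, T.proj_symm₁]
    have hx' := hx
    rw [h.comm] at hx'
    refine T.eq_symm hl (T.eq_symm₂ (mem_of_eq_coe hx') hx' ?_) fun hx => congrArg Prod.snd (key hx)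
    rw [← T.top_proj ⟨_, mem_of_eq_coe hx⟩ ⟨_, mem_of_eq_coe hx'⟩ rfl]
    exact congrArg Prod.fst (key _)
  top_add m u u' v w w' := by
    have hb : 𝔻.top.proj (T.e.symm (m, u, v, w)).1 = 𝔻.top.proj (T.e.symm (m, u', v, w')).1 := by
      rw [T.top_symm h, T.top_symm h]
    have ht := (h.top_fibre.1 _ _ hb).trans (T.top_symm h m u v w)
    have key := fun hx => T.top_add _ _ ⟨_, hx⟩ hb rfl
    simp only [T.e.apply_symm_apply] at key
    have hx : 𝔻.bot.proj (𝔻.left.proj (𝔻.top.add (T.e.symm (m, u, v, w)).1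
        (T.e.symm (m, u', v, w')).1)) = m := by rw [h.comm, ht, T.proj_symm₂]
    refine T.eq_symm (T.eq_symm₁ (mem_of_eq_coe hx) hx ?_) ht fun hx => (key hx).2
    rw [← T.left_proj ⟨_, mem_of_eq_coe hx⟩ ⟨_, mem_of_eq_coe hx⟩ rfl]
    exact (key _).1
  top_smul t m u v w := by
    have ht := (h.top_fibre.2 t _).trans (T.top_symm h m u v w)
    have key := fun hx => T.top_smul t (T.e.symm (m, u, v, w)) ⟨_, hx⟩ rfl
    simp only [T.e.apply_symm_apply] at key
    have hx : 𝔻.bot.proj (𝔻.left.proj (𝔻.top.smul t (T.e.symm (m, u, v, w)).1)) = m := by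
      rw [h.comm, ht, T.proj_symm₂]
    refine T.eq_symm (T.eq_symm₁ (mem_of_eq_coe hx) hx ?_) ht fun hx => (key hx).2
    rw [← T.left_proj ⟨_, mem_of_eq_coe hx⟩ ⟨_, mem_of_eq_coe hx⟩ rfl]
    exact (key _).1

end DoubleVectorTrivialization

theorem IsDoubleVectorBundle.exists_chart (h : IsDoubleVectorBundle 𝔻) (m : M) :
    ∃ U : Set M, IsOpen[dTopology] U ∧ m ∈ U ∧
      ∃ k₁ k₂ k₃ : ℕ, Nonempty (DoubleVectorChart 𝔻 U k₁ k₂ k₃) := by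
  obtain ⟨U, hU, hm, k₁, k₂, k₃, ⟨T⟩⟩ := h.locally_trivial m
  exact ⟨U, hU, hm, k₁, k₂, k₃, ⟨T.toChart h⟩⟩

end DoubleVectorCharts

/-! ### Double vector bundles from an atlas of charts -/

section OfCharts

theorem exists_coe_eq {X : Type*} {U : Set X} {x : X} (h : x ∈ U) : ∃ m : U, x = m := ⟨⟨x, h⟩, rfl⟩

variable {D D₁ D₂ M : Type*} [DiffeologicalSpace D] [DiffeologicalSpace D₁] [DiffeologicalSpace D₂]
  [DiffeologicalSpace M] {𝔻 : DoubleVectorBundleData D D₁ D₂ M}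

/-- A chart as a local trivialization. -/
def DoubleVectorChart.toTrivialization {U : Set M} {k₁ k₂ k₃ : ℕ}
    (C : DoubleVectorChart 𝔻 U k₁ k₂ k₃) (hleft : DSmooth 𝔻.left.proj)
    (htop : DSmooth 𝔻.top.proj) (hbot : DSmooth 𝔻.bot.proj) (hright : DSmooth 𝔻.right.proj)
    (comm : ∀ x, 𝔻.bot.proj (𝔻.left.proj x) = 𝔻.right.proj (𝔻.top.proj x)) :
    DoubleVectorTrivialization 𝔻 U k₁ k₂ k₃ where
  e₁ :=
    { toFun := fun y => (⟨_, y.2⟩, C.c₁ y.1)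
      invFun := fun p => ⟨C.pt₁ p.1 p.2, mem_of_eq_coe (C.bot_pt₁ _ _)⟩
      left_inv := fun y => Subtype.ext (C.eta₁ y.1 y.2)
      right_inv := fun p => Prod.ext (Subtype.ext (C.bot_pt₁ _ _)) (C.c₁_pt₁ _ _) }
  e₂ :=
    { toFun := fun z => (⟨_, z.2⟩, C.c₂ z.1)
      invFun := fun p => ⟨C.pt₂ p.1 p.2, mem_of_eq_coe (C.right_pt₂ _ _)⟩
      left_inv := fun z => Subtype.ext (C.eta₂ z.1 z.2)
      right_inv := fun p => Prod.ext (Subtype.ext (C.right_pt₂ _ _)) (C.c₂_pt₂ _ _) }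
  e :=
    { toFun := fun x => (⟨_, x.2⟩, C.c₁ (𝔻.left.proj x.1), C.c₂ (𝔻.top.proj x.1), C.c₃ x.1)
      invFun := fun p => ⟨C.pt p.1 p.2.1 p.2.2.1 p.2.2.2, mem_of_eq_coe (C.base_pt _ _ _ _)⟩
      left_inv := fun x => Subtype.ext (C.eta x.1 x.2)
      right_inv := fun p => Prod.ext (Subtype.ext (C.base_pt _ _ _ _)) (Prod.ext
        ((congrArg C.c₁ (C.left_pt _ _ _ _)).trans (C.c₁_pt₁ _ _)) (Prod.ext
        ((congrArg C.c₂ (C.top_pt _ _ _ _)).trans (C.c₂_pt₂ _ _)) (C.c₃_pt _ _ _ _))) }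
  diffeo₁ := ⟨fun n p hp => ⟨hbot _ _ hp, C.isPlot_c₁ (y := fun a => (p a).1) hp fun a => (p a).2⟩,
    fun n p hp => C.isPlot_pt₁ (m := fun a => (p a).1) hp.1 hp.2⟩
  diffeo₂ := ⟨fun n p hp =>
      ⟨hright _ _ hp, C.isPlot_c₂ (z := fun a => (p a).1) hp fun a => (p a).2⟩,
    fun n p hp => C.isPlot_pt₂ (m := fun a => (p a).1) hp.1 hp.2⟩
  diffeo := ⟨fun n p hp => ⟨hbot _ _ (hleft _ _ hp),
      C.isPlot_c₁ (y := fun a => 𝔻.left.proj (p a).1) (hleft _ _ hp) fun a => (p a).2,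
      C.isPlot_c₂ (z := fun a => 𝔻.top.proj (p a).1) (htop _ _ hp) fun a => comm _ ▸ (p a).2,
      C.isPlot_c₃ (x := fun a => (p a).1) hp fun a => (p a).2⟩,
    fun n p hp => C.isPlot_pt (m := fun a => (p a).1) hp.1 hp.2.1 hp.2.2.1 hp.2.2.2⟩
  base₁ _ := rfl
  base₂ _ := rfl
  base _ := rfl
  left_proj x y h := congrArg C.c₁ h
  top_proj x z h := congrArg C.c₂ h
  bot_add := by
    rintro ⟨x, hx⟩ ⟨y, hy⟩ ⟨z, hz⟩ h rfl
    obtain ⟨m, hm'⟩ := exists_coe_eq hx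
    obtain ⟨u, rfl⟩ := C.exists_pt₁ m hm'
    obtain ⟨u', rfl⟩ := C.exists_pt₁ m (h.symm.trans hm')
    simp [C.bot_add, C.c₁_pt₁]
  bot_smul := by
    rintro t ⟨x, hx⟩ ⟨z, hz⟩ rfl
    obtain ⟨m, hm'⟩ := exists_coe_eq hx
    obtain ⟨u, rfl⟩ := C.exists_pt₁ m hm'
    simp [C.bot_smul, C.c₁_pt₁]
  right_add := by
    rintro ⟨x, hx⟩ ⟨y, hy⟩ ⟨z, hz⟩ h rfl
    obtain ⟨m, hm'⟩ := exists_coe_eq hx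
    obtain ⟨u, rfl⟩ := C.exists_pt₂ m hm'
    obtain ⟨u', rfl⟩ := C.exists_pt₂ m (h.symm.trans hm')
    simp [C.right_add, C.c₂_pt₂]
  right_smul := by
    rintro t ⟨x, hx⟩ ⟨z, hz⟩ rfl
    obtain ⟨m, hm'⟩ := exists_coe_eq hx
    obtain ⟨u, rfl⟩ := C.exists_pt₂ m hm'
    simp [C.right_smul, C.c₂_pt₂]
  left_add := by
    rintro ⟨x, hx⟩ ⟨y, hy⟩ ⟨z, hz⟩ h rfl
    obtain ⟨m, hm'⟩ := exists_coe_eq hx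
    obtain ⟨u, v, w, rfl⟩ := C.exists_pt m hm'
    obtain ⟨v', w', rfl⟩ := C.exists_pt_left m (h.symm.trans (C.left_pt _ _ _ _))
    simp [C.left_add, C.top_pt, C.c₂_pt₂, C.c₃_pt]
  left_smul := by
    rintro t ⟨x, hx⟩ ⟨z, hz⟩ rfl
    obtain ⟨m, hm'⟩ := exists_coe_eq hx
    obtain ⟨u, v, w, rfl⟩ := C.exists_pt m hm'
    simp [C.left_smul, C.top_pt, C.c₂_pt₂, C.c₃_pt]
  top_add := by
    rintro ⟨x, hx⟩ ⟨y, hy⟩ ⟨z, hz⟩ h rfl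
    obtain ⟨m, hm'⟩ := exists_coe_eq hx
    obtain ⟨u, v, w, rfl⟩ := C.exists_pt m hm'
    obtain ⟨u', v', w', rfl⟩ := C.exists_pt m (x := y)
        ((comm y).trans ((congrArg 𝔻.right.proj h.symm).trans ((comm _).symm.trans hm')))
    rw [C.top_pt, C.top_pt, C.pt₂_inj] at h
    subst h
    simp [C.top_add, C.left_pt, C.c₁_pt₁, C.c₃_pt]
  top_smul := by
    rintro t ⟨x, hx⟩ ⟨z, hz⟩ rfl
    obtain ⟨m, hm'⟩ := exists_coe_eq hx
    obtain ⟨u, v, w, rfl⟩ := C.exists_pt m hm'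
    simp [C.top_smul, C.left_pt, C.c₁_pt₁, C.c₃_pt]

/-- Each algebraic axiom compares points over a single point of `M`, hence reduces to an identity
between coordinates in one chart. Commutativity of the square is assumed because it places two
points of one fibre over `D₂` over the same point of `M`, that is, in the same chart. -/
theorem isDoubleVectorBundle_of_charts (hleft : DSmooth 𝔻.left.proj)
    (htop : DSmooth 𝔻.top.proj) (hbot : DSmooth 𝔻.bot.proj) (hright : DSmooth 𝔻.right.proj)
    (comm : ∀ x, 𝔻.bot.proj (𝔻.left.proj x) = 𝔻.right.proj (𝔻.top.proj x))
    (H : ∀ m : M, ∃ U : Set M, IsOpen[dTopology] U ∧ m ∈ U ∧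
      ∃ k₁ k₂ k₃ : ℕ, Nonempty (DoubleVectorChart 𝔻 U k₁ k₂ k₃)) : IsDoubleVectorBundle 𝔻 where
  smooth_left := hleft
  smooth_top := htop
  smooth_bot := hbot
  smooth_right := hright
  comm := comm
  left_fibre := by
    refine ⟨fun x y h => ?_, fun t x => ?_⟩
    all_goals
      obtain ⟨U, -, hm, k₁, k₂, k₃, ⟨C⟩⟩ := H (𝔻.bot.proj (𝔻.left.proj x))
      obtain ⟨m, hm'⟩ := exists_coe_eq hm
      obtain ⟨u, v, w, rfl⟩ := C.exists_pt m hm'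
    · obtain ⟨v', w', rfl⟩ := C.exists_pt_left m (h.symm.trans (C.left_pt _ _ _ _))
      rw [C.left_add, C.left_pt, C.left_pt]
    · rw [C.left_smul, C.left_pt, C.left_pt]
  top_fibre := by
    refine ⟨fun x y h => ?_, fun t x => ?_⟩
    all_goals
      obtain ⟨U, -, hm, k₁, k₂, k₃, ⟨C⟩⟩ := H (𝔻.bot.proj (𝔻.left.proj x))
      obtain ⟨m, hm'⟩ := exists_coe_eq hm
      obtain ⟨u, v, w, rfl⟩ := C.exists_pt m hm'
    · obtain ⟨u', v', w', hy⟩ := C.exists_pt m (x := y)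
        ((comm y).trans ((congrArg 𝔻.right.proj h.symm).trans ((comm _).symm.trans hm')))
      rw [hy, C.top_pt, C.top_pt, C.pt₂_inj] at h
      rw [hy, h, C.top_add, C.top_pt, C.top_pt]
    · rw [C.top_smul, C.top_pt, C.top_pt]
  bot_fibre := by
    refine ⟨fun x y h => ?_, fun t x => ?_⟩
    all_goals
      obtain ⟨U, -, hm, k₁, k₂, k₃, ⟨C⟩⟩ := H (𝔻.bot.proj x)
      obtain ⟨m, hm'⟩ := exists_coe_eq hm
      obtain ⟨u, rfl⟩ := C.exists_pt₁ m hm'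
    · obtain ⟨u', hy⟩ := C.exists_pt₁ m (h.symm.trans hm')
      rw [hy, C.bot_add, C.bot_pt₁, C.bot_pt₁]
    · rw [C.bot_smul, C.bot_pt₁, C.bot_pt₁]
  right_fibre := by
    refine ⟨fun x y h => ?_, fun t x => ?_⟩
    all_goals
      obtain ⟨U, -, hm, k₁, k₂, k₃, ⟨C⟩⟩ := H (𝔻.right.proj x)
      obtain ⟨m, hm'⟩ := exists_coe_eq hm
      obtain ⟨u, rfl⟩ := C.exists_pt₂ m hm'
    · obtain ⟨u', hy⟩ := C.exists_pt₂ m (h.symm.trans hm')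
      rw [hy, C.right_add, C.right_pt₂, C.right_pt₂]
    · rw [C.right_smul, C.right_pt₂, C.right_pt₂]
  top_proj_add x y h := by
    obtain ⟨U, -, hm, k₁, k₂, k₃, ⟨C⟩⟩ := H (𝔻.bot.proj (𝔻.left.proj x))
    obtain ⟨m, hm'⟩ := exists_coe_eq hm
    obtain ⟨u, v, w, rfl⟩ := C.exists_pt m hm'
    obtain ⟨v', w', rfl⟩ := C.exists_pt_left m (h.symm.trans (C.left_pt _ _ _ _))
    rw [C.left_add, C.top_pt, C.top_pt, C.top_pt, C.right_add]
  top_proj_smul t x := by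
    obtain ⟨U, -, hm, k₁, k₂, k₃, ⟨C⟩⟩ := H (𝔻.bot.proj (𝔻.left.proj x))
    obtain ⟨m, hm'⟩ := exists_coe_eq hm
    obtain ⟨u, v, w, rfl⟩ := C.exists_pt m hm'
    rw [C.left_smul, C.top_pt, C.top_pt, C.right_smul]
  left_proj_add x y h := by
    obtain ⟨U, -, hm, k₁, k₂, k₃, ⟨C⟩⟩ := H (𝔻.bot.proj (𝔻.left.proj x))
    obtain ⟨m, hm'⟩ := exists_coe_eq hm
    obtain ⟨u, v, w, rfl⟩ := C.exists_pt m hm'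
    obtain ⟨u', v', w', hy⟩ := C.exists_pt m (x := y)
        ((comm y).trans ((congrArg 𝔻.right.proj h.symm).trans ((comm _).symm.trans hm')))
    rw [hy, C.top_pt, C.top_pt, C.pt₂_inj] at h
    rw [hy, h, C.top_add, C.left_pt, C.left_pt, C.left_pt, C.bot_add]
  left_proj_smul t x := by
    obtain ⟨U, -, hm, k₁, k₂, k₃, ⟨C⟩⟩ := H (𝔻.bot.proj (𝔻.left.proj x))
    obtain ⟨m, hm'⟩ := exists_coe_eq hm
    obtain ⟨u, v, w, rfl⟩ := C.exists_pt m hm'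
    rw [C.top_smul, C.left_pt, C.left_pt, C.bot_smul]
  homothety_comm s t x := by
    obtain ⟨U, -, hm, k₁, k₂, k₃, ⟨C⟩⟩ := H (𝔻.bot.proj (𝔻.left.proj x))
    obtain ⟨m, hm'⟩ := exists_coe_eq hm
    obtain ⟨u, v, w, rfl⟩ := C.exists_pt m hm'
    rw [C.top_smul, C.left_smul, C.left_smul, C.top_smul, smul_comm]
  locally_trivial m := by
    obtain ⟨U, hU, hm, k₁, k₂, k₃, ⟨C⟩⟩ := H m
    exact ⟨U, hU, hm, k₁, k₂, k₃, ⟨C.toTrivialization hleft htop hbot hright comm⟩⟩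

end OfCharts

/-! ### The vertical dual -/

section VerticalDual

variable {D D₁ D₂ M : Type*} [DiffeologicalSpace D] [DiffeologicalSpace D₁] [DiffeologicalSpace D₂]
  [DiffeologicalSpace M] {𝔻 : DoubleVectorBundleData D D₁ D₂ M}

namespace DoubleVectorChart

variable {U : Set M} {k₁ k₂ k₃ : ℕ}

/-- The dual chart of `D → D₁`. -/
def leftDualChart (C : DoubleVectorChart 𝔻 U k₁ k₂ k₃) (h : IsDoubleVectorBundle 𝔻) :
    VectorBundleChart 𝔻.left.dual (𝔻.bot.proj ⁻¹' U) (Coord k₃ × Coord k₂) :=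
  (C.leftChart h.smooth_bot h.smooth_top h.comm).dual
    -- The product pairing reverses the factors: the coefficient q of the core coordinate comes
    -- first, as it becomes a side coordinate, and the coefficient p of the `D₂` coordinate comes
    -- last, as it becomes the core coordinate.
    ((DualPairing.coord k₂).prod (DualPairing.coord k₃))

theorem mem_pt₁ (C : DoubleVectorChart 𝔻 U k₁ k₂ k₃) (m : U) (u : Coord k₁) :
    C.pt₁ m u ∈ 𝔻.bot.proj ⁻¹' U :=
  show 𝔻.bot.proj (C.pt₁ m u) ∈ U from mem_of_eq_coe (C.bot_pt₁ m u)

/-- The functional over the point with coordinate `u` with coefficients `q` and `p`. -/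
def dualPt (C : DoubleVectorChart 𝔻 U k₁ k₂ k₃) (h : IsDoubleVectorBundle 𝔻) (m : U)
    (u : Coord k₁) (q : Coord k₃) (p : Coord k₂) : 𝔻.left.Dual :=
  (C.leftDualChart h).pt ⟨C.pt₁ m u, C.mem_pt₁ m u⟩ (q, p)

/-- The element of the dual of the core bundle with coefficient `q`. -/
def coreDualPt (C : DoubleVectorChart 𝔻 U k₁ k₂ k₃) (h : IsDoubleVectorBundle 𝔻) (m : U)
    (q : Coord k₃) : 𝔻.core.Dual :=
  ((C.coreChart h).dual (DualPairing.coord k₃)).pt m q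

variable (C : DoubleVectorChart 𝔻 U k₁ k₂ k₃) (h : IsDoubleVectorBundle 𝔻)

theorem dualPt_base (m : U) (u : Coord k₁) (q : Coord k₃) (p : Coord k₂) :
    (C.dualPt h m u q p).1.base = C.pt₁ m u := rfl

theorem dualPt_val (m : U) (u : Coord k₁) (q : Coord k₃) (p : Coord k₂) (v : Coord k₂)
    (w : Coord k₃) : (C.dualPt h m u q p).1.val (C.pt m u v w) = inner ℝ v p + inner ℝ w q := by
  have := (C.leftChart h.smooth_bot h.smooth_top h.comm).dualPt_val_pt
    ((DualPairing.coord k₂).prod (DualPairing.coord k₃))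
    ⟨C.pt₁ m u, C.mem_pt₁ m u⟩ (q, p) (v, w)
  rw [C.leftChart_pt] at this
  exact this

theorem coreDualPt_val (m : U) (q w : Coord k₃) :
    (C.coreDualPt h m q).1.val (C.corePt m w) = inner ℝ w q :=
  (C.coreChart h).dualPt_val_pt (DualPairing.coord k₃) m q w

theorem dual_ext {m : U} {u : Coord k₁} {f g : 𝔻.left.Dual} (hf : f.1.base = C.pt₁ m u)
    (hg : g.1.base = C.pt₁ m u)
    (H : ∀ v w, f.1.val (C.pt m u v w) = g.1.val (C.pt m u v w)) : f = g := by
  refine VectorBundleData.Dual.ext (hf.trans hg.symm) fun x hx => ?_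
  obtain ⟨v, w, rfl⟩ := C.exists_pt_left m (hx.trans hf)
  exact H v w

theorem exists_dualPt {m : U} {φ : 𝔻.left.Dual} (hφ : 𝔻.bot.proj φ.1.base = m) :
    ∃ u q p, φ = C.dualPt h m u q p := by
  obtain ⟨u, hu⟩ := C.exists_pt₁ m hφ
  obtain ⟨⟨q, p⟩, hq⟩ := (C.leftDualChart h).exists_pt
    ⟨C.pt₁ m u, C.mem_pt₁ m u⟩ (x := φ) hu
  exact ⟨u, q, p, hq⟩

theorem coreDual_ext (h : IsDoubleVectorBundle 𝔻) {m : U} {f g : 𝔻.core.Dual} (hf : f.1.base = m) (hg : g.1.base = m)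
    (H : ∀ w, f.1.val (C.corePt m w) = g.1.val (C.corePt m w)) : f = g :=
  (C.coreChart h).dual_ext m hf hg H

/-- On the core vector (u, 0, w) the functional with coefficients q, p takes the value ⟨w, q⟩,
whatever the point through which the vector was formed. As the projection is a `pick`, both the
existence and the uniqueness of κ are shown; for uniqueness a single point (u, 0, 0) of the fibre
suffices. -/
theorem verticalDual_top_dualPt (m : U) (u : Coord k₁) (q : Coord k₃) (p : Coord k₂) :
    𝔻.verticalDual.top.proj (C.dualPt h m u q p) = C.coreDualPt h m q := by
  have key : ∃ κ : 𝔻.core.Dual, κ.1.base = 𝔻.bot.proj (C.dualPt h m u q p).1.base ∧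
      ∀ (x : D) (c : 𝔻.Core), 𝔻.left.proj x = (C.dualPt h m u q p).1.base →
        𝔻.core.proj c = κ.1.base →
        κ.1.val c = (C.dualPt h m u q p).1.val (𝔻.coreVector x c.1) := by
    refine ⟨C.coreDualPt h m q, (C.bot_pt₁ m u).symm, fun x c hx hc => ?_⟩
    obtain ⟨v, w, rfl⟩ := C.exists_pt_left m hx
    obtain ⟨w', rfl⟩ := C.exists_corePt m hc
    rw [coreDualPt_val, corePt_val, coreVector_pt, dualPt_val, inner_zero_left, zero_add]
  obtain ⟨h1, h2⟩ := pick_spec (d := 𝔻.core.zeroDual (𝔻.bot.proj (C.dualPt h m u q p).1.base)) key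
  have h1' := h1.trans (C.bot_pt₁ m u)
  refine C.coreDual_ext h h1' rfl fun w => ?_
  refine (h2 (C.pt m u 0 0) _ (C.left_pt _ _ _ _) ((C.core_proj_corePt m w).trans h1'.symm)).trans ?_
  rw [coreDualPt_val, corePt_val, coreVector_pt, dualPt_val, inner_zero_left, zero_add]

theorem verticalDual_left_add (m : U) (u : Coord k₁) (q q' : Coord k₃) (p p' : Coord k₂) :
    𝔻.verticalDual.left.add (C.dualPt h m u q p) (C.dualPt h m u q' p') =
      C.dualPt h m u (q + q') (p + p') :=
  (C.leftDualChart h).add_pt _ _ _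

theorem verticalDual_left_smul (t : ℝ) (m : U) (u : Coord k₁) (q : Coord k₃) (p : Coord k₂) :
    𝔻.verticalDual.left.smul t (C.dualPt h m u q p) = C.dualPt h m u (t • q) (t • p) :=
  (C.leftDualChart h).smul_pt _ _ _

/-- The prescription is consistent because both functionals have the same q: ⟨v, p⟩ + ⟨w, q⟩ + ⟨v,
p'⟩ + ⟨w', q⟩ depends only on v and w + w'. -/
theorem verticalDual_top_add (m : U) (u u' : Coord k₁) (q : Coord k₃) (p p' : Coord k₂) :
    𝔻.verticalDual.top.add (C.dualPt h m u q p) (C.dualPt h m u' q p') =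
      C.dualPt h m (u + u') q (p + p') := by
  have key : ∃ χ : 𝔻.left.Dual,
      χ.1.base = 𝔻.bot.add (C.dualPt h m u q p).1.base (C.dualPt h m u' q p').1.base ∧
      𝔻.verticalDual.top.proj χ = 𝔻.verticalDual.top.proj (C.dualPt h m u q p) ∧
      ∀ x y, 𝔻.left.proj x = (C.dualPt h m u q p).1.base →
        𝔻.left.proj y = (C.dualPt h m u' q p').1.base → 𝔻.top.proj x = 𝔻.top.proj y →
        χ.1.val (𝔻.top.add x y) =
          (C.dualPt h m u q p).1.val x + (C.dualPt h m u' q p').1.val y := by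
    refine ⟨C.dualPt h m (u + u') q (p + p'), (C.bot_add _ _ _).symm, ?_, fun x y hx hy hxy => ?_⟩
    · rw [verticalDual_top_dualPt, verticalDual_top_dualPt]
    · obtain ⟨v, w, rfl⟩ := C.exists_pt_left m hx
      obtain ⟨v', w', rfl⟩ := C.exists_pt_left m hy
      rw [C.top_pt, C.top_pt, C.pt₂_inj] at hxy
      subst hxy
      rw [C.top_add, dualPt_val, dualPt_val, dualPt_val, inner_add_right, inner_add_left]
      ring
  obtain ⟨h1, -, h3⟩ := pick_spec (d := C.dualPt h m u q p) key
  refine C.dual_ext (h1.trans (C.bot_add _ _ _)) rfl fun v w => ?_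
  -- Every vector over u + u' is (u, v, w) +₂ (u', v, 0), so the prescribed values determine the
  -- sum.
  have := h3 (C.pt m u v w) (C.pt m u' v 0) (C.left_pt _ _ _ _) (C.left_pt _ _ _ _)
    (by rw [C.top_pt, C.top_pt])
  rw [C.top_add, add_zero] at this
  refine this.trans ?_
  rw [dualPt_val, dualPt_val, dualPt_val, inner_add_right, inner_zero_left]
  ring

/-- For t = 0 the vectors t ·₂ x do not fill the fibre: their core coordinate vanishes. The values
on them determine p but not q, and q is determined by the requirement that the projection to `D₃*`
be unchanged. -/
theorem verticalDual_top_smul (t : ℝ) (m : U) (u : Coord k₁) (q : Coord k₃) (p : Coord k₂) :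
    𝔻.verticalDual.top.smul t (C.dualPt h m u q p) = C.dualPt h m (t • u) q (t • p) := by
  have key : ∃ χ : 𝔻.left.Dual,
      χ.1.base = 𝔻.bot.smul t (C.dualPt h m u q p).1.base ∧
      𝔻.verticalDual.top.proj χ = 𝔻.verticalDual.top.proj (C.dualPt h m u q p) ∧
      ∀ x, 𝔻.left.proj x = (C.dualPt h m u q p).1.base →
        χ.1.val (𝔻.top.smul t x) = t * (C.dualPt h m u q p).1.val x := by
    refine ⟨C.dualPt h m (t • u) q (t • p), (C.bot_smul _ _ _).symm, ?_, fun x hx => ?_⟩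
    · rw [verticalDual_top_dualPt, verticalDual_top_dualPt]
    · obtain ⟨v, w, rfl⟩ := C.exists_pt_left m hx
      rw [C.top_smul, dualPt_val, dualPt_val, inner_smul_right, real_inner_smul_left]
      ring
  obtain ⟨h1, h2, h3⟩ := pick_spec (d := C.dualPt h m u q p) key
  change (𝔻.verticalDual.top.smul t (C.dualPt h m u q p)).1.base = _ at h1
  change 𝔻.verticalDual.top.proj (𝔻.verticalDual.top.smul t (C.dualPt h m u q p)) = _ at h2
  change ∀ x, _ → (𝔻.verticalDual.top.smul t (C.dualPt h m u q p)).1.val _ = _ at h3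
  obtain ⟨u', q', p', hχ⟩ := C.exists_dualPt h (m := m)
    (φ := 𝔻.verticalDual.top.smul t (C.dualPt h m u q p))
    (by rw [h1, dualPt_base, C.bot_smul, C.bot_pt₁])
  rw [hχ] at h1 h2 h3 ⊢
  rw [dualPt_base, dualPt_base, C.bot_smul, C.pt₁_inj] at h1
  subst h1
  rw [verticalDual_top_dualPt, verticalDual_top_dualPt] at h2
  obtain rfl : q' = q := by
    refine (DualPairing.coord k₃).ext fun w => ?_
    have := congrArg (fun κ : 𝔻.core.Dual => κ.1.val (C.corePt m w)) h2
    exact (C.coreDualPt_val h m q' w).symm.trans (this.trans (C.coreDualPt_val h m q w))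
  congr 1
  refine (DualPairing.coord k₂).ext fun v => ?_
  -- With w = 0 the term containing q drops out and only ⟨v, p'⟩ = t ⟨v, p⟩ remains.
  have := h3 (C.pt m u v 0) (C.left_pt _ _ _ _)
  rw [C.top_smul, smul_zero, dualPt_val, dualPt_val, inner_zero_left, add_zero, add_zero,
    ← inner_smul_right] at this
  exact this

/-- The chart of the vertical dual. -/
def verticalDual : DoubleVectorChart 𝔻.verticalDual U k₁ k₃ k₂ where
  pt₁ := C.pt₁
  pt₂ := C.coreDualPt h
  pt := C.dualPt h
  c₁ := C.c₁
  c₂ := ((C.coreChart h).dual (DualPairing.coord k₃)).coord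
  c₃ φ := ((C.leftDualChart h).coord φ).2
  bot_pt₁ := C.bot_pt₁
  right_pt₂ _ _ := rfl
  left_pt _ _ _ _ := rfl
  top_pt := C.verticalDual_top_dualPt h
  c₁_pt₁ := C.c₁_pt₁
  c₂_pt₂ := ((C.coreChart h).dual (DualPairing.coord k₃)).coord_pt
  c₃_pt m u q p := by
    rw [dualPt, VectorBundleChart.coord_pt]
  eta₁ := C.eta₁
  eta₂ := ((C.coreChart h).dual (DualPairing.coord k₃)).pt_coord
  eta φ hφ := by
    obtain ⟨u, q, p, hp⟩ := C.exists_dualPt h (φ := φ) (m := ⟨_, hφ⟩) rfl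
    have e1 : C.c₁ (𝔻.verticalDual.left.proj φ) = u :=
      (congrArg (fun φ => C.c₁ (𝔻.verticalDual.left.proj φ)) hp).trans (C.c₁_pt₁ _ _)
    have e2 : ((C.coreChart h).dual (DualPairing.coord k₃)).coord
        (𝔻.verticalDual.top.proj φ) = q := by
      rw [hp, verticalDual_top_dualPt, coreDualPt, VectorBundleChart.coord_pt]
    have e3 : ((C.leftDualChart h).coord φ).2 = p := by
      rw [hp, dualPt, VectorBundleChart.coord_pt]
    rw [e1, e2, e3]
    exact hp.symm
  isPlot_pt₁ := C.isPlot_pt₁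
  isPlot_pt₂ := ((C.coreChart h).dual (DualPairing.coord k₃)).isPlot_pt
  isPlot_pt {n m u q p} hm hu hq hp := (C.leftDualChart h).isPlot_pt
    (b := fun a => ⟨C.pt₁ (m a) (u a), C.mem_pt₁ _ _⟩)
    (C.isPlot_pt₁ hm hu) (v := fun a => (q a, p a)) ⟨hq, hp⟩
  isPlot_c₁ := C.isPlot_c₁
  isPlot_c₂ := ((C.coreChart h).dual (DualPairing.coord k₃)).isPlot_coord
  isPlot_c₃ hx hU := ((C.leftDualChart h).isPlot_coord hx hU).2
  bot_add := C.bot_add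
  bot_smul := C.bot_smul
  right_add := ((C.coreChart h).dual (DualPairing.coord k₃)).add_pt
  right_smul := ((C.coreChart h).dual (DualPairing.coord k₃)).smul_pt
  left_add _ _ _ _ _ _ := C.verticalDual_left_add h _ _ _ _ _ _
  left_smul := C.verticalDual_left_smul h
  top_add := C.verticalDual_top_add h
  top_smul := C.verticalDual_top_smul h

end DoubleVectorChart

theorem verticalDual_comm (h : IsDoubleVectorBundle 𝔻) (φ : 𝔻.left.Dual) :
    (𝔻.verticalDual.top.proj φ).1.base = 𝔻.bot.proj φ.1.base := by
  obtain ⟨U, -, hm, k₁, k₂, k₃, ⟨C⟩⟩ := h.exists_chart (𝔻.bot.proj φ.1.base)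
  obtain ⟨u, q, p, hp⟩ := C.exists_dualPt h (φ := φ) (m := ⟨_, hm⟩) rfl
  have : 𝔻.verticalDual.top.proj φ = C.coreDualPt h ⟨_, hm⟩ q :=
    (congrArg _ hp).trans (C.verticalDual_top_dualPt h _ _ _ _)
  rw [this]
  rfl

/-- The defining property of the projection, in a form free of `pick` and of coordinates. Any `x` in
the fibre may be used. -/
theorem verticalDual_top_val (h : IsDoubleVectorBundle 𝔻) {φ : 𝔻.left.Dual} {x : D}
    {c : 𝔻.Core} (hx : 𝔻.left.proj x = φ.1.base) (hc : 𝔻.core.proj c = 𝔻.bot.proj φ.1.base) :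
    (𝔻.verticalDual.top.proj φ).1.val c = φ.1.val (𝔻.coreVector x c.1) := by
  obtain ⟨U, -, hm, k₁, k₂, k₃, ⟨C⟩⟩ := h.exists_chart (𝔻.bot.proj φ.1.base)
  generalize hm' : 𝔻.bot.proj φ.1.base = m at hm hc
  obtain ⟨u, q, p, rfl⟩ := C.exists_dualPt h (φ := φ) (m := ⟨_, hm⟩) hm'
  obtain ⟨v, w, rfl⟩ := C.exists_pt_left _ hx
  obtain ⟨w', rfl⟩ := C.exists_corePt ⟨_, hm⟩ hc
  rw [C.verticalDual_top_dualPt, C.coreDualPt_val, C.corePt_val, C.coreVector_pt, C.dualPt_val,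
    inner_zero_left, zero_add]

/-- Smoothness of κ has to be tested on a moving core element, where κ is a value of φ on a core
vector. That vector needs a point of the moving fibre; locally (u, 0, 0), with u the coordinate of
the base point, provides one smoothly. -/
theorem verticalDual_smooth_top (h : IsDoubleVectorBundle 𝔻) :
    DSmooth 𝔻.verticalDual.top.proj := by
  intro n c hc
  refine ⟨?_, fun k s x hs hx hb => ?_⟩
  · have : (fun u => ((𝔻.verticalDual.top.proj ∘ c) u).1.base) =
        fun u => 𝔻.bot.proj (c u).1.base := funext fun u => verticalDual_comm h (c u)
    rw [this]
    exact h.smooth_bot _ _ hc.1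
  · have hb' : ∀ v, 𝔻.core.proj (x v) = 𝔻.bot.proj (c (s v)).1.base := fun v =>
      (hb v).trans (verticalDual_comm h _)
    have hβ : IsPlot fun v => 𝔻.bot.proj (c (s v)).1.base :=
      isPlot_reparam (h.smooth_bot _ _ hc.1) hs
    refine isPlot_of_local hβ fun m => ?_
    obtain ⟨U, hU, hm, k₁, k₂, k₃, ⟨C⟩⟩ := h.exists_chart m
    refine ⟨U, hU, hm, fun l f hf hfU => ?_⟩
    have hy : ∀ v, 𝔻.left.proj (C.pt ⟨_, hfU v⟩ (C.c₁ (c (s (f v))).1.base) 0 0) =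
        (c (s (f v))).1.base := fun v => by rw [C.left_pt, C.eta₁]
    have hx' : ∀ v, 𝔻.bot.proj (𝔻.left.proj (x (f v)).1) ∈ U := fun v => by
      have := hfU v
      rwa [← hb'] at this
    have e : ∀ v, ((𝔻.verticalDual.top.proj ∘ c) (s (f v))).1.val (x (f v)) =
        (c (s (f v))).1.val
          (C.pt ⟨_, hfU v⟩ (C.c₁ (c (s (f v))).1.base) 0 (C.c₃ (x (f v)).1)) := fun v => by
      refine (verticalDual_top_val h (hy v) (hb' _)).trans ?_
      obtain ⟨w, hw⟩ := C.exists_corePt ⟨_, hfU v⟩ (hb' (f v))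
      rw [hw, C.corePt_val, C.coreVector_pt, C.c₃_pt]
    simp only [e]
    have hcb : IsPlot fun v => (c (s (f v))).1.base := isPlot_reparam hc.1 (hs.comp hf)
    refine hc.2 l (fun v => s (f v)) _ (hs.comp hf) (C.isPlot_pt (m := fun v => ⟨_, hfU v⟩)
      (isPlot_reparam hβ hf) (C.isPlot_c₁ hcb hfU) isPlot_const
      (C.isPlot_c₃ (x := fun v => (x (f v)).1) (isPlot_reparam hx hf) hx')) fun v => ?_
    rw [C.left_pt, C.eta₁]

/-- In the charts of the vertical dual the dimensions `k₂` and `k₃` have changed places: `D₃*` is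
the new side and `D₂*` the new core. -/
theorem isDoubleVectorBundle_verticalDual (h : IsDoubleVectorBundle 𝔻) :
    IsDoubleVectorBundle 𝔻.verticalDual :=
  isDoubleVectorBundle_of_charts (fun _ _ hc => hc.1) (verticalDual_smooth_top h) h.smooth_bot
    (fun _ _ hc => hc.1) (fun φ => (verticalDual_comm h φ).symm) fun m => by
      obtain ⟨U, hU, hm, k₁, k₂, k₃, ⟨C⟩⟩ := h.exists_chart m
      exact ⟨U, hU, hm, k₁, k₃, k₂, ⟨C.verticalDual h⟩⟩

end VerticalDual

/-! ### Affine combinations in a double vector bundle -/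

theorem VectorBundleData.IsLinearFunction.map_aff {E B : Type*} [DiffeologicalSpace E]
    {ξ : VectorBundleData E B} (hξ : ξ.FibrePreserving) {l : E → ℝ} (hl : ξ.IsLinearFunction l)
    {x y : E} (h : ξ.proj x = ξ.proj y) (t : ℝ) :
    l (ξ.toAffine.aff x y t) = t * l x + (1 - t) * l y := by
  change l (ξ.add _ _) = _
  rw [hl.map_add _ _ (by rw [hξ.2, hξ.2, h]), hl.map_smul, hl.map_smul]

theorem VectorBundleData.FibrePreserving.proj_aff {E B : Type*} {ξ : VectorBundleData E B}
    (hξ : ξ.FibrePreserving) {x y : E} (h : ξ.proj x = ξ.proj y) (t : ℝ) :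
    ξ.proj (ξ.toAffine.aff x y t) = ξ.proj x := by
  change ξ.proj (ξ.add _ _) = _
  rw [hξ.1 _ _ (by rw [hξ.2, hξ.2, h]), hξ.2]

section AffineCombinations

variable {D D₁ D₂ M : Type*} [DiffeologicalSpace D] [DiffeologicalSpace D₁] [DiffeologicalSpace D₂]
  [DiffeologicalSpace M] {𝔻 : DoubleVectorBundleData D D₁ D₂ M}

namespace DoubleVectorChart

variable {U : Set M} {k₁ k₂ k₃ : ℕ} (C : DoubleVectorChart 𝔻 U k₁ k₂ k₃)

theorem bot_aff (m : U) (u u' : Coord k₁) (t : ℝ) :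
    𝔻.bot.toAffine.aff (C.pt₁ m u) (C.pt₁ m u') t = C.pt₁ m (t • u + (1 - t) • u') := by
  change 𝔻.bot.add _ _ = _
  rw [C.bot_smul, C.bot_smul, C.bot_add]

theorem right_aff (m : U) (v v' : Coord k₂) (t : ℝ) :
    𝔻.right.toAffine.aff (C.pt₂ m v) (C.pt₂ m v') t = C.pt₂ m (t • v + (1 - t) • v') := by
  change 𝔻.right.add _ _ = _
  rw [C.right_smul, C.right_smul, C.right_add]

theorem left_aff (m : U) (u : Coord k₁) (v v' : Coord k₂) (w w' : Coord k₃) (t : ℝ) :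
    𝔻.left.toAffine.aff (C.pt m u v w) (C.pt m u v' w') t =
      C.pt m u (t • v + (1 - t) • v') (t • w + (1 - t) • w') := by
  change 𝔻.left.add _ _ = _
  rw [C.left_smul, C.left_smul, C.left_add]

theorem top_aff (m : U) (u u' : Coord k₁) (v : Coord k₂) (w w' : Coord k₃) (t : ℝ) :
    𝔻.top.toAffine.aff (C.pt m u v w) (C.pt m u' v w') t =
      C.pt m (t • u + (1 - t) • u') v (t • w + (1 - t) • w') := by
  change 𝔻.top.add _ _ = _
  rw [C.top_smul, C.top_smul, C.top_add]

/-- The chart of the bundle `D₁ → M`. -/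
def botChart : VectorBundleChart 𝔻.bot U (Coord k₁) where
  pt := C.pt₁
  coord := C.c₁
  proj_pt := C.bot_pt₁
  coord_pt := C.c₁_pt₁
  pt_coord := C.eta₁
  isPlot_pt := C.isPlot_pt₁
  isPlot_coord := C.isPlot_c₁
  add_pt := C.bot_add
  smul_pt := C.bot_smul

theorem exists_pt_pair_left {m : U} {x y : D} (hx : 𝔻.bot.proj (𝔻.left.proj x) = m)
    (h : 𝔻.left.proj x = 𝔻.left.proj y) :
    ∃ u v w v' w', x = C.pt m u v w ∧ y = C.pt m u v' w' := by
  obtain ⟨u, v, w, rfl⟩ := C.exists_pt m hx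
  obtain ⟨v', w', rfl⟩ := C.exists_pt_left m (h.symm.trans (C.left_pt _ _ _ _))
  exact ⟨u, v, w, v', w', rfl, rfl⟩

theorem exists_pt_pair_top (h𝔻 : IsDoubleVectorBundle 𝔻) {m : U} {x y : D}
    (hx : 𝔻.bot.proj (𝔻.left.proj x) = m) (h : 𝔻.top.proj x = 𝔻.top.proj y) :
    ∃ u v w u' w', x = C.pt m u v w ∧ y = C.pt m u' v w' := by
  obtain ⟨u, v, w, rfl⟩ := C.exists_pt m hx
  obtain ⟨u', v', w', rfl⟩ := C.exists_pt m (x := y)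
    (by rw [h𝔻.comm, ← h, C.top_pt, C.right_pt₂])
  rw [C.top_pt, C.top_pt, C.pt₂_inj] at h
  subst h
  exact ⟨u, v, w, u', w', rfl, rfl⟩

end DoubleVectorChart

namespace IsDoubleVectorBundle

theorem top_proj_left_aff (h : IsDoubleVectorBundle 𝔻) {x y : D}
    (hxy : 𝔻.left.proj x = 𝔻.left.proj y) (t : ℝ) :
    𝔻.top.proj (𝔻.left.toAffine.aff x y t) =
      𝔻.right.toAffine.aff (𝔻.top.proj x) (𝔻.top.proj y) t := by
  change 𝔻.top.proj (𝔻.left.add _ _) = 𝔻.right.add _ _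
  rw [h.top_proj_add _ _ (by rw [h.left_fibre.2, h.left_fibre.2, hxy]), h.top_proj_smul,
    h.top_proj_smul]

theorem left_proj_top_aff (h : IsDoubleVectorBundle 𝔻) {x y : D}
    (hxy : 𝔻.top.proj x = 𝔻.top.proj y) (t : ℝ) :
    𝔻.left.proj (𝔻.top.toAffine.aff x y t) =
      𝔻.bot.toAffine.aff (𝔻.left.proj x) (𝔻.left.proj y) t := by
  change 𝔻.left.proj (𝔻.top.add _ _) = 𝔻.bot.add _ _
  rw [h.left_proj_add _ _ (by rw [h.top_fibre.2, h.top_fibre.2, hxy]), h.left_proj_smul,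
    h.left_proj_smul]

/-- In a chart the four points sit over the corners (u, v), (u, v'), (u', v), (u', v'). The side
coordinates agree at once, and both sides have as core coordinate the same combination, with the
product weights, of the four core coordinates. -/
theorem aff_interchange (h : IsDoubleVectorBundle 𝔻) {x x' y y' : D} (s t : ℝ)
    (hx : 𝔻.left.proj x = 𝔻.left.proj x') (hy : 𝔻.left.proj y = 𝔻.left.proj y')
    (hxy : 𝔻.top.proj x = 𝔻.top.proj y) (hxy' : 𝔻.top.proj x' = 𝔻.top.proj y') :
    𝔻.top.toAffine.aff (𝔻.left.toAffine.aff x x' s) (𝔻.left.toAffine.aff y y' s) t =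
      𝔻.left.toAffine.aff (𝔻.top.toAffine.aff x y t) (𝔻.top.toAffine.aff x' y' t) s := by
  obtain ⟨U, -, hm, k₁, k₂, k₃, ⟨C⟩⟩ := h.exists_chart (𝔻.bot.proj (𝔻.left.proj x))
  obtain ⟨m, hm'⟩ := exists_coe_eq hm
  obtain ⟨u, v, w, v', w', rfl, rfl⟩ := C.exists_pt_pair_left hm' hx
  obtain ⟨_, _, _, u', w₂, h1, rfl⟩ := C.exists_pt_pair_top h hm' hxy
  obtain ⟨v₂, w₂', rfl⟩ := C.exists_pt_left m (hy.symm.trans (C.left_pt _ _ _ _))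
  rw [C.top_pt, C.top_pt, C.pt₂_inj] at hxy hxy'
  subst hxy hxy'
  rw [C.left_aff, C.left_aff, C.top_aff, C.top_aff, C.top_aff, C.left_aff]
  congr 1
  module

end IsDoubleVectorBundle

/-! ### The level set is a double affine bundle -/

variable {l₁ : D₁ → ℝ} {l₂ : D₂ → ℝ}

/-- The weights add up to 1, so the combination formed in `D` stays in the level set; it is
therefore the element that `pick` selects. The two lemmas that follow serve the same purpose for the
other structures. -/
theorem levelSet_left_aff (h : IsDoubleVectorBundle 𝔻) (hl₂ : 𝔻.right.IsLinearFunction l₂)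
    {x y : {x : D // l₁ (𝔻.left.proj x) = 1 ∧ l₂ (𝔻.top.proj x) = 1}}
    (hxy : 𝔻.left.proj x.1 = 𝔻.left.proj y.1) (t : ℝ) :
    ((levelSet 𝔻 l₁ l₂).left.aff x y t).1 = 𝔻.left.toAffine.aff x.1 y.1 t := by
  refine pick_spec (P := fun z : {x : D // l₁ (𝔻.left.proj x) = 1 ∧ l₂ (𝔻.top.proj x) = 1} =>
    z.1 = 𝔻.left.toAffine.aff x.1 y.1 t) ⟨⟨_, ?_, ?_⟩, rfl⟩
  · rw [h.left_fibre.proj_aff hxy]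
    exact x.2.1
  · rw [h.top_proj_left_aff hxy,
      hl₂.map_aff h.right_fibre (by rw [← h.comm, ← h.comm, hxy]), x.2.2, y.2.2]
    ring

theorem levelSet_top_aff (h : IsDoubleVectorBundle 𝔻) (hl₁ : 𝔻.bot.IsLinearFunction l₁)
    {x y : {x : D // l₁ (𝔻.left.proj x) = 1 ∧ l₂ (𝔻.top.proj x) = 1}}
    (hxy : 𝔻.top.proj x.1 = 𝔻.top.proj y.1) (t : ℝ) :
    ((levelSet 𝔻 l₁ l₂).top.aff x y t).1 = 𝔻.top.toAffine.aff x.1 y.1 t := by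
  refine pick_spec (P := fun z : {x : D // l₁ (𝔻.left.proj x) = 1 ∧ l₂ (𝔻.top.proj x) = 1} =>
    z.1 = 𝔻.top.toAffine.aff x.1 y.1 t) ⟨⟨_, ?_, ?_⟩, rfl⟩
  · rw [h.left_proj_top_aff hxy,
      hl₁.map_aff h.bot_fibre (by rw [h.comm, h.comm, hxy]), x.2.1, y.2.1]
    ring
  · rw [h.top_fibre.proj_aff hxy]
    exact x.2.2

theorem restrict_level_aff {E B : Type*} [DiffeologicalSpace E] {ξ : VectorBundleData E B}
    (hξ : ξ.FibrePreserving) {l : E → ℝ} (hl : ξ.IsLinearFunction l) {x y : {x : E // l x = 1}}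
    (hxy : ξ.proj x.1 = ξ.proj y.1) (t : ℝ) :
    ((ξ.toAffine.restrict (fun x => l x = 1) fun x => ξ.proj x.1).aff x y t).1 =
      ξ.toAffine.aff x.1 y.1 t := by
  refine pick_spec (P := fun z : {x : E // l x = 1} => z.1 = ξ.toAffine.aff x.1 y.1 t)
    ⟨⟨_, ?_⟩, rfl⟩
  rw [hl.map_aff hξ hxy, x.2, y.2]
  ring

/-- Coordinates `π` on the level set of a linear function in a chart over `U' ⊆ U`, with
parametrization `S`. -/
structure LevelChart {E B : Type*} [DiffeologicalSpace E] [DiffeologicalSpace B]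
    {ξ : VectorBundleData E B} {U : Set B} {k : ℕ} (C : VectorBundleChart ξ U (Coord k))
    (l : E → ℝ) (U' : Set B) (k' : ℕ) where
  sub : U' ⊆ U
  π : Coord k →ₗ[ℝ] Coord k'
  S : U' → Coord k' → Coord k
  level : ∀ b y, l (C.pt (Set.inclusion sub b) (S b y)) = 1
  π_S : ∀ b y, π (S b y) = y
  S_π : ∀ b v, l (C.pt (Set.inclusion sub b) v) = 1 → S b (π v) = v
  isPlot_S : ∀ {n : ℕ} {b : Coord n → U'} {y : Coord n → Coord k'}, IsPlot b → IsPlot y →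
    IsPlot fun a => S (b a) (y a)

/-- The restriction of a chart of a level set to a smaller set. -/
def LevelChart.restrict {E B : Type*} [DiffeologicalSpace E] [DiffeologicalSpace B]
    {ξ : VectorBundleData E B} {U : Set B} {k : ℕ} {C : VectorBundleChart ξ U (Coord k)}
    {l : E → ℝ} {U' : Set B} {k' : ℕ} (L : LevelChart C l U' k') {V : Set B} (hV : V ⊆ U') :
    LevelChart C l V k' where
  sub := hV.trans L.sub
  π := L.π
  S b := L.S (Set.inclusion hV b)
  level b := L.level (Set.inclusion hV b)
  π_S b := L.π_S (Set.inclusion hV b)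
  S_π b := L.S_π (Set.inclusion hV b)
  isPlot_S hb := L.isPlot_S (b := fun _ => Set.inclusion hV _) hb

/-- A linear function as a linear form in the coordinates of a chart. -/
def VectorBundleChart.linearForm {E B : Type*} [DiffeologicalSpace E] [DiffeologicalSpace B]
    {ξ : VectorBundleData E B} {U : Set B} {V : Type*} [AddCommGroup V] [Module ℝ V]
    [DiffeologicalSpace V] (C : VectorBundleChart ξ U V) {l : E → ℝ} (hl : ξ.IsLinearFunction l)
    (b : U) : V →ₗ[ℝ] ℝ where
  toFun v := l (C.pt b v)
  map_add' v w := by rw [← C.add_pt, hl.map_add _ _ (by rw [C.proj_pt, C.proj_pt])]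
  map_smul' t v := by rw [← C.smul_pt, hl.map_smul]; rfl

/-- Fix a vector `v₀` on which `l` does not vanish at `b`. Wherever `l` is still nonzero on `v₀`,
which is an open condition, each line parallel to `v₀` meets the hyperplane l = 1 exactly once. The
level set is thus parametrized by the quotient by ℝ v₀, modelled on the kernel of `l` at the one
point `b`. The projection along `v₀` is linear and the same over every base point, so affine
combinations have the trivial form in these coordinates. -/
theorem VectorBundleChart.exists_levelChart {E B : Type*} [DiffeologicalSpace E]
    [DiffeologicalSpace B] {ξ : VectorBundleData E B} {U : Set B} (hU : IsOpen[dTopology] U) {k : ℕ}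
    (C : VectorBundleChart ξ U (Coord k)) {l : E → ℝ} (hl : ξ.IsLinearFunction l)
    (hl' : ξ.FibrewiseNonzero l) {b : B} (hb : b ∈ U) :
    ∃ U' : Set B, IsOpen[dTopology] U' ∧ b ∈ U' ∧ ∃ k', Nonempty (LevelChart C l U' k') := by
  obtain ⟨x, hx, hlx⟩ := hl' b
  obtain ⟨v₀, rfl⟩ := C.exists_pt ⟨b, hb⟩ hx
  let F := C.linearForm hl
  have hF : ∀ {n : ℕ} {b : Coord n → U} {v : Coord n → Coord k}, IsPlot b → IsPlot v →
      IsPlot fun a => F (b a) (v a) := fun hb hv => hl.smooth _ _ (C.isPlot_pt hb hv)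
  let F₀ := F ⟨b, hb⟩
  have hF₀ : F₀ v₀ ≠ 0 := hlx
  let K := LinearMap.ker F₀
  let ε : K ≃ₗ[ℝ] Coord (Module.finrank ℝ K) :=
    LinearEquiv.ofFinrankEq _ _ (by simp)
  -- The projection onto the kernel along `v₀`.
  let ρ : Coord k →ₗ[ℝ] K :=
    (LinearMap.id - (F₀.smulRight ((F₀ v₀)⁻¹ • v₀))).codRestrict K fun v => by
      simp [K, hF₀]
  have hρ : ∀ v, (ρ v : Coord k) = v - (F₀ v * (F₀ v₀)⁻¹) • v₀ := fun v =>
    (LinearMap.codRestrict_apply _ _ _).trans (by simp [smul_smul])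
  have hρK : ∀ z : K, ρ z = z := fun z => Subtype.ext <| by
    rw [hρ, show F₀ z = 0 from z.2]
    simp
  have hρv : ρ v₀ = 0 := Subtype.ext <| by
    rw [hρ, mul_inv_cancel₀ hF₀]
    simp
  let ι : Coord (Module.finrank ℝ K) →ₗ[ℝ] Coord k := K.subtype ∘ₗ ε.symm.toLinearMap
  refine ⟨_, isOpen_ne_zero hU (g := fun b => F b v₀)
    (fun n p hp => hF hp isPlot_const), ⟨hb, hF₀⟩, Module.finrank ℝ K, ⟨?_⟩⟩
  refine
    { sub := fun b hb => hb.1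
      π := ε.toLinearMap ∘ₗ ρ
      -- The point of the line through `ι y` in the direction `v₀` at which the linear form over `b`
      -- equals 1.
      S := fun b y => ι y + ((1 - F ⟨b, b.2.1⟩ (ι y)) / F ⟨b, b.2.1⟩ v₀) • v₀
      level := fun b y => ?_
      π_S := fun b y => ?_
      S_π := fun b v hv => ?_
      isPlot_S := fun {n b y} hb hy => ?_ }
  · change F ⟨b, b.2.1⟩ _ = 1
    rw [map_add, map_smul, smul_eq_mul, div_mul_cancel₀ _ b.2.2]
    ring
  · have h1 : ρ (ι y) = ε.symm y := hρK _
    change ε (ρ (ι y + _ • v₀)) = y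
    rw [map_add, map_smul, hρv, smul_zero, add_zero, h1, ε.apply_symm_apply]
  · have h1 : ι ((ε.toLinearMap ∘ₗ ρ) v) = v - (F₀ v * (F₀ v₀)⁻¹) • v₀ := by
      rw [← hρ]
      simp [ι]
    have hv' : F ⟨b, b.2.1⟩ v = 1 := hv
    -- If the form is 1 at v, then 1 minus its value at v - c v₀ is c times its value at `v₀`; the
    -- correction therefore restores exactly the multiple of `v₀` that the projection removed.
    rw [h1, map_sub, map_smul, hv', sub_sub_cancel, smul_eq_mul, mul_div_cancel_right₀ _ b.2.2,
      sub_add_cancel]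
  · have hb' : IsPlot fun a => (⟨b a, (b a).2.1⟩ : U) := hb
    have h1 : IsPlot fun a => ι (y a) := isPlot_linearMap ι hy
    exact (h1.contDiff.add (ContDiff.smul (((contDiff_const.sub (hF hb' h1).contDiff)).div
      (hF hb' isPlot_const).contDiff fun a => (b a).2.2) contDiff_const)).isPlot

/-- The local trivialization of a level set. -/
def DoubleVectorChart.levelSetTrivialization {U : Set M} {k₁ k₂ k₃ : ℕ}
    (C : DoubleVectorChart 𝔻 U k₁ k₂ k₃) (h : IsDoubleVectorBundle 𝔻)
    (hl₁ : 𝔻.bot.IsLinearFunction l₁) (hl₂ : 𝔻.right.IsLinearFunction l₂) {U' : Set M} {j₁ j₂ : ℕ}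
    (L₁ : LevelChart C.botChart l₁ U' j₁) (L₂ : LevelChart C.rightChart l₂ U' j₂) :
    DoubleAffineTrivialization (levelSet 𝔻 l₁ l₂) U' j₁ j₂ k₃ where
  e₁ :=
    { toFun := fun y => (⟨_, y.2⟩, L₁.π (C.c₁ y.1.1))
      invFun := fun p => ⟨⟨C.pt₁ (Set.inclusion L₁.sub p.1) (L₁.S p.1 p.2), L₁.level _ _⟩,
        mem_of_eq_coe (m := p.1) (C.bot_pt₁ _ _)⟩
      left_inv := fun y => Subtype.ext (Subtype.ext (by
        have e := C.eta₁ y.1.1 (L₁.sub y.2)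
        have := L₁.S_π ⟨_, y.2⟩ (C.c₁ y.1.1) ((congrArg l₁ e).trans y.1.2)
        exact (congrArg _ this).trans e))
      right_inv := fun p => Prod.ext (Subtype.ext (C.bot_pt₁ _ _))
        ((congrArg L₁.π (C.c₁_pt₁ _ _)).trans (L₁.π_S _ _)) }
  e₂ :=
    { toFun := fun z => (⟨_, z.2⟩, L₂.π (C.c₂ z.1.1))
      invFun := fun p => ⟨⟨C.pt₂ (Set.inclusion L₂.sub p.1) (L₂.S p.1 p.2), L₂.level _ _⟩,
        mem_of_eq_coe (m := p.1) (C.right_pt₂ _ _)⟩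
      left_inv := fun z => Subtype.ext (Subtype.ext (by
        have e := C.eta₂ z.1.1 (L₂.sub z.2)
        have := L₂.S_π ⟨_, z.2⟩ (C.c₂ z.1.1) ((congrArg l₂ e).trans z.1.2)
        exact (congrArg _ this).trans e))
      right_inv := fun p => Prod.ext (Subtype.ext (C.right_pt₂ _ _))
        ((congrArg L₂.π (C.c₂_pt₂ _ _)).trans (L₂.π_S _ _)) }
  e :=
    { toFun := fun x => (⟨_, x.2⟩, L₁.π (C.c₁ (𝔻.left.proj x.1.1)),
        L₂.π (C.c₂ (𝔻.top.proj x.1.1)), C.c₃ x.1.1)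
      invFun := fun p => ⟨⟨C.pt (Set.inclusion L₁.sub p.1) (L₁.S p.1 p.2.1) (L₂.S p.1 p.2.2.1)
          p.2.2.2, by rw [C.left_pt]; exact L₁.level _ _, by rw [C.top_pt]; exact L₂.level _ _⟩,
        mem_of_eq_coe (m := p.1) (C.base_pt _ _ _ _)⟩
      left_inv := fun x => Subtype.ext (Subtype.ext (by
        have hx₁ : 𝔻.bot.proj (𝔻.left.proj x.1.1) ∈ U' := x.2
        have hx₂ : 𝔻.right.proj (𝔻.top.proj x.1.1) ∈ U' := h.comm x.1.1 ▸ hx₁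
        have e := C.eta x.1.1 (L₁.sub hx₁)
        have e₁ := C.eta₁ _ (L₁.sub hx₁)
        have e₂ := C.eta₂ _ (L₁.sub hx₂)
        have h₁ := L₁.S_π ⟨_, hx₁⟩ (C.c₁ (𝔻.left.proj x.1.1)) ((congrArg l₁ e₁).trans x.1.2.1)
        have h₂ := L₂.S_π ⟨_, hx₂⟩ (C.c₂ (𝔻.top.proj x.1.1)) ((congrArg l₂ e₂).trans x.1.2.2)
        -- The two level charts see the base point of `x` along the two ways round the square.
        have hb : (⟨_, hx₂⟩ : U') = ⟨_, hx₁⟩ := Subtype.ext (h.comm _).symm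
        rw [hb] at h₂
        refine Eq.trans ?_ e
        change C.pt _ (L₁.S ⟨_, hx₁⟩ _) (L₂.S ⟨_, hx₁⟩ _) _ = _
        rw [h₁, h₂]
        rfl))
      right_inv := fun p => Prod.ext (Subtype.ext (C.base_pt _ _ _ _)) (Prod.ext
        ((congrArg (fun y => L₁.π (C.c₁ y)) (C.left_pt _ _ _ _)).trans
          ((congrArg L₁.π (C.c₁_pt₁ _ _)).trans (L₁.π_S _ _))) (Prod.ext
        ((congrArg (fun z => L₂.π (C.c₂ z)) (C.top_pt _ _ _ _)).trans
          ((congrArg L₂.π (C.c₂_pt₂ _ _)).trans (L₂.π_S _ _))) (C.c₃_pt _ _ _ _))) }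
  diffeo₁ := ⟨fun n p hp => ⟨h.smooth_bot _ _ hp, isPlot_linearMap L₁.π
      (C.isPlot_c₁ (y := fun a => (p a).1.1) hp fun a => L₁.sub (p a).2)⟩,
    fun n p hp => C.isPlot_pt₁ (m := fun a => Set.inclusion L₁.sub (p a).1) hp.1
      (L₁.isPlot_S (b := fun a => (p a).1) hp.1 hp.2)⟩
  diffeo₂ := ⟨fun n p hp => ⟨h.smooth_right _ _ hp, isPlot_linearMap L₂.π
      (C.isPlot_c₂ (z := fun a => (p a).1.1) hp fun a => L₂.sub (p a).2)⟩,
    fun n p hp => C.isPlot_pt₂ (m := fun a => Set.inclusion L₂.sub (p a).1) hp.1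
      (L₂.isPlot_S (b := fun a => (p a).1) hp.1 hp.2)⟩
  diffeo := ⟨fun n p hp => ⟨h.smooth_bot _ _ (h.smooth_left _ _ hp),
      isPlot_linearMap L₁.π (C.isPlot_c₁ (y := fun a => 𝔻.left.proj (p a).1.1)
        (h.smooth_left _ _ hp) fun a => L₁.sub (p a).2),
      isPlot_linearMap L₂.π (C.isPlot_c₂ (z := fun a => 𝔻.top.proj (p a).1.1)
        (h.smooth_top _ _ hp) fun a => h.comm _ ▸ L₁.sub (p a).2),
      C.isPlot_c₃ (x := fun a => (p a).1.1) hp fun a => L₁.sub (p a).2⟩,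
    fun n p hp => C.isPlot_pt (m := fun a => Set.inclusion L₁.sub (p a).1) hp.1
      (L₁.isPlot_S (b := fun a => (p a).1) hp.1 hp.2.1)
      (L₂.isPlot_S (b := fun a => (p a).1) hp.1 hp.2.2.1) hp.2.2.2⟩
  base₁ _ := rfl
  base₂ _ := rfl
  base _ := rfl
  left_proj x y hxy := congrArg (fun y => L₁.π (C.c₁ y.1)) hxy
  top_proj x z hxz := congrArg (fun z => L₂.π (C.c₂ z.1)) hxz
  bot_aff x y z t hxy hz := by
    obtain ⟨m, hm⟩ := exists_coe_eq (L₁.sub x.2)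
    obtain ⟨u, hu⟩ := C.exists_pt₁ m hm
    obtain ⟨u', hu'⟩ := C.exists_pt₁ m (hxy.symm.trans hm)
    have hz' : z.1.1 = 𝔻.bot.toAffine.aff x.1.1 y.1.1 t :=
      (congrArg Subtype.val hz).trans (restrict_level_aff h.bot_fibre hl₁ hxy t)
    change L₁.π (C.c₁ z.1.1) = t • L₁.π (C.c₁ x.1.1) + (1 - t) • L₁.π (C.c₁ y.1.1)
    rw [hz', hu, hu', C.bot_aff, C.c₁_pt₁, C.c₁_pt₁, C.c₁_pt₁, map_add, map_smul, map_smul]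
  right_aff x y z t hxy hz := by
    obtain ⟨m, hm⟩ := exists_coe_eq (L₂.sub x.2)
    obtain ⟨v, hv⟩ := C.exists_pt₂ m hm
    obtain ⟨v', hv'⟩ := C.exists_pt₂ m (hxy.symm.trans hm)
    have hz' : z.1.1 = 𝔻.right.toAffine.aff x.1.1 y.1.1 t :=
      (congrArg Subtype.val hz).trans (restrict_level_aff h.right_fibre hl₂ hxy t)
    change L₂.π (C.c₂ z.1.1) = t • L₂.π (C.c₂ x.1.1) + (1 - t) • L₂.π (C.c₂ y.1.1)
    rw [hz', hv, hv', C.right_aff, C.c₂_pt₂, C.c₂_pt₂, C.c₂_pt₂, map_add, map_smul, map_smul]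
  left_aff x y z t hxy hz := by
    obtain ⟨m, hm⟩ := exists_coe_eq (L₁.sub x.2)
    have hxy' : 𝔻.left.proj x.1.1 = 𝔻.left.proj y.1.1 := congrArg Subtype.val hxy
    obtain ⟨u, v, w, v', w', hx, hy⟩ := C.exists_pt_pair_left hm hxy'
    have hz' : z.1.1 = 𝔻.left.toAffine.aff x.1.1 y.1.1 t :=
      (congrArg Subtype.val hz).trans (levelSet_left_aff h hl₂ hxy' t)
    change (L₂.π (C.c₂ (𝔻.top.proj z.1.1)), C.c₃ z.1.1) =
      t • (L₂.π (C.c₂ (𝔻.top.proj x.1.1)), C.c₃ x.1.1) +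
      (1 - t) • (L₂.π (C.c₂ (𝔻.top.proj y.1.1)), C.c₃ y.1.1)
    rw [hz', hx, hy, C.left_aff]
    simp only [C.top_pt, C.c₂_pt₂, C.c₃_pt, map_add, map_smul, Prod.smul_mk, Prod.mk_add_mk]
  top_aff x y z t hxy hz := by
    obtain ⟨m, hm⟩ := exists_coe_eq (L₁.sub x.2)
    have hxy' : 𝔻.top.proj x.1.1 = 𝔻.top.proj y.1.1 := congrArg Subtype.val hxy
    obtain ⟨u, v, w, u', w', hx, hy⟩ := C.exists_pt_pair_top h hm hxy'
    have hz' : z.1.1 = 𝔻.top.toAffine.aff x.1.1 y.1.1 t :=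
      (congrArg Subtype.val hz).trans (levelSet_top_aff h hl₁ hxy' t)
    change L₁.π (C.c₁ (𝔻.left.proj z.1.1)) = t • L₁.π (C.c₁ (𝔻.left.proj x.1.1)) +
      (1 - t) • L₁.π (C.c₁ (𝔻.left.proj y.1.1)) ∧
      C.c₃ z.1.1 = t • C.c₃ x.1.1 + (1 - t) • C.c₃ y.1.1
    rw [hz', hx, hy, C.top_aff]
    simp only [C.left_pt, C.c₁_pt₁, C.c₃_pt, map_add, map_smul, and_self]

/-- The conditions involve the two side coordinates separately and leave the core coordinate free,
so a chart of `D` and level charts of the sides give a trivialization. The algebraic laws are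
inherited from the affine combinations of `D`. -/
theorem isDoubleAffineBundle_levelSet (h : IsDoubleVectorBundle 𝔻)
    (hl₁ : 𝔻.bot.IsLinearFunction l₁) (hl₁' : 𝔻.bot.FibrewiseNonzero l₁)
    (hl₂ : 𝔻.right.IsLinearFunction l₂) (hl₂' : 𝔻.right.FibrewiseNonzero l₂) :
    IsDoubleAffineBundle (levelSet 𝔻 l₁ l₂) where
  smooth_left _ _ hp := h.smooth_left _ _ hp
  smooth_top _ _ hp := h.smooth_top _ _ hp
  smooth_bot _ _ hp := h.smooth_bot _ _ hp
  smooth_right _ _ hp := h.smooth_right _ _ hp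
  comm x := h.comm x.1
  left_fibre x y t hxy := by
    have hxy' : 𝔻.left.proj x.1 = 𝔻.left.proj y.1 := congrArg Subtype.val hxy
    exact Subtype.ext ((congrArg 𝔻.left.proj (levelSet_left_aff h hl₂ hxy' t)).trans
      (h.left_fibre.proj_aff hxy' t))
  top_fibre x y t hxy := by
    have hxy' : 𝔻.top.proj x.1 = 𝔻.top.proj y.1 := congrArg Subtype.val hxy
    exact Subtype.ext ((congrArg 𝔻.top.proj (levelSet_top_aff h hl₁ hxy' t)).trans
      (h.top_fibre.proj_aff hxy' t))
  bot_fibre x y t hxy := (congrArg 𝔻.bot.proj (restrict_level_aff h.bot_fibre hl₁ hxy t)).trans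
    (h.bot_fibre.proj_aff hxy t)
  right_fibre x y t hxy :=
    (congrArg 𝔻.right.proj (restrict_level_aff h.right_fibre hl₂ hxy t)).trans
      (h.right_fibre.proj_aff hxy t)
  top_proj_aff x y t hxy := by
    have hxy' : 𝔻.left.proj x.1 = 𝔻.left.proj y.1 := congrArg Subtype.val hxy
    refine Subtype.ext (((congrArg 𝔻.top.proj (levelSet_left_aff h hl₂ hxy' t)).trans
      (h.top_proj_left_aff hxy' t)).trans (restrict_level_aff h.right_fibre hl₂
      (x := (levelSet 𝔻 l₁ l₂).top.proj x) (y := (levelSet 𝔻 l₁ l₂).top.proj y) ?_ t).symm)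
    exact (h.comm _).symm.trans ((congrArg 𝔻.bot.proj hxy').trans (h.comm _))
  left_proj_aff x y t hxy := by
    have hxy' : 𝔻.top.proj x.1 = 𝔻.top.proj y.1 := congrArg Subtype.val hxy
    refine Subtype.ext (((congrArg 𝔻.left.proj (levelSet_top_aff h hl₁ hxy' t)).trans
      (h.left_proj_top_aff hxy' t)).trans (restrict_level_aff h.bot_fibre hl₁
      (x := (levelSet 𝔻 l₁ l₂).left.proj x) (y := (levelSet 𝔻 l₁ l₂).left.proj y) ?_ t).symm)
    exact (h.comm _).trans ((congrArg 𝔻.right.proj hxy').trans (h.comm _).symm)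
  surjective := by
    rintro ⟨a₁, h₁⟩ ⟨a₂, h₂⟩ ha
    have ha' : 𝔻.bot.proj a₁ = 𝔻.right.proj a₂ := ha
    obtain ⟨U, -, hm, k₁, k₂, k₃, ⟨C⟩⟩ := h.exists_chart (𝔻.bot.proj a₁)
    obtain ⟨m, hm'⟩ := exists_coe_eq hm
    obtain ⟨u, rfl⟩ := C.exists_pt₁ m hm'
    obtain ⟨v, rfl⟩ := C.exists_pt₂ m (ha'.symm.trans hm')
    exact ⟨⟨C.pt m u v 0, by rwa [C.left_pt], by rwa [C.top_pt]⟩, Subtype.ext (C.left_pt _ _ _ _),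
      Subtype.ext (C.top_pt _ _ _ _)⟩
  interchange x x' y y' s t hx hy hxy hxy' := by
    have hx₀ : 𝔻.left.proj x.1 = 𝔻.left.proj x'.1 := congrArg Subtype.val hx
    have hy₀ : 𝔻.left.proj y.1 = 𝔻.left.proj y'.1 := congrArg Subtype.val hy
    have hxy₀ : 𝔻.top.proj x.1 = 𝔻.top.proj y.1 := congrArg Subtype.val hxy
    have hxy₀' : 𝔻.top.proj x'.1 = 𝔻.top.proj y'.1 := congrArg Subtype.val hxy'
    refine Subtype.ext ?_
    rw [levelSet_top_aff h hl₁, levelSet_left_aff h hl₂ hx₀, levelSet_left_aff h hl₂ hy₀,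
      levelSet_left_aff h hl₂, levelSet_top_aff h hl₁ hxy₀, levelSet_top_aff h hl₁ hxy₀',
      h.aff_interchange s t hx₀ hy₀ hxy₀ hxy₀']
    · rw [levelSet_top_aff h hl₁ hxy₀, levelSet_top_aff h hl₁ hxy₀', h.left_proj_top_aff hxy₀,
        h.left_proj_top_aff hxy₀', hx₀, hy₀]
    · rw [levelSet_left_aff h hl₂ hx₀, levelSet_left_aff h hl₂ hy₀, h.top_proj_left_aff hx₀,
        h.top_proj_left_aff hy₀, hxy₀, hxy₀']
  locally_trivial m := by
    obtain ⟨U, hU, hm, k₁, k₂, k₃, ⟨C⟩⟩ := h.exists_chart m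
    obtain ⟨U₁, hU₁, hm₁, j₁, ⟨L₁⟩⟩ := C.botChart.exists_levelChart hU hl₁ hl₁' hm
    obtain ⟨U₂, hU₂, hm₂, j₂, ⟨L₂⟩⟩ := C.rightChart.exists_levelChart hU hl₂ hl₂' hm
    exact ⟨U₁ ∩ U₂, isOpen_dTopology_inter hU₁ hU₂, ⟨hm₁, hm₂⟩, j₁, j₂, k₃,
      ⟨C.levelSetTrivialization h hl₁ hl₂ (L₁.restrict Set.inter_subset_left)
        (L₂.restrict Set.inter_subset_right)⟩⟩

/-! ### Transport of double affine bundles -/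

/-- Provides the double affine structure of `A#` without trivializations of `A#` itself. The side
bundles are equal, so only the structures on the total space have to be carried over. -/
theorem IsDoubleAffineIso.isDoubleAffineBundle {A A' A₁ A₂ : Type*} [DiffeologicalSpace A]
    [DiffeologicalSpace A'] [DiffeologicalSpace A₁] [DiffeologicalSpace A₂]
    {𝔸 : DoubleAffineBundleData A A₁ A₂ M} {𝔸' : DoubleAffineBundleData A' A₁ A₂ M} {e : A ≃ A'}
    (he : IsDoubleAffineIso 𝔸 𝔸' e) (h : IsDoubleAffineBundle 𝔸) : IsDoubleAffineBundle 𝔸' := by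
  obtain ⟨left, top, bot, right⟩ := 𝔸
  obtain ⟨left', top', bot', right'⟩ := 𝔸'
  obtain ⟨hd, rfl, rfl, hl, ht, hla, hta⟩ := he
  dsimp only at hl ht hla hta
  have hl' : ∀ x, left.proj (e.symm x) = left'.proj x := fun x => by
    rw [← hl, e.apply_symm_apply]
  have ht' : ∀ x, top.proj (e.symm x) = top'.proj x := fun x => by
    rw [← ht, e.apply_symm_apply]
  have hla' : ∀ x y t, left'.proj x = left'.proj y →
      e.symm (left'.aff x y t) = left.aff (e.symm x) (e.symm y) t := fun x y t hxy => by
    rw [e.symm_apply_eq, hla _ _ _ (by rw [hl', hl', hxy]), e.apply_symm_apply,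
      e.apply_symm_apply]
  have hta' : ∀ x y t, top'.proj x = top'.proj y →
      e.symm (top'.aff x y t) = top.aff (e.symm x) (e.symm y) t := fun x y t hxy => by
    rw [e.symm_apply_eq, hta _ _ _ (by rw [ht', ht', hxy]), e.apply_symm_apply,
      e.apply_symm_apply]
  constructor
  · have : left'.proj = left.proj ∘ e.symm := funext fun x => (hl' x).symm
    exact this ▸ h.smooth_left.comp hd.2
  · have : top'.proj = top.proj ∘ e.symm := funext fun x => (ht' x).symm
    exact this ▸ h.smooth_top.comp hd.2
  · exact h.smooth_bot
  · exact h.smooth_right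
  · intro x
    have := h.comm (e.symm x)
    simpa only [hl', ht'] using this
  · intro x y t hxy
    have := h.left_fibre (e.symm x) (e.symm y) t (by simpa only [hl'] using hxy)
    simpa only [← hla' x y t hxy, hl'] using this
  · intro x y t hxy
    have := h.top_fibre (e.symm x) (e.symm y) t (by simpa only [ht'] using hxy)
    simpa only [← hta' x y t hxy, ht'] using this
  · exact h.bot_fibre
  · exact h.right_fibre
  · intro x y t hxy
    have := h.top_proj_aff (e.symm x) (e.symm y) t (by simpa only [hl'] using hxy)
    simpa only [← hla' x y t hxy, ht'] using this
  · intro x y t hxy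
    have := h.left_proj_aff (e.symm x) (e.symm y) t (by simpa only [ht'] using hxy)
    simpa only [← hta' x y t hxy, hl'] using this
  · intro a₁ a₂ ha
    obtain ⟨x, hx₁, hx₂⟩ := h.surjective a₁ a₂ ha
    exact ⟨e x, (hl x).trans hx₁, (ht x).trans hx₂⟩
  · intro x x' y y' s t hx hy hxy hxy'
    have hx₀ : left.proj (e.symm x) = left.proj (e.symm x') := by simpa only [hl'] using hx
    have hy₀ : left.proj (e.symm y) = left.proj (e.symm y') := by simpa only [hl'] using hy
    have hxy₀ : top.proj (e.symm x) = top.proj (e.symm y) := by simpa only [ht'] using hxy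
    have hxy₀' : top.proj (e.symm x') = top.proj (e.symm y') := by simpa only [ht'] using hxy'
    have := h.interchange (e.symm x) (e.symm x') (e.symm y) (e.symm y') s t hx₀ hy₀ hxy₀ hxy₀'
    refine e.symm.injective ?_
    dsimp only at hx hy hxy hxy' ⊢
    rw [hta', hla' _ _ _ hx, hla' _ _ _ hy, hla', hta' _ _ _ hxy, hta' _ _ _ hxy']
    · exact this
    · rw [← hl', ← hl', hta' _ _ _ hxy, hta' _ _ _ hxy']
      exact (h.left_proj_aff _ _ _ hxy₀).trans
        ((congrArg₂ (fun a b => bot'.aff a b t) hx₀ hy₀).trans (h.left_proj_aff _ _ _ hxy₀').symm)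
    · rw [← ht', ← ht', hla' _ _ _ hx, hla' _ _ _ hy]
      exact (h.top_proj_aff _ _ _ hx₀).trans
        ((congrArg₂ (fun a b => right'.aff a b s) hxy₀ hxy₀').trans
          (h.top_proj_aff _ _ _ hy₀).symm)
  · intro m
    obtain ⟨U, hU, hm, k₁, k₂, k₃, ⟨T⟩⟩ := h.locally_trivial m
    let ε : {x : A' // bot'.proj (left'.proj x) ∈ U} ≃ {x : A // bot'.proj (left.proj x) ∈ U} :=
      e.symm.subtypeEquiv fun x => by rw [hl']
    refine ⟨U, hU, hm, k₁, k₂, k₃, ⟨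
      { e₁ := T.e₁
        e₂ := T.e₂
        e := ε.trans T.e
        diffeo₁ := T.diffeo₁
        diffeo₂ := T.diffeo₂
        diffeo := ⟨fun n p hp => T.diffeo.1 n _ (hd.2 n (fun a => (p a).1) hp), fun n p hp =>
          hd.1 n (fun a => (T.e.symm (p a)).1) (T.diffeo.2 n p hp)⟩
        base₁ := T.base₁
        base₂ := T.base₂
        base := fun x => (T.base (ε x)).trans (congrArg bot'.proj (hl' x))
        left_proj := fun x y hxy => T.left_proj (ε x) y ((hl' x).trans hxy)
        top_proj := fun x z hxz => T.top_proj (ε x) z ((ht' x).trans hxz)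
        bot_aff := T.bot_aff
        right_aff := T.right_aff
        left_aff := fun x y z t hxy hz => T.left_aff (ε x) (ε y) (ε z) t
          ((hl' x).trans (hxy.trans (hl' y).symm)) ((congrArg e.symm hz).trans (hla' _ _ _ hxy))
        top_aff := fun x y z t hxy hz => T.top_aff (ε x) (ε y) (ε z) t
          ((ht' x).trans (hxy.trans (ht' y).symm)) ((congrArg e.symm hz).trans (hta' _ _ _ hxy)) }⟩⟩

end AffineCombinations

/-! ### Restriction of linear functions to a level set -/

/-- An affine function on the level set of a linear form extends to a linear form. -/
theorem exists_linear_extension {V : Type*} [AddCommGroup V] [Module ℝ V] (Λ : V →ₗ[ℝ] ℝ) {v₀ : V}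
    (h₀ : Λ v₀ = 1) {g : V → ℝ} (hg : ∀ v w (t : ℝ), Λ v = 1 → Λ w = 1 →
      g (t • v + (1 - t) • w) = t * g v + (1 - t) * g w) :
    ∃ F : V →ₗ[ℝ] ℝ, ∀ v, Λ v = 1 → F v = g v := by
  have hΛ : ∀ v, Λ (v + (1 - Λ v) • v₀) = 1 := fun v => by
    rw [map_add, map_smul, h₀, smul_eq_mul]
    ring
  -- Since v = (v + (1 - Λ v) v₀) + (Λ v - 1) v₀ and both v₀ and the first summand lie on the level
  -- set, no other value is possible for a linear extension.
  let F : V → ℝ := fun v => g (v + (1 - Λ v) • v₀) + (Λ v - 1) * g v₀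
  have hsmul : ∀ (t : ℝ) v, F (t • v) = t * F v := fun t v => by
    have e : t • v + (1 - Λ (t • v)) • v₀ = t • (v + (1 - Λ v) • v₀) + (1 - t) • v₀ := by
      rw [map_smul, smul_eq_mul]
      module
    change g (t • v + (1 - Λ (t • v)) • v₀) + _ = _
    rw [e, hg _ _ _ (hΛ v) h₀, map_smul, smul_eq_mul]
    ring
  refine ⟨{ toFun := F, map_add' := fun v w => ?_, map_smul' := hsmul }, fun v hv => ?_⟩
  -- v + w is the midpoint of 2v and 2w, and the normalization onto the level set preserves affine
  -- combinations; additivity follows from weight 1/2 together with homogeneity for the factor 2.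
  · have e : v + w + (1 - Λ (v + w)) • v₀ =
        (1 / 2 : ℝ) • ((2 : ℝ) • v + (1 - Λ ((2 : ℝ) • v)) • v₀) +
          (1 - 1 / 2 : ℝ) • ((2 : ℝ) • w + (1 - Λ ((2 : ℝ) • w)) • v₀) := by
      simp only [map_add, map_smul, smul_eq_mul]
      module
    have h1 := hsmul 2 v
    have h2 := hsmul 2 w
    have h3 : F (v + w) = g (v + w + (1 - Λ (v + w)) • v₀) + (Λ (v + w) - 1) * g v₀ := rfl
    rw [e, hg _ _ _ (hΛ _) (hΛ _)] at h3
    have h4 : F ((2 : ℝ) • v) = g ((2 : ℝ) • v + (1 - Λ ((2 : ℝ) • v)) • v₀) +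
      (Λ ((2 : ℝ) • v) - 1) * g v₀ := rfl
    have h5 : F ((2 : ℝ) • w) = g ((2 : ℝ) • w + (1 - Λ ((2 : ℝ) • w)) • v₀) +
      (Λ ((2 : ℝ) • w) - 1) * g v₀ := rfl
    simp only [map_add, map_smul, smul_eq_mul] at h3 h4 h5
    linear_combination h3 + h1 / 2 + h2 / 2 - h4 / 2 - h5 / 2
  · change g _ + _ = _
    rw [hv]
    simp

namespace VectorBundleChart

variable {E B : Type*} [DiffeologicalSpace E] [DiffeologicalSpace B] {ξ : VectorBundleData E B}
  {U : Set B} {V : Type*} [AddCommGroup V] [Module ℝ V] [DiffeologicalSpace V]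
  (C : VectorBundleChart ξ U V) {l : E → ℝ}

theorem exists_level_one (hl : ξ.IsLinearFunction l) (hl' : ξ.FibrewiseNonzero l) (b : U) :
    ∃ v, l (C.pt b v) = 1 := by
  obtain ⟨x, hx, hlx⟩ := hl' b
  obtain ⟨v, rfl⟩ := C.exists_pt b hx
  refine ⟨(l (C.pt b v))⁻¹ • v, ?_⟩
  rw [← C.smul_pt, hl.map_smul, inv_mul_cancel₀ hlx]

theorem level_add (hl : ξ.IsLinearFunction l) {b : U} {v₀ : V} (h₀ : l (C.pt b v₀) = 1) (v : V) :
    l (C.pt b (v + (1 - l (C.pt b v)) • v₀)) = 1 := by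
  change C.linearForm hl b _ = 1
  rw [map_add, map_smul]
  change l (C.pt b v) + (1 - l (C.pt b v)) * l (C.pt b v₀) = 1
  rw [h₀]
  ring

/-- Used with s the value of `l` at the point and `v₀` on the level set: both points on the right
then lie on the level set, so a functional is expressed by its values there. -/
theorem val_eq_level (φ : ξ.Dual) {b : U} (hb : φ.1.base = b) (s : ℝ) (v₀ v : V) :
    φ.1.val (C.pt b v) = φ.1.val (C.pt b (v + (1 - s) • v₀)) + (s - 1) * φ.1.val (C.pt b v₀) := by
  change C.functional φ b hb v = C.functional φ b hb _ + _ * C.functional φ b hb v₀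
  rw [map_add, map_smul, smul_eq_mul]
  ring

end VectorBundleChart

/-- A vector bundle is locally trivial. -/
def VectorBundleData.LocallyTrivial {E B : Type*} [DiffeologicalSpace E] [DiffeologicalSpace B]
    (ξ : VectorBundleData E B) : Prop :=
  ∀ b : B, ∃ U : Set B, IsOpen[dTopology] U ∧ b ∈ U ∧
    ∃ k : ℕ, Nonempty (VectorBundleChart ξ U (Coord k))

section Restriction

variable {E B C : Type*} [DiffeologicalSpace E] [DiffeologicalSpace B] [DiffeologicalSpace C]

/-- The subset `P` of `E`, fibred over `C` by `pr`, is the part of the level set of the linear function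
`l` lying over the image of `j : C → B`. -/
structure IsLevel (ξ : VectorBundleData E B) (l : E → ℝ) (P : E → Prop) (pr : {x : E // P x} → C)
    (j : C → B) : Prop where
  linear : ξ.IsLinearFunction l
  nonzero : ξ.FibrewiseNonzero l
  trivial : ξ.LocallyTrivial
  level : ∀ x, P x → l x = 1
  mem : ∀ x c, l x = 1 → ξ.proj x = j c → P x
  proj : ∀ x, j (pr x) = ξ.proj x.1
  injective : Function.Injective j
  smooth : DSmooth j

namespace IsLevel

variable {ξ : VectorBundleData E B} {l : E → ℝ} {P : E → Prop} {pr : {x : E // P x} → C} {j : C → B}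

theorem proj_eq (h : IsLevel ξ l P pr j) {x : {x : E // P x}} {c : C} (hx : ξ.proj x.1 = j c) :
    pr x = c := h.injective ((h.proj x).trans hx)

/-- By `val_eq_level` a linear function is determined by its values on a hyperplane that avoids the
origin. -/
theorem dual_ext (h : IsLevel ξ l P pr j) {φ ψ : ξ.Dual} (c : C) (hφ : φ.1.base = j c)
    (hψ : ψ.1.base = j c) (H : ∀ x : {x : E // P x}, pr x = c → φ.1.val x.1 = ψ.1.val x.1) :
    φ = ψ := by
  obtain ⟨U, -, hb, k, ⟨K⟩⟩ := h.trivial (j c)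
  obtain ⟨b, hb⟩ := exists_coe_eq hb
  obtain ⟨v₀, h₀⟩ := K.exists_level_one h.linear h.nonzero b
  have key : ∀ v, l (K.pt b v) = 1 → φ.1.val (K.pt b v) = ψ.1.val (K.pt b v) := fun v hv => by
    have hp : ξ.proj (K.pt b v) = j c := (K.proj_pt b v).trans hb.symm
    exact H ⟨_, h.mem _ c hv hp⟩ (h.proj_eq hp)
  refine K.dual_ext b (hφ.trans hb) (hψ.trans hb) fun v => ?_
  rw [K.val_eq_level φ (hφ.trans hb) (l (K.pt b v)) v₀,
    K.val_eq_level ψ (hψ.trans hb) (l (K.pt b v)) v₀, key _ h₀, key _ (K.level_add h.linear h₀ v)]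

/-- The linear extension, made in a chart around the single fibre concerned. Its smoothness is
automatic, because it is a linear form on a finite-dimensional space. -/
theorem exists_dual (h : IsLevel ξ l P pr j)
    (f : FibreFunction (ξ.toAffine.restrict P pr).proj)
    (hf : (ξ.toAffine.restrict P pr).IsAffineMap f) :
    ∃ φ : ξ.Dual, φ.1.base = j f.base ∧ ∀ x, φ.1.val x.1 = f.val x := by
  classical
  obtain ⟨U, -, hb, k, ⟨K⟩⟩ := h.trivial (j f.base)
  obtain ⟨b, hb⟩ := exists_coe_eq hb
  obtain ⟨v₀, h₀⟩ := K.exists_level_one h.linear h.nonzero b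
  have hp : ∀ v, ξ.proj (K.pt b v) = j f.base := fun v => (K.proj_pt b v).trans hb.symm
  have hP : ∀ {v}, l (K.pt b v) = 1 → P (K.pt b v) := fun hv => h.mem _ _ hv (hp _)
  let g : Coord k → ℝ := fun v => if hv : P (K.pt b v) then f.val ⟨_, hv⟩ else 0
  have hg : ∀ {v} (hv : l (K.pt b v) = 1), g v = f.val ⟨K.pt b v, hP hv⟩ := fun hv => dif_pos _
  obtain ⟨F, hF⟩ := exists_linear_extension (K.linearForm h.linear b) h₀ (g := g)
    fun v w t hv hw => by
      have e : ξ.toAffine.aff (K.pt b v) (K.pt b w) t = K.pt b (t • v + (1 - t) • w) := by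
        change ξ.add _ _ = _
        rw [K.smul_pt, K.smul_pt, K.add_pt]
      have hvw : l (K.pt b (t • v + (1 - t) • w)) = 1 := by
        change K.linearForm h.linear b _ = 1
        rw [map_add, map_smul, map_smul, hv, hw, smul_eq_mul, smul_eq_mul]
        ring
      have e' : (ξ.toAffine.restrict P pr).aff ⟨_, hP hv⟩ ⟨_, hP hw⟩ t = ⟨_, hP hvw⟩ :=
        Subtype.ext ((pick_spec (P := fun z : {x : E // P x} =>
          z.1 = ξ.toAffine.aff (K.pt b v) (K.pt b w) t) ⟨⟨_, hP hvw⟩, e.symm⟩).trans e)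
      rw [hg hv, hg hw, hg hvw, ← e']
      exact hf _ _ t (h.proj_eq (hp v)) (h.proj_eq (hp w))
  refine ⟨K.ofFunctional b F fun hv => isPlot_linearMap F hv, hb.symm, ?_⟩
  rintro ⟨x, hx⟩
  by_cases hxb : ξ.proj x = b
  · rw [K.ofFunctional_val b F (fun hv => isPlot_linearMap F hv) hxb]
    obtain ⟨v, rfl⟩ := K.exists_pt b hxb
    have hv := h.level _ hx
    rw [K.coord_pt, hF v hv, hg hv]
  -- Off the fibre both functions vanish by convention, which is why the values agree without
  -- restriction on `x`.
  · rw [f.val_off _ fun hc => hxb ((h.proj ⟨x, hx⟩).symm.trans ((congrArg j hc).trans hb))]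
    exact (K.ofFunctional b F fun hv => isPlot_linearMap F hv).1.val_off x hxb

/-- Smoothness of the inverse of restriction. The extension formula expresses the value of the
functional at a moving vector by values of `f` at two moving points of the level set, and these
points can be chosen smoothly near any base point. -/
theorem isPlot_dual (h : IsLevel ξ l P pr j) {n : ℕ} {c : Coord n → ξ.Dual}
    {f : Coord n → FibreFunction (ξ.toAffine.restrict P pr).proj} (hf : IsPlot f)
    (hb : ∀ u, (c u).1.base = j (f u).base)
    (hv : ∀ u x, pr x = (f u).base → (c u).1.val x.1 = (f u).val x) : IsPlot c := by
  have hbase : IsPlot fun u => (c u).1.base := by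
    simp only [hb]
    exact h.smooth _ _ hf.1
  refine ⟨hbase, fun k s x hs hx hxb => ?_⟩
  have hxb' : ∀ v, ξ.proj (x v) = (c (s v)).1.base := hxb
  have hβ : IsPlot fun v => (c (s v)).1.base := isPlot_reparam hbase hs
  refine isPlot_of_local hβ fun b => ?_
  obtain ⟨U, hU, hbU, d, ⟨K⟩⟩ := h.trivial b
  obtain ⟨v₀, h₀⟩ := K.exists_level_one h.linear h.nonzero ⟨b, hbU⟩
  have hsm : DSmooth fun b : U => l (K.pt b v₀) := fun n p hp =>
    h.linear.smooth _ _ (K.isPlot_pt hp isPlot_const)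
  refine ⟨_, isOpen_ne_zero hU hsm, ⟨hbU, h₀ ▸ one_ne_zero⟩, fun m r hr hrU => ?_⟩
  let β : Coord m → U := fun v => ⟨(c (s (r v))).1.base, (hrU v).1⟩
  have hβp : IsPlot β := isPlot_reparam hβ hr
  -- Rescaling the constant vector `v₀` gives a local section of the level set; it plays the part of
  -- v₀ in the extension formula as the base point moves, and `z` below is the normalized point.
  let w : Coord m → Coord d := fun v => (l (K.pt (β v) v₀))⁻¹ • v₀
  have hw : IsPlot w := (((hsm _ _ hβp).contDiff.inv fun v => (hrU v).2).smul contDiff_const).isPlot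
  have hw1 : ∀ v, l (K.pt (β v) (w v)) = 1 := fun v => by
    rw [← K.smul_pt, h.linear.map_smul]
    exact inv_mul_cancel₀ (hrU v).2
  let y : Coord m → Coord d := fun v => K.coord (x (r v))
  have hxr : IsPlot fun v => x (r v) := isPlot_reparam hx hr
  have hy : IsPlot y := K.isPlot_coord hxr fun v => by
    rw [hxb']
    exact (hrU v).1
  have hxy : ∀ v, K.pt (β v) (y v) = x (r v) := fun v => K.pt_coord' (β v) (hxb' (r v))
  have hlx : IsPlot fun v => l (x (r v)) := h.linear.smooth _ _ hxr
  let z : Coord m → Coord d := fun v => y v + (1 - l (x (r v))) • w v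
  have hz : IsPlot z :=
    (hy.contDiff.add ((contDiff_const.sub hlx.contDiff).smul hw.contDiff)).isPlot
  have hz1 : ∀ v, l (K.pt (β v) (z v)) = 1 := fun v => by
    have := K.level_add h.linear (hw1 v) (y v)
    rwa [hxy] at this
  have hp : ∀ v a, ξ.proj (K.pt (β v) a) = j (f (s (r v))).base := fun v a =>
    (K.proj_pt _ _).trans (hb _)
  have hmem : ∀ {a : Coord m → Coord d}, (∀ v, l (K.pt (β v) (a v)) = 1) →
      ∀ v, P (K.pt (β v) (a v)) := fun ha v => h.mem _ _ (ha v) (hp v _)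
  have hplot : ∀ {a : Coord m → Coord d} (ha : ∀ v, l (K.pt (β v) (a v)) = 1), IsPlot a →
      IsPlot fun v => (f (s (r v))).val ⟨K.pt (β v) (a v), hmem ha v⟩ := fun ha hap =>
    hf.2 m (fun v => s (r v)) _ (hs.comp hr) (K.isPlot_pt hβp hap) fun v => h.proj_eq (hp v _)
  have e : ∀ v, (c (s (r v))).1.val (x (r v)) =
      (f (s (r v))).val ⟨K.pt (β v) (z v), hmem hz1 v⟩ +
        (l (x (r v)) - 1) * (f (s (r v))).val ⟨K.pt (β v) (w v), hmem hw1 v⟩ := fun v => by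
    rw [← hv _ _ (h.proj_eq (hp v _)), ← hv _ _ (h.proj_eq (hp v _))]
    conv_lhs => rw [← hxy, K.val_eq_level (c (s (r v))) (b := β v) rfl (l (x (r v))) (w v)]
  have : (fun v => (c (s (r v))).1.val (x (r v))) = _ := funext e
  rw [this]
  exact ((hplot hz1 hz).contDiff.add
    ((hlx.contDiff.sub contDiff_const).mul (hplot hw1 hw).contDiff)).isPlot

end IsLevel

end Restriction

/-- The way to recognize an operation given by `pick`: the candidate has the property, and nothing
else has it. -/
theorem pick_eq {α : Type*} {d a : α} {P : α → Prop} (ha : P a) (h : ∀ b, P b → b = a) :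
    pick d P = a :=
  h _ (pick_spec ⟨a, ha⟩)

theorem FibreFunction.ext_fibre {E B : Type*} [DiffeologicalSpace E] {p : E → B}
    {f g : FibreFunction p} (hb : f.base = g.base) (hv : ∀ x, p x = f.base → f.val x = g.val x) :
    f = g := by
  obtain ⟨b, v, hv0, hs⟩ := f
  obtain ⟨b', v', hv0', hs'⟩ := g
  obtain rfl : b = b' := hb
  obtain rfl : v = v' := funext fun x => by
    by_cases hx : p x = b
    · exact hv x hx
    · rw [hv0 x hx, hv0' x hx]
  rfl

namespace IsLevel

variable {E B C : Type*} [DiffeologicalSpace E] [DiffeologicalSpace B] [DiffeologicalSpace C]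
  {ξ : VectorBundleData E B} {l : E → ℝ} {P : E → Prop} {pr : {x : E // P x} → C} {j : C → B}

/-- The restriction of a linear function on a fibre to the level set. -/
def restrictDual (h : IsLevel ξ l P pr j) (φ : ξ.Dual) (c : C) (hc : φ.1.base = j c) :
    FibreFunction (ξ.toAffine.restrict P pr).proj where
  base := c
  val x := φ.1.val x.1
  val_off _ hx := φ.1.val_off _ fun hb => hx (h.proj_eq (hb.trans hc))
  smooth n x hx hb := φ.1.smooth n (fun u => (x u).1) hx fun u =>
    (h.proj (x u)).symm.trans ((congrArg j (hb u)).trans hc.symm)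

theorem restrict_aff (h : IsLevel ξ l P pr j) (hξ : ξ.FibrePreserving) {x y : {x : E // P x}}
    (hxy : pr x = pr y) (t : ℝ) :
    ((ξ.toAffine.restrict P pr).aff x y t).1 = ξ.toAffine.aff x.1 y.1 t := by
  have hxy' : ξ.proj x.1 = ξ.proj y.1 := by rw [← h.proj, ← h.proj, hxy]
  refine pick_spec (P := fun z : {x : E // P x} => z.1 = ξ.toAffine.aff x.1 y.1 t)
    ⟨⟨_, h.mem _ (pr x) ?_ ?_⟩, rfl⟩
  · rw [h.linear.map_aff hξ hxy', h.level _ x.2, h.level _ y.2]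
    ring
  · rw [hξ.proj_aff hxy', h.proj]

theorem isAffineMap_restrictDual (h : IsLevel ξ l P pr j) (hξ : ξ.FibrePreserving) (φ : ξ.Dual)
    (c : C) (hc : φ.1.base = j c) :
    (ξ.toAffine.restrict P pr).IsAffineMap (h.restrictDual φ c hc) := by
  intro x y t hx hy
  have hx' : ξ.proj x.1 = φ.1.base := (h.proj x).symm.trans ((congrArg j hx).trans hc.symm)
  have hy' : ξ.proj y.1 = φ.1.base := (h.proj y).symm.trans ((congrArg j hy).trans hc.symm)
  change φ.1.val ((ξ.toAffine.restrict P pr).aff x y t).1 = t * φ.1.val x.1 + (1 - t) * φ.1.val y.1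
  rw [h.restrict_aff hξ (Eq.trans hx (Eq.symm hy))]
  change φ.1.val (ξ.add _ _) = _
  rw [φ.2.1 _ _ ((hξ.2 _ _).trans hx') ((hξ.2 _ _).trans hy'), φ.2.2 _ _ hx', φ.2.2 _ _ hy']

theorem isPlot_restrictDual (h : IsLevel ξ l P pr j) {n : ℕ} {φ : Coord n → ξ.Dual}
    {c : Coord n → C} (hφ : IsPlot φ) (hcp : IsPlot c) (hc : ∀ u, (φ u).1.base = j (c u)) :
    IsPlot fun u => h.restrictDual (φ u) (c u) (hc u) :=
  ⟨hcp, fun k s x hs hx hb => hφ.2 k s (fun v => (x v).1) hs hx fun v =>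
    (h.proj (x v)).symm.trans ((congrArg j (hb v)).trans (hc _).symm)⟩

end IsLevel

/-! ### The fibres of `A → A₁` and of `A₂ → M` as level sets -/

section DoubleVector

variable {D D₁ D₂ M : Type*} [DiffeologicalSpace D] [DiffeologicalSpace D₁] [DiffeologicalSpace D₂]
  [DiffeologicalSpace M] {𝔻 : DoubleVectorBundleData D D₁ D₂ M}

namespace IsDoubleVectorBundle

theorem left_locallyTrivial (h : IsDoubleVectorBundle 𝔻) : 𝔻.left.LocallyTrivial := fun y => by
  obtain ⟨U, hU, hm, k₁, k₂, k₃, ⟨C⟩⟩ := h.exists_chart (𝔻.bot.proj y)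
  exact ⟨_, isOpen_dTopology_preimage h.smooth_bot hU, hm, k₂ + k₃,
    ⟨(C.leftChart h.smooth_bot h.smooth_top h.comm).congr
      (LinearEquiv.ofFinrankEq _ _ (by simp))⟩⟩

theorem right_locallyTrivial (h : IsDoubleVectorBundle 𝔻) : 𝔻.right.LocallyTrivial := fun m => by
  obtain ⟨U, hU, hm, k₁, k₂, k₃, ⟨C⟩⟩ := h.exists_chart m
  exact ⟨U, hU, hm, k₂, ⟨C.rightChart⟩⟩

theorem exists_over (h : IsDoubleVectorBundle 𝔻) {y : D₁} {z : D₂}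
    (hyz : 𝔻.bot.proj y = 𝔻.right.proj z) : ∃ x, 𝔻.left.proj x = y ∧ 𝔻.top.proj x = z := by
  obtain ⟨U, -, hm, k₁, k₂, k₃, ⟨C⟩⟩ := h.exists_chart (𝔻.bot.proj y)
  obtain ⟨m, hm'⟩ := exists_coe_eq hm
  obtain ⟨u, rfl⟩ := C.exists_pt₁ m hm'
  obtain ⟨v, rfl⟩ := C.exists_pt₂ m (hyz.symm.trans hm')
  exact ⟨C.pt m u v 0, C.left_pt _ _ _ _, C.top_pt _ _ _ _⟩

theorem core_props (h : IsDoubleVectorBundle 𝔻) {x : D} {c : 𝔻.Core}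
    (hc : 𝔻.core.proj c = 𝔻.bot.proj (𝔻.left.proj x)) :
    𝔻.left.proj (𝔻.coreVector x c.1) = 𝔻.left.proj x ∧
      𝔻.left.proj (𝔻.translate x c.1) = 𝔻.left.proj x ∧
      𝔻.top.proj (𝔻.translate x c.1) = 𝔻.top.proj x := by
  obtain ⟨U, -, hm, k₁, k₂, k₃, ⟨C⟩⟩ := h.exists_chart (𝔻.bot.proj (𝔻.left.proj x))
  obtain ⟨m, hm'⟩ := exists_coe_eq hm
  obtain ⟨u, v, w, rfl⟩ := C.exists_pt m hm'
  obtain ⟨w', rfl⟩ := C.exists_corePt m (hc.trans hm')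
  rw [C.corePt_val, C.coreVector_pt, C.translate_pt]
  simp only [C.left_pt, C.top_pt, and_self]

/-- Linearity of φ together with the definition of its projection κ. It turns the normalization f(x
+ σ) = f(x) + 1 into the condition that `l₃` be 1 on κ. -/
theorem val_translate (h : IsDoubleVectorBundle 𝔻) {φ : 𝔻.left.Dual} {x : D} {c : 𝔻.Core}
    (hx : 𝔻.left.proj x = φ.1.base) (hc : 𝔻.core.proj c = 𝔻.bot.proj φ.1.base) :
    φ.1.val (𝔻.translate x c.1) = φ.1.val x + (𝔻.verticalDual.top.proj φ).1.val c := by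
  rw [verticalDual_top_val h hx hc]
  exact φ.2.1 _ _ hx (((h.core_props (hx ▸ hc)).1).trans hx)

/-- The pullback of `l₂` is linear on the fibres of `D → D₁`, because `D → D₂` is a bundle morphism;
it is nonzero on each fibre, because every vector of `D₂` lifts to any point of `D₁` over the same
point of `M`. The map from the base is the inclusion of `A₁` in `D₁`. -/
theorem isLevel_left (h : IsDoubleVectorBundle 𝔻) (l₁ : D₁ → ℝ) {l₂ : D₂ → ℝ}
    (hl₂ : 𝔻.right.IsLinearFunction l₂) (hl₂' : 𝔻.right.FibrewiseNonzero l₂) :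
    IsLevel 𝔻.left (fun x => l₂ (𝔻.top.proj x))
      (fun x => l₁ (𝔻.left.proj x) = 1 ∧ l₂ (𝔻.top.proj x) = 1)
      (fun x => (⟨𝔻.left.proj x.1, x.2.1⟩ : {y : D₁ // l₁ y = 1})) Subtype.val where
  linear :=
    { smooth := hl₂.smooth.comp h.smooth_top
      map_add := fun x y hxy => by
        rw [h.top_proj_add _ _ hxy, hl₂.map_add _ _ (by rw [← h.comm, ← h.comm, hxy])]
      map_smul := fun t x => by rw [h.top_proj_smul, hl₂.map_smul] }
  nonzero y := by
    obtain ⟨z, hz, hlz⟩ := hl₂' (𝔻.bot.proj y)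
    obtain ⟨x, hx, rfl⟩ := h.exists_over hz.symm
    exact ⟨x, hx, hlz⟩
  trivial := h.left_locallyTrivial
  level x hx := hx.2
  mem x c hx hc := ⟨hc ▸ c.2, hx⟩
  proj _ := rfl
  injective := Subtype.val_injective
  smooth _ _ hp := hp

theorem isLevel_right (h : IsDoubleVectorBundle 𝔻) {l₂ : D₂ → ℝ}
    (hl₂ : 𝔻.right.IsLinearFunction l₂) (hl₂' : 𝔻.right.FibrewiseNonzero l₂) :
    IsLevel 𝔻.right l₂ (fun z => l₂ z = 1) (fun z => 𝔻.right.proj z.1) id where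
  linear := hl₂
  nonzero := hl₂'
  trivial := h.right_locallyTrivial
  level _ hx := hx
  mem _ _ hx _ := hx
  proj _ := rfl
  injective := Function.injective_id
  smooth := dSmooth_id

end IsDoubleVectorBundle

/-! ### The section of the core as a linear function -/

theorem isLinearFunction_sectionFunction {σ : M → 𝔻.Core} (hσ : IsSpecialSection 𝔻 σ) :
    𝔻.core.dual.IsLinearFunction (sectionFunction 𝔻 σ) where
  smooth n c hc := hc.2 n id _ contDiff_id (hσ.smooth _ _ hc.1) fun u => hσ.proj _
  map_add κ κ' hκ := by
    obtain ⟨h1, h2⟩ := VectorBundleData.dual_add_spec κ κ' hκ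
    have hκ' : κ.1.base = κ'.1.base := hκ
    change (𝔻.core.dual.add κ κ').1.val (σ (𝔻.core.dual.add κ κ').1.base) = _
    rw [h1, h2 _ (hσ.proj _), sectionFunction, sectionFunction, hκ']
  map_smul t κ := by
    obtain ⟨h1, h2⟩ := VectorBundleData.dual_smul_spec t κ
    change (𝔻.core.dual.smul t κ).1.val (σ (𝔻.core.dual.smul t κ).1.base) = _
    rw [h1, h2 _ (hσ.proj _), sectionFunction]

theorem fibrewiseNonzero_sectionFunction (h : IsDoubleVectorBundle 𝔻) {σ : M → 𝔻.Core}
    (hσ : IsSpecialSection 𝔻 σ) : 𝔻.core.dual.FibrewiseNonzero (sectionFunction 𝔻 σ) := fun m => by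
  obtain ⟨U, -, hm, k₁, k₂, k₃, ⟨C⟩⟩ := h.exists_chart m
  obtain ⟨w, hw⟩ := C.exists_corePt ⟨m, hm⟩ (hσ.proj m)
  -- The functional given by the inner product with the coordinate of σ itself; its value on σ is
  -- the square of a nonzero norm.
  refine ⟨C.coreDualPt h ⟨m, hm⟩ w, rfl, ?_⟩
  change (C.coreDualPt h ⟨m, hm⟩ w).1.val (σ m) ≠ 0
  rw [hw, C.coreDualPt_val]
  intro h0
  refine hσ.ne_zero m ?_
  rw [inner_self_eq_zero] at h0
  rw [hw, h0]
  exact ((C.coreChart h).smul_pt 0 ⟨m, hm⟩ 0).trans (by rw [smul_zero]; rfl)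

/-! ### Operations of the vertical dual -/

theorem verticalDual_top_add_val (h : IsDoubleVectorBundle 𝔻) {φ ψ : 𝔻.left.Dual} {x y : D}
    (hφψ : 𝔻.verticalDual.top.proj φ = 𝔻.verticalDual.top.proj ψ)
    (hx : 𝔻.left.proj x = φ.1.base) (hy : 𝔻.left.proj y = ψ.1.base)
    (hxy : 𝔻.top.proj x = 𝔻.top.proj y) :
    (𝔻.verticalDual.top.add φ ψ).1.val (𝔻.top.add x y) = φ.1.val x + ψ.1.val y := by
  obtain ⟨U, -, hm, k₁, k₂, k₃, ⟨C⟩⟩ := h.exists_chart (𝔻.bot.proj φ.1.base)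
  obtain ⟨m, hm'⟩ := exists_coe_eq hm
  obtain ⟨u, q, p, u', p', rfl, rfl⟩ := (C.verticalDual h).exists_pt_pair_top
    (isDoubleVectorBundle_verticalDual h) (x := φ) (y := ψ) hm' hφψ
  obtain ⟨v, w, rfl⟩ := C.exists_pt_left m hx
  obtain ⟨v', w', rfl⟩ := C.exists_pt_left m hy
  rw [C.top_pt, C.top_pt, C.pt₂_inj] at hxy
  subst hxy
  rw [(C.verticalDual h).top_add, C.top_add]
  change (C.dualPt h _ _ _ _).1.val _ = (C.dualPt h _ _ _ _).1.val _ + (C.dualPt h _ _ _ _).1.val _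
  rw [C.dualPt_val, C.dualPt_val, C.dualPt_val, inner_add_right, inner_add_left]
  ring

theorem verticalDual_top_smul_val (h : IsDoubleVectorBundle 𝔻) (t : ℝ) {φ : 𝔻.left.Dual} {x : D}
    (hx : 𝔻.left.proj x = φ.1.base) :
    (𝔻.verticalDual.top.smul t φ).1.val (𝔻.top.smul t x) = t * φ.1.val x := by
  obtain ⟨U, -, hm, k₁, k₂, k₃, ⟨C⟩⟩ := h.exists_chart (𝔻.bot.proj φ.1.base)
  obtain ⟨m, hm'⟩ := exists_coe_eq hm
  obtain ⟨u, q, p, rfl⟩ := C.exists_dualPt h hm'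
  obtain ⟨v, w, rfl⟩ := C.exists_pt_left m hx
  rw [C.verticalDual_top_smul, C.top_smul, C.dualPt_val, C.dualPt_val, inner_smul_right,
    real_inner_smul_left]
  ring

/-- Additivity and the two homotheties combine into exactly the formula that specifies `aff₂` on
`A#`. -/
theorem verticalDual_top_aff_val (h : IsDoubleVectorBundle 𝔻) {φ ψ : 𝔻.left.Dual} {x y : D}
    (hφψ : 𝔻.verticalDual.top.proj φ = 𝔻.verticalDual.top.proj ψ)
    (hx : 𝔻.left.proj x = φ.1.base) (hy : 𝔻.left.proj y = ψ.1.base)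
    (hxy : 𝔻.top.proj x = 𝔻.top.proj y) (t : ℝ) :
    (𝔻.verticalDual.top.toAffine.aff φ ψ t).1.val (𝔻.top.toAffine.aff x y t) =
      t * φ.1.val x + (1 - t) * ψ.1.val y := by
  have hV := isDoubleVectorBundle_verticalDual h
  change (𝔻.verticalDual.top.add _ _).1.val (𝔻.top.add _ _) = _
  have hl : ∀ (s : ℝ) (χ : 𝔻.left.Dual), (𝔻.verticalDual.top.smul s χ).1.base =
      𝔻.bot.smul s χ.1.base := fun s χ => hV.left_proj_smul s χ
  rw [verticalDual_top_add_val h, verticalDual_top_smul_val h t hx, verticalDual_top_smul_val h _ hy]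
  · rw [hV.top_fibre.2, hV.top_fibre.2, hφψ]
  · rw [h.left_proj_smul, hl, hx]
  · rw [h.left_proj_smul, hl, hy]
  · rw [h.top_fibre.2, h.top_fibre.2, hxy]

theorem verticalDual_left_aff_val {φ ψ : 𝔻.left.Dual} (hφψ : φ.1.base = ψ.1.base) {x : D}
    (hx : 𝔻.left.proj x = φ.1.base) (t : ℝ) :
    (𝔻.verticalDual.left.toAffine.aff φ ψ t).1.val x = t * φ.1.val x + (1 - t) * ψ.1.val x := by
  change (𝔻.left.dual.add (𝔻.left.dual.smul t φ) (𝔻.left.dual.smul (1 - t) ψ)).1.val x = _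
  obtain ⟨h1, h2⟩ := VectorBundleData.dual_smul_spec t φ
  obtain ⟨h3, h4⟩ := VectorBundleData.dual_smul_spec (1 - t) ψ
  obtain ⟨-, h6⟩ := VectorBundleData.dual_add_spec (𝔻.left.dual.smul t φ)
    (𝔻.left.dual.smul (1 - t) ψ) (by rw [h1, h3, hφψ])
  rw [h6 x (hx.trans h1.symm), h2 x hx, h4 x (hx.trans hφψ)]

/-! ### Restriction of functionals to the fibres of the level set -/

variable {l₁ : D₁ → ℝ} {l₂ : D₂ → ℝ} {σ : M → 𝔻.Core}

theorem sectionFunction_top (h : IsDoubleVectorBundle 𝔻) (σ : M → 𝔻.Core) (φ : 𝔻.left.Dual) :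
    sectionFunction 𝔻 σ (𝔻.verticalDual.top.proj φ) =
      (𝔻.verticalDual.top.proj φ).1.val (σ (𝔻.bot.proj φ.1.base)) := by
  rw [sectionFunction, verticalDual_comm h]

/-- The restriction of a functional to a fibre of `A → A₁`. -/
def restrictSpecial (h : IsDoubleVectorBundle 𝔻) (hl₂ : 𝔻.right.IsLinearFunction l₂)
    (hl₂' : 𝔻.right.FibrewiseNonzero l₂) (hσ : IsSpecialSection 𝔻 σ)
    (φ : {φ : 𝔻.left.Dual // l₁ (𝔻.verticalDual.left.proj φ) = 1 ∧
      sectionFunction 𝔻 σ (𝔻.verticalDual.top.proj φ) = 1}) : SpecialDual 𝔻 l₁ l₂ σ :=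
  ⟨(h.isLevel_left l₁ hl₂ hl₂').restrictDual φ.1 ⟨φ.1.1.base, φ.2.1⟩ rfl,
    (h.isLevel_left l₁ hl₂ hl₂').isAffineMap_restrictDual h.left_fibre _ _ _,
    fun x x' hx hx' => by
      have hx₀ : 𝔻.left.proj x.1 = φ.1.1.base := congrArg Subtype.val hx
      change φ.1.1.val x'.1 = φ.1.1.val x.1 + 1
      rw [hx']
      refine (h.val_translate hx₀ (hσ.proj _)).trans ?_
      exact congrArg (φ.1.1.val x.1 + ·) ((sectionFunction_top h σ φ.1).symm.trans φ.2.2)⟩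

theorem SpecialDual.ext {f g : SpecialDual 𝔻 l₁ l₂ σ} (hb : f.1.base = g.1.base)
    (hv : ∀ x, (levelSet 𝔻 l₁ l₂).left.proj x = f.1.base → f.1.val x = g.1.val x) : f = g :=
  Subtype.ext (FibreFunction.ext_fibre hb hv)

/-- The projection κ and the normalization by σ are read off from translates of a point, so the
fibres of `A → A₁` must be nonempty. -/
theorem exists_levelSet_left (h : IsDoubleVectorBundle 𝔻) (hl₂ : 𝔻.right.IsLinearFunction l₂)
    (hl₂' : 𝔻.right.FibrewiseNonzero l₂) (a : {y : D₁ // l₁ y = 1}) :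
    ∃ x, (levelSet 𝔻 l₁ l₂).left.proj x = a := by
  obtain ⟨U, -, hm, k, ⟨K⟩⟩ := h.right_locallyTrivial (𝔻.bot.proj a.1)
  obtain ⟨v, hv⟩ := K.exists_level_one hl₂ hl₂' ⟨_, hm⟩
  obtain ⟨x, hx, hx'⟩ := h.exists_over (K.proj_pt ⟨_, hm⟩ v).symm
  exact ⟨⟨x, hx ▸ a.2, hx' ▸ hv⟩, Subtype.ext hx⟩

/-- Existence and uniqueness of the linear extension. What remains is that the extension of an
element of `A#` has `l₃` equal to 1, and this is seen by translating a single point of the fibre by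
σ. -/
theorem bijective_restrictSpecial (h : IsDoubleVectorBundle 𝔻)
    (hl₂ : 𝔻.right.IsLinearFunction l₂) (hl₂' : 𝔻.right.FibrewiseNonzero l₂)
    (hσ : IsSpecialSection 𝔻 σ) :
    Function.Bijective (restrictSpecial (l₁ := l₁) h hl₂ hl₂' hσ) := by
  have hL := h.isLevel_left l₁ hl₂ hl₂'
  refine ⟨fun φ ψ hφψ => Subtype.ext ?_, fun f => ?_⟩
  · have hb : (⟨φ.1.1.base, φ.2.1⟩ : {y : D₁ // l₁ y = 1}) = ⟨ψ.1.1.base, ψ.2.1⟩ :=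
      congrArg (fun f => f.1.base) hφψ
    refine hL.dual_ext ⟨φ.1.1.base, φ.2.1⟩ rfl (congrArg Subtype.val hb).symm fun x _ => ?_
    exact congrArg (fun f => f.1.val x) hφψ
  · obtain ⟨φ, hb, hv⟩ := hL.exists_dual f.1 f.2.1
    obtain ⟨x, hx⟩ := exists_levelSet_left h hl₂ hl₂' f.1.base
    have hx₀ : 𝔻.left.proj x.1 = φ.1.base := (congrArg Subtype.val hx).trans hb.symm
    have hσx : 𝔻.core.proj (σ (𝔻.bot.proj φ.1.base)) = 𝔻.bot.proj φ.1.base := hσ.proj _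
    have hp := h.core_props (hσx.trans (congrArg 𝔻.bot.proj hx₀.symm))
    let x' : {x : D // l₁ (𝔻.left.proj x) = 1 ∧ l₂ (𝔻.top.proj x) = 1} :=
      ⟨𝔻.translate x.1 (σ (𝔻.bot.proj φ.1.base)).1, by rw [hp.2.1]; exact x.2.1,
        by rw [hp.2.2]; exact x.2.2⟩
    -- The increment along σ is 1 by the definition of `A#` and is the value of κ on σ by
    -- `val_translate`.
    have h1 := f.2.2 x x' hx (by rw [← hb])
    rw [← hv, ← hv] at h1
    have h2 := h.val_translate hx₀ hσx
    have h3 : (𝔻.verticalDual.top.proj φ).1.val (σ (𝔻.bot.proj φ.1.base)) = 1 := by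
      linarith [h1.symm.trans h2]
    refine ⟨⟨φ, (congrArg l₁ hb).trans f.1.base.2, (sectionFunction_top h σ φ).trans h3⟩, ?_⟩
    exact SpecialDual.ext (Subtype.ext hb) fun x _ => hv x

/-- Restriction of functionals as a bijection. -/
def restrictEquiv (h : IsDoubleVectorBundle 𝔻) (hl₂ : 𝔻.right.IsLinearFunction l₂)
    (hl₂' : 𝔻.right.FibrewiseNonzero l₂) (hσ : IsSpecialSection 𝔻 σ) :
    {φ : 𝔻.left.Dual // l₁ (𝔻.verticalDual.left.proj φ) = 1 ∧
      sectionFunction 𝔻 σ (𝔻.verticalDual.top.proj φ) = 1} ≃ SpecialDual 𝔻 l₁ l₂ σ :=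
  Equiv.ofBijective _ (bijective_restrictSpecial h hl₂ hl₂' hσ)

theorem restrictEquiv_val (h : IsDoubleVectorBundle 𝔻) (hl₂ : 𝔻.right.IsLinearFunction l₂)
    (hl₂' : 𝔻.right.FibrewiseNonzero l₂) (hσ : IsSpecialSection 𝔻 σ)
    (φ : {φ : 𝔻.left.Dual // l₁ (𝔻.verticalDual.left.proj φ) = 1 ∧
      sectionFunction 𝔻 σ (𝔻.verticalDual.top.proj φ) = 1})
    (x : {x : D // l₁ (𝔻.left.proj x) = 1 ∧ l₂ (𝔻.top.proj x) = 1}) :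
    (restrictEquiv h hl₂ hl₂' hσ φ).1.val x = φ.1.1.val x.1 := rfl

theorem isDiffeo_restrictEquiv (h : IsDoubleVectorBundle 𝔻) (hl₂ : 𝔻.right.IsLinearFunction l₂)
    (hl₂' : 𝔻.right.FibrewiseNonzero l₂) (hσ : IsSpecialSection 𝔻 σ) :
    IsDiffeo (restrictEquiv (l₁ := l₁) h hl₂ hl₂' hσ) := by
  have hL := h.isLevel_left l₁ hl₂ hl₂'
  refine ⟨fun n c hc => ?_, fun n c hc => ?_⟩
  · have hc' : IsPlot fun u => (c u).1 := hc
    exact hL.isPlot_restrictDual (c := fun u => ⟨(c u).1.1.base, (c u).2.1⟩) hc' hc'.1 fun _ => rfl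
  · have he : ∀ u, restrictEquiv h hl₂ hl₂' hσ ((restrictEquiv (l₁ := l₁) h hl₂ hl₂' hσ).symm (c u))
        = c u := fun u => Equiv.apply_symm_apply _ _
    exact hL.isPlot_dual (c := fun u => ((restrictEquiv h hl₂ hl₂' hσ).symm (c u)).1)
      (f := fun u => (c u).1) hc (fun u => congrArg (fun f => f.1.base.1) (he u))
      fun u x _ => congrArg (fun f => f.1.val x) (he u)

/-- Take for x and y the coordinates v and w of z, over a and b: the weights add up to 1, so the
combination gives w back, for every t. Hence the formula for `aff₂` prescribes the values on the
whole fibre, and unlike the homotheties of the vertical dual it needs no extra condition on κ. -/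
theorem exists_levelSet_top_aff (h : IsDoubleVectorBundle 𝔻) (hl₁ : 𝔻.bot.IsLinearFunction l₁)
    {a b : {y : D₁ // l₁ y = 1}} (hab : 𝔻.bot.proj a.1 = 𝔻.bot.proj b.1) (t : ℝ)
    {z : {x : D // l₁ (𝔻.left.proj x) = 1 ∧ l₂ (𝔻.top.proj x) = 1}}
    (hz : (levelSet 𝔻 l₁ l₂).left.proj z = (levelSet 𝔻 l₁ l₂).bot.aff a b t) :
    ∃ x y, (levelSet 𝔻 l₁ l₂).left.proj x = a ∧ (levelSet 𝔻 l₁ l₂).left.proj y = b ∧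
      (levelSet 𝔻 l₁ l₂).top.proj x = (levelSet 𝔻 l₁ l₂).top.proj y ∧
      (levelSet 𝔻 l₁ l₂).top.aff x y t = z := by
  obtain ⟨a, ha⟩ := a
  obtain ⟨b, hb⟩ := b
  obtain ⟨z, hz₁, hz₂⟩ := z
  have hz' : 𝔻.left.proj z = 𝔻.bot.toAffine.aff a b t :=
    (congrArg Subtype.val hz).trans (restrict_level_aff h.bot_fibre hl₁ hab t)
  obtain ⟨U, -, hm, k₁, k₂, k₃, ⟨C⟩⟩ := h.exists_chart (𝔻.bot.proj a)
  obtain ⟨m, hm'⟩ := exists_coe_eq hm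
  obtain ⟨u, rfl⟩ := C.exists_pt₁ m hm'
  obtain ⟨u', rfl⟩ := C.exists_pt₁ m (hab.symm.trans hm')
  rw [C.bot_aff] at hz'
  obtain ⟨v, w, rfl⟩ := C.exists_pt_left m hz'
  have hv : l₂ (C.pt₂ m v) = 1 := by rwa [C.top_pt] at hz₂
  have hxy : 𝔻.top.proj (C.pt m u v w) = 𝔻.top.proj (C.pt m u' v w) := by rw [C.top_pt, C.top_pt]
  refine ⟨⟨C.pt m u v w, by rwa [C.left_pt], by rwa [C.top_pt]⟩,
    ⟨C.pt m u' v w, by rwa [C.left_pt], by rwa [C.top_pt]⟩, Subtype.ext (C.left_pt _ _ _ _),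
    Subtype.ext (C.left_pt _ _ _ _), Subtype.ext hxy, Subtype.ext ?_⟩
  rw [levelSet_top_aff h hl₁ hxy, C.top_aff]
  congr 1
  module

/-- Each structure map of `A#` is a `pick` of an element with prescribed values. The restriction of
the corresponding element of the vertical dual has these values, and they determine it; this also
shows that the operations of `A#` exist. -/
theorem isDoubleAffineIso_restrictEquiv (h : IsDoubleVectorBundle 𝔻)
    (hl₁ : 𝔻.bot.IsLinearFunction l₁) (hl₂ : 𝔻.right.IsLinearFunction l₂)
    (hl₂' : 𝔻.right.FibrewiseNonzero l₂) (hσ : IsSpecialSection 𝔻 σ) :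
    IsDoubleAffineIso (levelSet 𝔻.verticalDual l₁ (sectionFunction 𝔻 σ))
      (specialDual h l₁ l₂ hσ) (restrictEquiv h hl₂ hl₂' hσ) where
  diffeo := isDiffeo_restrictEquiv h hl₂ hl₂' hσ
  bot_eq := rfl
  right_eq := rfl
  left_proj _ := rfl
  top_proj φ := by
    refine pick_eq ⟨verticalDual_comm h φ.1, fun x x' c hx hc hx' => ?_⟩ fun κ hκ => ?_
    · have hx₀ : 𝔻.left.proj x.1 = φ.1.1.base := congrArg Subtype.val hx
      change (𝔻.verticalDual.top.proj φ.1).1.val c = φ.1.1.val x'.1 - φ.1.1.val x.1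
      rw [hx', h.val_translate hx₀ (hc.trans (verticalDual_comm h φ.1))]
      ring
    · obtain ⟨hκb, hκ⟩ := hκ
      have hκb' : κ.1.1.base = 𝔻.bot.proj φ.1.1.base := hκb
      refine Subtype.ext (VectorBundleData.Dual.ext (hκb.trans (verticalDual_comm h φ.1).symm)
        fun c hc => ?_)
      -- Any κ with the property is evaluated at a core element by translating this one point.
      obtain ⟨x, hx⟩ := exists_levelSet_left (l₁ := l₁) h hl₂ hl₂' ⟨φ.1.1.base, φ.2.1⟩
      have hx₀ : 𝔻.left.proj x.1 = φ.1.1.base := congrArg Subtype.val hx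
      have hcb : 𝔻.core.proj c = 𝔻.bot.proj φ.1.1.base := hc.trans hκb'
      have hp := h.core_props (hcb.trans (congrArg 𝔻.bot.proj hx₀.symm))
      have h1 := hκ x ⟨𝔻.translate x.1 c.1, by rw [hp.2.1]; exact x.2.1,
        by rw [hp.2.2]; exact x.2.2⟩ c hx hc rfl
      rw [h1, restrictEquiv_val, restrictEquiv_val, h.val_translate hx₀ hcb]
      exact add_sub_cancel_left _ _
  left_aff φ ψ t hφψ := by
    have hV := isDoubleVectorBundle_verticalDual h
    have hb : φ.1.1.base = ψ.1.1.base := congrArg Subtype.val hφψ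
    have haff := levelSet_left_aff (l₁ := l₁) hV (isLinearFunction_sectionFunction hσ) hb t
    have hbase : ((levelSet 𝔻.verticalDual l₁ (sectionFunction 𝔻 σ)).left.aff φ ψ t).1.1.base =
        φ.1.1.base :=
      (congrArg (fun χ : 𝔻.left.Dual => χ.1.base) haff).trans (hV.left_fibre.proj_aff hb t)
    have hval : ∀ x, (levelSet 𝔻 l₁ l₂).left.proj x = ⟨φ.1.1.base, φ.2.1⟩ →
        ((levelSet 𝔻.verticalDual l₁ (sectionFunction 𝔻 σ)).left.aff φ ψ t).1.1.val x.1 =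
          t * φ.1.1.val x.1 + (1 - t) * ψ.1.1.val x.1 := fun x hx => by
      rw [haff]
      exact verticalDual_left_aff_val hb (congrArg Subtype.val hx) t
    refine (pick_eq ⟨Subtype.ext hbase, hval⟩ fun χ hχ => ?_).symm
    exact SpecialDual.ext (hχ.1.trans (Subtype.ext hbase).symm) fun x hx =>
      (hχ.2 x (hx.trans hχ.1)).trans (hval x (hx.trans hχ.1)).symm
  top_aff φ ψ t hφψ := by
    have hV := isDoubleVectorBundle_verticalDual h
    have hr : 𝔻.verticalDual.top.proj φ.1 = 𝔻.verticalDual.top.proj ψ.1 :=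
      congrArg Subtype.val hφψ
    have hab : 𝔻.bot.proj φ.1.1.base = 𝔻.bot.proj ψ.1.1.base := by
      rw [← verticalDual_comm h, ← verticalDual_comm h, hr]
    have haff := levelSet_top_aff (l₂ := sectionFunction 𝔻 σ) hV hl₁ hr t
    have hbase : (⟨φ.1.1.base, φ.2.1⟩ : {y : D₁ // l₁ y = 1}) = ⟨φ.1.1.base, φ.2.1⟩ ∧
        ((levelSet 𝔻.verticalDual l₁ (sectionFunction 𝔻 σ)).top.aff φ ψ t).1.1.base =
        ((levelSet 𝔻 l₁ l₂).bot.aff ⟨φ.1.1.base, φ.2.1⟩ ⟨ψ.1.1.base, ψ.2.1⟩ t).1 :=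
      ⟨rfl, ((congrArg (fun χ : 𝔻.left.Dual => χ.1.base) haff).trans
        (hV.left_proj_top_aff hr t)).trans (restrict_level_aff h.bot_fibre hl₁
          (x := ⟨φ.1.1.base, φ.2.1⟩) (y := ⟨ψ.1.1.base, ψ.2.1⟩) hab t).symm⟩
    have hval : ∀ x y, (levelSet 𝔻 l₁ l₂).left.proj x = ⟨φ.1.1.base, φ.2.1⟩ →
        (levelSet 𝔻 l₁ l₂).left.proj y = ⟨ψ.1.1.base, ψ.2.1⟩ →
        (levelSet 𝔻 l₁ l₂).top.proj x = (levelSet 𝔻 l₁ l₂).top.proj y →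
        ((levelSet 𝔻.verticalDual l₁ (sectionFunction 𝔻 σ)).top.aff φ ψ t).1.1.val
          ((levelSet 𝔻 l₁ l₂).top.aff x y t).1 = t * φ.1.1.val x.1 + (1 - t) * ψ.1.1.val y.1 := by
      intro x y hx hy hxy
      have hxy' : 𝔻.top.proj x.1 = 𝔻.top.proj y.1 := congrArg Subtype.val hxy
      rw [haff, levelSet_top_aff h hl₁ hxy']
      exact verticalDual_top_aff_val h hr (congrArg Subtype.val hx) (congrArg Subtype.val hy) hxy' t
    refine (pick_eq ⟨Subtype.ext hbase.2, fun x y hx hy hxy => hval x y hx hy hxy⟩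
      fun χ hχ => ?_).symm
    refine SpecialDual.ext (hχ.1.trans (Subtype.ext hbase.2).symm) fun z hz => ?_
    obtain ⟨x, y, hx, hy, hxy, rfl⟩ := exists_levelSet_top_aff h hl₁ hab t (hz.trans hχ.1)
    exact (hχ.2 x y hx hy hxy).trans (hval x y hx hy hxy).symm

end DoubleVector

/-! ### Isomorphisms of vector bundles -/

/-- A bijection which is the identity in suitable charts is an isomorphism of vector bundles. -/
theorem isVectorBundleIso_of_charts {E E' B : Type*} [DiffeologicalSpace E] [DiffeologicalSpace E']
    [DiffeologicalSpace B] {ξ : VectorBundleData E B} {η : VectorBundleData E' B} (e : E ≃ E')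
    (hξ : DSmooth ξ.proj) (hη : DSmooth η.proj)
    (H : ∀ b : B, ∃ U : Set B, IsOpen[dTopology] U ∧ b ∈ U ∧ ∃ (k : ℕ)
      (K : VectorBundleChart ξ U (Coord k)) (K' : VectorBundleChart η U (Coord k)),
      ∀ b v, e (K.pt b v) = K'.pt b v) : IsVectorBundleIso ξ η e := by
  have hproj : ∀ x, η.proj (e x) = ξ.proj x := fun x => by
    obtain ⟨U, -, hb, k, K, K', he⟩ := H (ξ.proj x)
    obtain ⟨b, hb⟩ := exists_coe_eq hb
    obtain ⟨v, rfl⟩ := K.exists_pt b hb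
    rw [he, K.proj_pt, K'.proj_pt]
  refine ⟨⟨fun n c hc => ?_, fun n c hc => ?_⟩, hproj, fun x y hxy => ?_, fun t x => ?_⟩
  · refine isPlot_of_local (hξ _ _ hc) fun b => ?_
    obtain ⟨U, hU, hb, k, K, K', he⟩ := H b
    refine ⟨U, hU, hb, fun m f hf hfU => ?_⟩
    have hcf : IsPlot fun v => c (f v) := isPlot_reparam hc hf
    have hfU' : ∀ v, ξ.proj (c (f v)) ∈ U := hfU
    have : (fun v => (e ∘ c) (f v)) = fun v => K'.pt ⟨_, hfU' v⟩ (K.coord (c (f v))) :=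
      funext fun v => by rw [← he, K.pt_coord]; rfl
    rw [this]
    exact K'.isPlot_pt (b := fun v => ⟨_, hfU' v⟩) (hξ _ _ hcf) (K.isPlot_coord hcf hfU')
  · refine isPlot_of_local (hη _ _ hc) fun b => ?_
    obtain ⟨U, hU, hb, k, K, K', he⟩ := H b
    refine ⟨U, hU, hb, fun m f hf hfU => ?_⟩
    have hcf : IsPlot fun v => c (f v) := isPlot_reparam hc hf
    have hfU' : ∀ v, η.proj (c (f v)) ∈ U := hfU
    have : (fun v => (e.symm ∘ c) (f v)) = fun v => K.pt ⟨_, hfU' v⟩ (K'.coord (c (f v))) :=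
      funext fun v => e.symm_apply_eq.2 (by rw [he, K'.pt_coord])
    rw [this]
    exact K.isPlot_pt (b := fun v => ⟨_, hfU' v⟩) (hη _ _ hcf) (K'.isPlot_coord hcf hfU')
  · obtain ⟨U, -, hb, k, K, K', he⟩ := H (ξ.proj x)
    obtain ⟨b, hb⟩ := exists_coe_eq hb
    obtain ⟨w, rfl⟩ := K.exists_pt b (hxy.symm.trans hb)
    obtain ⟨v, rfl⟩ := K.exists_pt b hb
    rw [K.add_pt, he, he, he, K'.add_pt]
  · obtain ⟨U, -, hb, k, K, K', he⟩ := H (ξ.proj x)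
    obtain ⟨b, hb⟩ := exists_coe_eq hb
    obtain ⟨v, rfl⟩ := K.exists_pt b hb
    rw [K.smul_pt, he, he, K'.smul_pt]

/-! ### Linear functions against affine functions on a level set, and linear functions as sections
of the dual -/

section Restriction

variable {E B : Type*} [DiffeologicalSpace E] [DiffeologicalSpace B] {ξ : VectorBundleData E B}
  {l : E → ℝ} {P : E → Prop} {pr : {x : E // P x} → B}

theorem AffineBundleData.AffineFunctions.ext {ζ : AffineBundleData E B} {f g : ζ.AffineFunctions}
    (hb : f.1.base = g.1.base) (hv : ∀ x, ζ.proj x = f.1.base → f.1.val x = g.1.val x) : f = g :=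
  Subtype.ext (FibreFunction.ext_fibre hb hv)

/-- Restriction of linear functions to a level set, as a bijection of the dual bundle onto the bundle
of affine functions. -/
def IsLevel.dualEquiv (h : IsLevel ξ l P pr id) (hξ : ξ.FibrePreserving) :
    ξ.Dual ≃ (ξ.toAffine.restrict P pr).AffineFunctions :=
  Equiv.ofBijective
    (fun φ => ⟨h.restrictDual φ φ.1.base rfl, h.isAffineMap_restrictDual hξ _ _ _⟩)
    ⟨fun φ ψ hφψ => h.dual_ext φ.1.base rfl (congrArg (fun f => f.1.base) hφψ).symm fun x _ =>
        congrArg (fun f => f.1.val x) hφψ,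
      fun f => by
        obtain ⟨φ, hb, hv⟩ := h.exists_dual f.1 f.2
        exact ⟨φ, AffineBundleData.AffineFunctions.ext hb fun x _ => hv x⟩⟩

/-- The extension argument gives the smooth bijection. The operations on both sides are pointwise,
so restriction commutes with them; `pick_eq` identifies those of the affine functions. -/
theorem IsLevel.isVectorBundleIso_dualEquiv (h : IsLevel ξ l P pr id) (hξ : ξ.FibrePreserving) :
    IsVectorBundleIso ξ.dual (ξ.toAffine.restrict P pr).affineFunctions (h.dualEquiv hξ) where
  diffeo := by
    refine ⟨fun n c hc => ?_, fun n c hc => ?_⟩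
    · exact h.isPlot_restrictDual (c := fun u => (c u).1.base) hc hc.1 fun _ => rfl
    · have he : ∀ u, h.dualEquiv hξ ((h.dualEquiv hξ).symm (c u)) = c u :=
        fun u => Equiv.apply_symm_apply _ _
      exact h.isPlot_dual (c := fun u => (h.dualEquiv hξ).symm (c u)) (f := fun u => (c u).1) hc
        (fun u => congrArg (fun f => f.1.base) (he u))
        fun u x _ => congrArg (fun f => f.1.val x) (he u)
  proj _ := rfl
  map_add φ ψ hφψ := by
    obtain ⟨h1, h2⟩ := VectorBundleData.dual_add_spec φ ψ hφψ
    have hval : ∀ x, (ξ.toAffine.restrict P pr).proj x = φ.1.base →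
        (ξ.dual.add φ ψ).1.val x.1 = φ.1.val x.1 + ψ.1.val x.1 :=
      fun x hx => h2 x.1 ((h.proj x).symm.trans hx)
    refine (pick_eq ⟨h1, hval⟩ fun χ hχ => ?_).symm
    exact AffineBundleData.AffineFunctions.ext (hχ.1.trans h1.symm) fun x hx =>
      (hχ.2 x (hx.trans hχ.1)).trans (hval x (hx.trans hχ.1)).symm
  map_smul t φ := by
    obtain ⟨h1, h2⟩ := VectorBundleData.dual_smul_spec t φ
    have hval : ∀ x, (ξ.toAffine.restrict P pr).proj x = φ.1.base →
        (ξ.dual.smul t φ).1.val x.1 = t * φ.1.val x.1 :=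
      fun x hx => h2 x.1 ((h.proj x).symm.trans hx)
    refine (pick_eq ⟨h1, hval⟩ fun χ hχ => ?_).symm
    exact AffineBundleData.AffineFunctions.ext (hχ.1.trans h1.symm) fun x hx =>
      (hχ.2 x (hx.trans hχ.1)).trans (hval x (hx.trans hχ.1)).symm

open Classical in
/-- A linear function as a section of the dual bundle. -/
def VectorBundleData.IsLinearFunction.toSection (hl : ξ.IsLinearFunction l) (hξ : ξ.FibrePreserving)
    (b : B) : ξ.Dual :=
  ⟨{ base := b
     val := fun x => if ξ.proj x = b then l x else 0
     val_off := fun _ hx => if_neg hx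
     smooth := fun n c hc hb => by
      simp only [hb, if_true]
      exact hl.smooth n c hc },
    fun x y hx hy => by
      have hxb : ξ.proj x = b := hx
      have hyb : ξ.proj y = b := hy
      have hxy := hxb.trans hyb.symm
      simp only [hxb, hyb, hξ.1 x y hxy, hl.map_add x y hxy, if_true],
    fun t x hx => by
      have hxb : ξ.proj x = b := hx
      simp only [hxb, hξ.2 t x, hl.map_smul t x, if_true]⟩

namespace VectorBundleData.IsLinearFunction

variable (hl : ξ.IsLinearFunction l) (hξ : ξ.FibrePreserving)

theorem toSection_val {b : B} {x : E} (hx : ξ.proj x = b) : (hl.toSection hξ b).1.val x = l x :=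
  if_pos hx

theorem dSmooth_toSection : DSmooth (hl.toSection hξ) := fun n c hc =>
  ⟨hc, fun k s x _ hx hb => by
    have hb' : ∀ v, ξ.proj (x v) = c (s v) := hb
    have : (fun v => (hl.toSection hξ (c (s v))).1.val (x v)) = fun v => l (x v) :=
      funext fun v => hl.toSection_val hξ (hb' v)
    exact (congrArg IsPlot this).mpr (hl.smooth _ _ hx)⟩

theorem toSection_ne_zero (hl' : ξ.FibrewiseNonzero l) (b : B) :
    ¬ ξ.dual.IsZero (hl.toSection hξ b) := fun h0 => by
  obtain ⟨x, hx, hlx⟩ := hl' b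
  have h1 := (VectorBundleData.dual_smul_spec 0 (hl.toSection hξ b)).2 x hx
  have h2 : ξ.dual.smul 0 (hl.toSection hξ b) = hl.toSection hξ b := h0
  rw [h2, hl.toSection_val hξ hx, zero_mul] at h1
  exact hlx h1

end VectorBundleData.IsLinearFunction

end Restriction

/-! ### The core of the vertical dual -/

section VerticalDualCore

variable {D D₁ D₂ M : Type*} [DiffeologicalSpace D] [DiffeologicalSpace D₁] [DiffeologicalSpace D₂]
  [DiffeologicalSpace M] {𝔻 : DoubleVectorBundleData D D₁ D₂ M}

/-- The core element `ψ` of the vertical dual is the pullback of `lam` to the fibre over a zero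
vector. -/
def IsPullback (lam : 𝔻.right.Dual) (ψ : 𝔻.verticalDual.Core) : Prop :=
  𝔻.bot.proj ψ.1.1.base = lam.1.base ∧
    ∀ x, 𝔻.left.proj x = ψ.1.1.base → ψ.1.1.val x = lam.1.val (𝔻.top.proj x)

namespace DoubleVectorChart

variable {U : Set M} {k₁ k₂ k₃ : ℕ} (C : DoubleVectorChart 𝔻 U k₁ k₂ k₃)
  (h : IsDoubleVectorBundle 𝔻)

/-- The dual chart of `D₂ → M`. -/
def rightDualChart : VectorBundleChart 𝔻.right.dual U (Coord k₂) :=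
  C.rightChart.dual (DualPairing.coord k₂)

theorem rightDualChart_val (m : U) (p v : Coord k₂) :
    (C.rightDualChart.pt m p).1.val (C.pt₂ m v) = inner ℝ v p :=
  C.rightChart.dualPt_val_pt (DualPairing.coord k₂) m p v

/-- The core element with coordinate p' takes the value ⟨v, p'⟩ at (0, v, w), and the pullback of
the functional with coefficient p takes the value ⟨v, p⟩. -/
theorem isPullback_pt (m : U) (p p' : Coord k₂) :
    IsPullback (C.rightDualChart.pt m p) ((C.verticalDual h).corePt m p') ↔ p' = p := by
  have hval : ∀ v w, ((C.verticalDual h).corePt m p').1.1.val (C.pt m 0 v w) = inner ℝ v p' :=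
    fun v w => (C.dualPt_val h m 0 0 p' v w).trans (by rw [inner_zero_right, add_zero])
  refine ⟨fun H => (DualPairing.coord k₂).ext fun v => ?_, fun hp => ⟨C.bot_pt₁ m 0, fun x hx => ?_⟩⟩
  · have := H.2 (C.pt m 0 v 0) (C.left_pt _ _ _ _)
    rwa [hval, C.top_pt, C.rightDualChart_val] at this
  · obtain ⟨v, w, rfl⟩ := C.exists_pt_left m hx
    rw [hval, C.top_pt, C.rightDualChart_val, hp]

end DoubleVectorChart

namespace IsDoubleVectorBundle

/-- With its counterpart below, makes the pullback relation the graph of a bijection. In coordinates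
both directions are the identity on p. -/
theorem existsUnique_isPullback (h : IsDoubleVectorBundle 𝔻) (lam : 𝔻.right.Dual) : ∃! ψ, IsPullback lam ψ := by
  obtain ⟨U, -, hm, k₁, k₂, k₃, ⟨C⟩⟩ := h.exists_chart lam.1.base
  obtain ⟨m, hm'⟩ := exists_coe_eq hm
  obtain ⟨p, rfl⟩ := C.rightDualChart.exists_pt m hm'
  refine ⟨(C.verticalDual h).corePt m p, (C.isPullback_pt h m p p).2 rfl, fun ψ hψ => ?_⟩
  obtain ⟨p', rfl⟩ := (C.verticalDual h).exists_corePt m (c := ψ) (hψ.1.trans hm')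
  rw [(C.isPullback_pt h m p p').1 hψ]

theorem existsUnique_isPullback' (h : IsDoubleVectorBundle 𝔻) (ψ : 𝔻.verticalDual.Core) :
    ∃! lam, IsPullback lam ψ := by
  obtain ⟨U, -, hm, k₁, k₂, k₃, ⟨C⟩⟩ := h.exists_chart (𝔻.bot.proj ψ.1.1.base)
  obtain ⟨m, hm'⟩ := exists_coe_eq hm
  obtain ⟨p, rfl⟩ := (C.verticalDual h).exists_corePt m (c := ψ) hm'
  refine ⟨C.rightDualChart.pt m p, (C.isPullback_pt h m p p).2 rfl, fun lam hlam => ?_⟩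
  obtain ⟨p', rfl⟩ := C.rightDualChart.exists_pt m (x := lam) (hlam.1.symm.trans hm')
  rw [(C.isPullback_pt h m p' p).1 hlam]

/-- The dual of `D₂` as the core of the vertical dual. -/
def pullbackEquiv (h : IsDoubleVectorBundle 𝔻) : 𝔻.right.Dual ≃ 𝔻.verticalDual.Core where
  toFun lam := (h.existsUnique_isPullback lam).choose
  invFun ψ := (h.existsUnique_isPullback' ψ).choose
  left_inv lam := ((h.existsUnique_isPullback' _).choose_spec.2 lam
    (h.existsUnique_isPullback lam).choose_spec.1).symm
  right_inv ψ := ((h.existsUnique_isPullback _).choose_spec.2 ψ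
    (h.existsUnique_isPullback' ψ).choose_spec.1).symm

theorem isPullback_pullbackEquiv (h : IsDoubleVectorBundle 𝔻) (lam : 𝔻.right.Dual) :
    IsPullback lam (h.pullbackEquiv lam) :=
  (h.existsUnique_isPullback lam).choose_spec.1

theorem pullbackEquiv_pt (h : IsDoubleVectorBundle 𝔻) {U : Set M} {k₁ k₂ k₃ : ℕ}
    (C : DoubleVectorChart 𝔻 U k₁ k₂ k₃) (m : U) (p : Coord k₂) :
    h.pullbackEquiv (C.rightDualChart.pt m p) = (C.verticalDual h).corePt m p :=
  (h.existsUnique_isPullback _).unique (h.isPullback_pullbackEquiv _)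
    ((C.isPullback_pt h m p p).2 rfl)

/-- The map is the identity between the chart of `D₂*` and the core chart of the vertical dual. -/
theorem isVectorBundleIso_pullbackEquiv (h : IsDoubleVectorBundle 𝔻) :
    IsVectorBundleIso 𝔻.right.dual 𝔻.verticalDual.core h.pullbackEquiv := by
  refine isVectorBundleIso_of_charts _ (fun _ _ hc => hc.1)
    (fun n c hc => ?_) fun m => ?_
  · have hc' : IsPlot fun u => (c u).1 := hc
    exact h.smooth_bot _ _ hc'.1
  · obtain ⟨U, hU, hm, k₁, k₂, k₃, ⟨C⟩⟩ := h.exists_chart m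
    exact ⟨U, hU, hm, k₂, C.rightDualChart,
      (C.verticalDual h).coreChart (isDoubleVectorBundle_verticalDual h), h.pullbackEquiv_pt C⟩

/-- In the vertical dual, translation by the core element p' takes (u, q, p) to (u, q, p + p'). The
base point and κ are therefore unchanged, and the functional grows by ⟨v, p'⟩, the value of λ at the
projection to `D₂`. -/
theorem translate_pullbackEquiv (h : IsDoubleVectorBundle 𝔻) {φ : 𝔻.left.Dual} {lam : 𝔻.right.Dual}
    (hb : 𝔻.bot.proj φ.1.base = lam.1.base) :
    (𝔻.verticalDual.translate φ (h.pullbackEquiv lam).1).1.base = φ.1.base ∧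
      𝔻.verticalDual.top.proj (𝔻.verticalDual.translate φ (h.pullbackEquiv lam).1) =
        𝔻.verticalDual.top.proj φ ∧
      ∀ x, 𝔻.left.proj x = φ.1.base →
        (𝔻.verticalDual.translate φ (h.pullbackEquiv lam).1).1.val x =
          φ.1.val x + lam.1.val (𝔻.top.proj x) := by
  obtain ⟨U, -, hm, k₁, k₂, k₃, ⟨C⟩⟩ := h.exists_chart (𝔻.bot.proj φ.1.base)
  obtain ⟨m, hm'⟩ := exists_coe_eq hm
  obtain ⟨u, q, p, rfl⟩ := C.exists_dualPt h hm'
  obtain ⟨p', rfl⟩ := C.rightDualChart.exists_pt m (x := lam) (hb.symm.trans hm')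
  have e : 𝔻.verticalDual.translate (C.dualPt h m u q p)
      (h.pullbackEquiv (C.rightDualChart.pt m p')).1 = C.dualPt h m u q (p + p') := by
    rw [h.pullbackEquiv_pt]
    exact (C.verticalDual h).translate_pt m u q p p'
  rw [e, C.verticalDual_top_dualPt, C.verticalDual_top_dualPt]
  refine ⟨rfl, rfl, fun x hx => ?_⟩
  obtain ⟨v, w, rfl⟩ := C.exists_pt_left m hx
  rw [C.dualPt_val, C.dualPt_val, C.top_pt, C.rightDualChart_val, inner_add_right]
  ring

theorem isSpecialSection_pullbackEquiv (h : IsDoubleVectorBundle 𝔻) {l₂ : D₂ → ℝ}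
    (hl₂ : 𝔻.right.IsLinearFunction l₂) (hl₂' : 𝔻.right.FibrewiseNonzero l₂) :
    IsSpecialSection 𝔻.verticalDual fun m => h.pullbackEquiv (hl₂.toSection h.right_fibre m) where
  smooth := h.isVectorBundleIso_pullbackEquiv.diffeo.1.comp (hl₂.dSmooth_toSection h.right_fibre)
  proj _ := h.isVectorBundleIso_pullbackEquiv.proj _
  ne_zero m h0 := hl₂.toSection_ne_zero h.right_fibre hl₂' m <| h.pullbackEquiv.injective <|
    (h.isVectorBundleIso_pullbackEquiv.map_smul 0 _).trans h0

end IsDoubleVectorBundle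
end VerticalDualCore

end DoubleAffine

end

/-! ### The main theorem -/

open DoubleAffine in
theorem mainTheorem3 {E : Type*} [NormedAddCommGroup E] [NormedSpace ℝ E] [FiniteDimensional ℝ E]
    {M : Type*} [TopologicalSpace M] [ChartedSpace E M] [IsManifold 𝓘(ℝ, E) ∞ M]
    [DiffeologicalSpace M] [IsManifoldDiffeology E M]
    {D D₁ D₂ : Type*} [DiffeologicalSpace D] [DiffeologicalSpace D₁] [DiffeologicalSpace D₂]
    -- the double vector bundle `(D; D₁, D₂; M)`
    (𝔻 : DoubleVectorBundleData D D₁ D₂ M) (h𝔻 : IsDoubleVectorBundle 𝔻)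
    -- the linear functions that cut out `A`
    (l₁ : D₁ → ℝ) (hl₁ : 𝔻.bot.IsLinearFunction l₁) (hl₁' : 𝔻.bot.FibrewiseNonzero l₁)
    (l₂ : D₂ → ℝ) (hl₂ : 𝔻.right.IsLinearFunction l₂) (hl₂' : 𝔻.right.FibrewiseNonzero l₂)
    -- the distinguished section of the core bundle `D₃`
    (σ : M → 𝔻.Core) (hσ : IsSpecialSection 𝔻 σ) :
    -- the vertical dual is a double vector bundle, `l₃` is a fibrewise nonzero linear function on
    -- `D₃*`, and `l₁`, `l₃` determine a double affine bundle in the vertical dual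
    IsDoubleVectorBundle 𝔻.verticalDual ∧
    𝔻.core.dual.IsLinearFunction (sectionFunction 𝔻 σ) ∧
    𝔻.core.dual.FibrewiseNonzero (sectionFunction 𝔻 σ) ∧
    IsDoubleAffineBundle (levelSet 𝔻.verticalDual l₁ (sectionFunction 𝔻 σ)) ∧
    -- the special double affine dual `A#` is a double affine bundle
    IsDoubleAffineBundle (specialDual h𝔻 l₁ l₂ hσ) ∧
    -- restriction of functionals to the fibres of `A → A₁` is an isomorphism between the two
    ∃ e : {φ : 𝔻.left.Dual // l₁ (𝔻.verticalDual.left.proj φ) = 1 ∧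
        sectionFunction 𝔻 σ (𝔻.verticalDual.top.proj φ) = 1} ≃ SpecialDual 𝔻 l₁ l₂ σ,
      IsDoubleAffineIso (levelSet 𝔻.verticalDual l₁ (sectionFunction 𝔻 σ))
        (specialDual h𝔻 l₁ l₂ hσ) e ∧
      (∀ φ x, (levelSet 𝔻 l₁ l₂).left.proj x = (e φ).1.base →
        (e φ).1.val x = φ.1.1.val x.1) ∧
      -- `D₂*` is the core of the vertical dual, `λ` corresponding to the pullback of `λ` to the
      -- fibre of `D` over the zero vector of `D₁`
      ∃ Ψ : 𝔻.right.Dual ≃ 𝔻.verticalDual.Core,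
        IsVectorBundleIso 𝔻.right.dual 𝔻.verticalDual.core Ψ ∧
        (∀ lam x, 𝔻.left.proj x = (Ψ lam).1.1.base →
          (Ψ lam).1.1.val x = lam.1.val (𝔻.top.proj x)) ∧
        -- `D₂*` is isomorphic to `A₂†` by restriction of linear functions to `A₂`
        ∃ R : 𝔻.right.Dual ≃ (levelSet 𝔻 l₁ l₂).right.AffineFunctions,
          IsVectorBundleIso 𝔻.right.dual (levelSet 𝔻 l₁ l₂).right.affineFunctions R ∧
          (∀ lam z, (levelSet 𝔻 l₁ l₂).right.proj z = lam.1.base →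
            (R lam).1.val z = lam.1.val z.1) ∧
          -- under `e`, translation by the core element `λ` becomes addition of `R λ`
          (∀ φ lam, 𝔻.bot.proj (𝔻.verticalDual.left.proj φ.1) = 𝔻.right.dual.proj lam →
            ∃ φ', φ'.1 = 𝔻.verticalDual.translate φ.1 (Ψ lam).1 ∧
              (e φ').1.base = (e φ).1.base ∧
              ∀ x, (levelSet 𝔻 l₁ l₂).left.proj x = (e φ).1.base →
                (e φ').1.val x =
                  (e φ).1.val x + (R lam).1.val ((levelSet 𝔻 l₁ l₂).top.proj x)) ∧
          -- `l₂` is a nowhere vanishing section of the core `D₂*`, it corresponds to `1` on `A₂`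
          ∃ s₂ : M → 𝔻.right.Dual,
            (∀ m z, 𝔻.right.proj z = m → (s₂ m).1.val z = l₂ z) ∧
            (∀ m, 𝔻.right.dual.proj (s₂ m) = m) ∧
            IsSpecialSection 𝔻.verticalDual (fun m => Ψ (s₂ m)) ∧
            ∀ m z, (levelSet 𝔻 l₁ l₂).right.proj z = m → (R (s₂ m)).1.val z = 1 := by
  have hV := isDoubleVectorBundle_verticalDual h𝔻
  have hl₃ := isLinearFunction_sectionFunction hσ
  have hl₃' := fibrewiseNonzero_sectionFunction h𝔻 hσ
  have hA := isDoubleAffineBundle_levelSet hV hl₁ hl₁' hl₃ hl₃'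
  have he := isDoubleAffineIso_restrictEquiv h𝔻 hl₁ hl₂ hl₂' hσ
  have hL := h𝔻.isLevel_right hl₂ hl₂'
  refine ⟨hV, hl₃, hl₃', hA, he.isDoubleAffineBundle hA, restrictEquiv h𝔻 hl₂ hl₂' hσ, he,
    fun _ _ _ => rfl, h𝔻.pullbackEquiv, h𝔻.isVectorBundleIso_pullbackEquiv,
    fun lam => (h𝔻.isPullback_pullbackEquiv lam).2, hL.dualEquiv h𝔻.right_fibre,
    hL.isVectorBundleIso_dualEquiv h𝔻.right_fibre, fun _ _ _ => rfl, fun φ lam hb => ?_,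
    hl₂.toSection h𝔻.right_fibre, fun m z hz => hl₂.toSection_val h𝔻.right_fibre hz,
    fun _ => rfl, h𝔻.isSpecialSection_pullbackEquiv hl₂ hl₂',
    -- On `A₂` the function `l₂` is 1 by definition, so the section given by `l₂` restricts to the
    -- constant 1.
    fun m z hz => (hl₂.toSection_val h𝔻.right_fibre hz).trans z.2⟩
  obtain ⟨h1, h2, h3⟩ := h𝔻.translate_pullbackEquiv hb
  -- Translation by a core element changes neither projection, so both level conditions persist.
  exact ⟨⟨_, (congrArg l₁ h1).trans φ.2.1, (congrArg (sectionFunction 𝔻 σ) h2).trans φ.2.2⟩, rfl,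
    Subtype.ext h1, fun x hx => h3 x.1 (congrArg Subtype.val hx)⟩
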